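/- Let $T>0$, $\bar a>0$, $\lambda,\alpha,\beta\in\mathbb R$, let $a,f\in C^2[0,T]$ and $K\in C^2([0,T]^2)$ with $a(\xi)\ge\bar a$ on $[0,T]$, put $\bar K=\max_{\xi\in[0,T]}\int_0^T|K(\xi,\zeta)|\,d\zeta$, and assume $|\lambda|\,\bar K\,T<\bar a$. For $0<\varepsilon\le 1$ let $v\in C[0,T]\cap C^2(0,T)$ solve $$\varepsilon v''(\xi)+a(\xi)v'(\xi)=f(\xi)+\lambda\int_0^T K(\xi,\eta)v(\eta)\,d\eta\quad(0<\xi<T),\qquad v(0)=\alpha,\ v(T)=\beta. \tag{P}$$ For even $N\ge 2$ let $\rho=\min\{T/2,\ \bar a^{-1}\varepsilon\ln N\}$, $\xi_i=\frac{2\rho}{N}i$ for $0\le i\le N/2$ and $\xi_i=\rho+\frac{2(T-\rho)}{N}\left(i-\frac N2\right)$ for $N/2<i\le N$. Write $h_i=\xi_i-\xi_{i-1}$, $\hbar_i=\frac{h_i+h_{i+1}}2$ $(1\le i\le N-1)$, $\hbar_0=\frac{h_1}2$, $\hbar_N=\frac{h_N}2$, and, with $g_i=g(\xi_i)$ for a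 function $g$, $$g_{\bar\xi,i}=\frac{g_i-g_{i-1}}{h_i},\quad g_{\xi,i}=\frac{g_{i+1}-g_i}{h_{i+1}},\quad g_{\bar\xi\xi,i}=\frac{g_{\xi,i}-g_{\bar\xi,i}}{\hbar_i},\quad g_{\overset{0}{\xi},i}=\frac{g_{i+1}-g_{i-1}}{2\hbar_i}.$$ For $1\le i\le N-1$ set $$\chi^{(1)}_i=\hbar_i^{-1}\Big[\frac{\varepsilon}{a_i}-\frac{h_i}{e^{a_ih_i/\varepsilon}-1}\Big],\qquad \chi^{(2)}_i=\hbar_i^{-1}\Big[\frac{h_{i+1}}{1-e^{-a_ih_{i+1}/\varepsilon}}-\frac{\varepsilon}{a_i}\Big],$$ $$\gamma^{(1)}_i=\hbar_i^{-1}\Big[\frac{h_i(\frac{\varepsilon}{a_i}-\xi_{i-1})+\frac{\xi_i^2-\xi_{i-1}^2}2}{e^{a_ih_i/\varepsilon}-1}-\frac{\varepsilon^2}{a_i^2}\Big],\qquad \gamma^{(2)}_i=\hbar_i^{-1}\Big[\frac{h_{i+1}(\xi_{i+1}-\frac{\varepsilon}{a_i})-\frac{\xi_{i+1}^2-\xi_i^2}2}{1-e^{-a_ih_{i+1}/\varepsilon}}+\frac{\varepsilon^2}{a_i^2}\Big],$$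 $$\hat a^{(k)}_i=a_i\chi^{(k)}_i+a_{\xi,i}\gamma^{(k)}_i\ (k=1,2),\quad \theta_i=1-\frac{\hat a^{(1)}_ih_{i+1}}{2\varepsilon}+\frac{\hat a^{(2)}_ih_i}{2\varepsilon},\quad A_i=\hat a^{(1)}_i+\hat a^{(2)}_i,$$ $$\hat f_i=f_i(\chi^{(1)}_i+\chi^{(2)}_i)+f_{\xi,i}(\gamma^{(1)}_i+\gamma^{(2)}_i),\quad \mathcal K_{ij}=K(\xi_i,\xi_j)(\chi^{(1)}_i+\chi^{(2)}_i)+\frac{\partial K}{\partial\xi}(\xi_i,\xi_j)(\gamma^{(1)}_i+\gamma^{(2)}_i),$$ and let $y=(y_0,\dots,y_N)$ solve the exponentially fitted difference scheme $$\varepsilon\theta_i\,y_{\bar\xi\xi,i}+A_i\,y_{\overset{0}{\xi},i}=\hat f_i+\lambda\sum_{j=0}^{N}\hbar_j\mathcal K_{ij}y_j\quad(1\le i\le N-1),\qquad y_0=\alpha,\ y_N=\beta. \tag{S}$$ Then there are constants $C$ and $N_0$, depending only on $T,\bar a,a,f,K,\lambda,\alpha,\beta$ and not on $\varepsilon$ or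 $N$, such that for all $\varepsilon\in(0,1]$, all even $N\ge N_0$, every solution $v$ of (P) and every solution $y$ of (S), $$\max_{0\le i\le N}|v(\xi_i)-y_i|\le C\,N^{-2}\ln N.$$ -/

import Mathlib

open Set MeasureTheory

namespace FredholmScheme

/-! ### The continuous problem -/

/-- The constant `max_{ξ ∈ [0,T]} ∫_0^T |K(ξ,ζ)| dζ`. -/
noncomputable def kernelBound (T : ℝ) (K : ℝ → ℝ → ℝ) : ℝ :=
  sSup ((fun ξ => ∫ ζ in (0 : ℝ)..T, |K ξ ζ|) '' Icc 0 T)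

/-- `v` is a classical solution (in `C[0,T] ∩ C²(0,T)`) of
`ε v'' + a v' = f + lam ∫_0^T K(·,η) v(η) dη` on `(0,T)`, `v(0) = α`, `v(T) = β`. -/
structure IsSolution (T ε lam α β : ℝ) (a f : ℝ → ℝ) (K : ℝ → ℝ → ℝ) (v : ℝ → ℝ) : Prop where
  continuousOn : ContinuousOn v (Icc 0 T)
  contDiffOn : ContDiffOn ℝ 2 v (Ioo 0 T)
  equation : ∀ ξ ∈ Ioo 0 T,
    ε * deriv (deriv v) ξ + a ξ * deriv v ξ = f ξ + lam * ∫ η in (0 : ℝ)..T, K ξ η * v η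
  left_bc : v 0 = α
  right_bc : v T = β

/-! ### The piecewise uniform mesh -/

/-- The transition point `ρ = min {T/2, ε ln N / abar}`. -/
noncomputable def transition (T abar ε : ℝ) (N : ℕ) : ℝ :=
  min (T / 2) (abar⁻¹ * ε * Real.log N)

/-- The mesh points `ξ_0, …, ξ_N` (for even `N`): `N/2` equal steps in each of `[0,ρ]`, `[ρ,T]`. -/
noncomputable def mesh (T abar ε : ℝ) (N : ℕ) (i : ℕ) : ℝ :=
  if i ≤ N / 2 then (i : ℝ) * (2 * transition T abar ε N / N)
  else ((i : ℝ) - (N : ℝ) / 2) * (2 * (T - transition T abar ε N) / N) + transition T abar ε N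

/-! ### Difference quotients of mesh functions on a mesh `x 0 < x 1 < … < x N` -/

/-- `h_i = x_i - x_{i-1}` (used for `1 ≤ i ≤ N`). -/
def step (x : ℕ → ℝ) (i : ℕ) : ℝ := x i - x (i - 1)

/-- `ħ_0 = h_1 / 2`, `ħ_N = h_N / 2`, and `ħ_i = (h_i + h_{i+1}) / 2` otherwise. -/
noncomputable def hbar (N : ℕ) (x : ℕ → ℝ) (i : ℕ) : ℝ :=
  if i = 0 then step x 1 / 2
  else if i = N then step x N / 2
  else (step x i + step x (i + 1)) / 2

/-- Backward difference quotient. -/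
noncomputable def bwdDiff (x φ : ℕ → ℝ) (i : ℕ) : ℝ := (φ i - φ (i - 1)) / step x i

/-- Forward difference quotient. -/
noncomputable def fwdDiff (x φ : ℕ → ℝ) (i : ℕ) : ℝ := (φ (i + 1) - φ i) / step x (i + 1)

/-- Second difference quotient. -/
noncomputable def secondDiff (N : ℕ) (x φ : ℕ → ℝ) (i : ℕ) : ℝ :=
  (fwdDiff x φ i - bwdDiff x φ i) / hbar N x i

/-- Central difference quotient. -/
noncomputable def centralDiff (N : ℕ) (x φ : ℕ → ℝ) (i : ℕ) : ℝ :=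
  (φ (i + 1) - φ (i - 1)) / (2 * hbar N x i)

/-- The discrete maximum norm `max_{0 ≤ i ≤ N} |φ_i|`. -/
def maxNorm (N : ℕ) (φ : ℕ → ℝ) : ℝ :=
  (Finset.range (N + 1)).sup' Finset.nonempty_range_add_one (fun i => |φ i|)

/-! ### Coefficients of the exponentially fitted scheme

With the exponential basis function `ψ_i` (`ε ψ'' = a_i ψ'` on the two cells next to `x_i`,
`ψ_i(x_i) = 1`, `ψ_i(x_{i-1}) = ψ_i(x_{i+1}) = 0`), `chi1`, `chi2` are `ħ_i⁻¹ ∫ ψ_i` and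
`gamma1`, `gamma2` are `ħ_i⁻¹ ∫ (ξ - x_i) ψ_i(ξ) dξ` over the left and the right cell. -/

noncomputable def chi1 (ε : ℝ) (a : ℝ → ℝ) (N : ℕ) (x : ℕ → ℝ) (i : ℕ) : ℝ :=
  (hbar N x i)⁻¹ * (ε / a (x i) - step x i / (Real.exp (a (x i) * step x i / ε) - 1))

noncomputable def chi2 (ε : ℝ) (a : ℝ → ℝ) (N : ℕ) (x : ℕ → ℝ) (i : ℕ) : ℝ :=
  (hbar N x i)⁻¹ *
    (step x (i + 1) / (1 - Real.exp (-(a (x i) * step x (i + 1) / ε))) - ε / a (x i))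

noncomputable def gamma1 (ε : ℝ) (a : ℝ → ℝ) (N : ℕ) (x : ℕ → ℝ) (i : ℕ) : ℝ :=
  (hbar N x i)⁻¹ *
    (1 / (Real.exp (a (x i) * step x i / ε) - 1) *
        (step x i * (ε / a (x i) - x (i - 1)) + (x i ^ 2 / 2 - x (i - 1) ^ 2 / 2))
      - ε ^ 2 / a (x i) ^ 2)

noncomputable def gamma2 (ε : ℝ) (a : ℝ → ℝ) (N : ℕ) (x : ℕ → ℝ) (i : ℕ) : ℝ :=
  (hbar N x i)⁻¹ *
    (1 / (1 - Real.exp (-(a (x i) * step x (i + 1) / ε))) *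
        (step x (i + 1) * (x (i + 1) - ε / a (x i)) - (x (i + 1) ^ 2 / 2 - x i ^ 2 / 2))
      + ε ^ 2 / a (x i) ^ 2)

/-- `â_i^{(1)} = a_i χ_i^{(1)} + a_{ξ,i} γ_i^{(1)}`. -/
noncomputable def aHat1 (ε : ℝ) (a : ℝ → ℝ) (N : ℕ) (x : ℕ → ℝ) (i : ℕ) : ℝ :=
  a (x i) * chi1 ε a N x i + fwdDiff x (fun k => a (x k)) i * gamma1 ε a N x i

/-- `â_i^{(2)} = a_i χ_i^{(2)} + a_{ξ,i} γ_i^{(2)}`. -/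
noncomputable def aHat2 (ε : ℝ) (a : ℝ → ℝ) (N : ℕ) (x : ℕ → ℝ) (i : ℕ) : ℝ :=
  a (x i) * chi2 ε a N x i + fwdDiff x (fun k => a (x k)) i * gamma2 ε a N x i

/-- The fitting factor `θ_i`. -/
noncomputable def theta (ε : ℝ) (a : ℝ → ℝ) (N : ℕ) (x : ℕ → ℝ) (i : ℕ) : ℝ :=
  1 - aHat1 ε a N x i * step x (i + 1) / (2 * ε) + aHat2 ε a N x i * step x i / (2 * ε)

/-- The convection coefficient `A_i`. -/
noncomputable def coeffA (ε : ℝ) (a : ℝ → ℝ) (N : ℕ) (x : ℕ → ℝ) (i : ℕ) : ℝ :=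
  aHat1 ε a N x i + aHat2 ε a N x i

/-- The discrete right-hand side `f̂_i`. -/
noncomputable def fHat (ε : ℝ) (a f : ℝ → ℝ) (N : ℕ) (x : ℕ → ℝ) (i : ℕ) : ℝ :=
  f (x i) * (chi1 ε a N x i + chi2 ε a N x i)
    + fwdDiff x (fun k => f (x k)) i * (gamma1 ε a N x i + gamma2 ε a N x i)

/-- The discrete kernel `𝒦_{ij}`; the derivative is `∂K/∂ξ` at `(x_i, x_j)`. -/
noncomputable def discreteKernel (ε : ℝ) (a : ℝ → ℝ) (K : ℝ → ℝ → ℝ) (N : ℕ) (x : ℕ → ℝ)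
    (i j : ℕ) : ℝ :=
  K (x i) (x j) * (chi1 ε a N x i + chi2 ε a N x i)
    + deriv (fun ξ => K ξ (x j)) (x i) * (gamma1 ε a N x i + gamma2 ε a N x i)

/-- `y_0, …, y_N` solves the exponentially fitted difference scheme on the mesh `x`. -/
structure IsDiscreteSolution (ε lam α β : ℝ) (a f : ℝ → ℝ) (K : ℝ → ℝ → ℝ)
    (N : ℕ) (x y : ℕ → ℝ) : Prop where
  equation : ∀ i, 1 ≤ i → i ≤ N - 1 →
    ε * theta ε a N x i * secondDiff N x y i + coeffA ε a N x i * centralDiff N x y i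
      = fHat ε a f N x i
        + lam * ∑ j ∈ Finset.range (N + 1), hbar N x j * discreteKernel ε a K N x i j * y j
  left_bc : y 0 = α
  right_bc : y N = β

end FredholmScheme

namespace FredholmScheme

/-! ### Stability of the difference scheme -/

/-- Two-point recurrences with a positive dominated coefficient have summable solutions. -/
theorem sum_recurrence_le {n : ℕ} {c : ℝ} {G g e E : ℕ → ℝ}
    (hg : ∀ j, 0 ≤ g j) (hGg : ∀ j < n, c + g (j + 1) ≤ G j) (hE : ∀ j, 0 ≤ E j) (hE0 : E 0 = 0)
    (hrec : ∀ j < n, E (j + 1) * G j = E j * g j + e j) :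
    c * ∑ j ∈ Finset.range (n + 1), E j ≤ ∑ j ∈ Finset.range n, e j := by
  have key : ∀ m ≤ n, c * ∑ j ∈ Finset.range (m + 1), E j + E m * g m
      ≤ ∑ j ∈ Finset.range m, e j := by
    intro m
    induction m with
    | zero => intro _; simp [hE0]
    | succ m ih =>
      intro hm
      have h1 := ih (by omega)
      rw [Finset.sum_range_succ E (m + 1), Finset.sum_range_succ e m]
      have h2 := hrec m (by omega)
      have h3 := mul_le_mul_of_nonneg_left (hGg m (by omega)) (hE (m + 1))
      nlinarith
  have := key n le_rfl
  have := mul_nonneg (hE n) (hg n)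
  linarith

/-- Stability of the two-point recurrence `d_{j+1} G_j - d_j g_j = r_j` with vanishing sum. -/
theorem recurrence_stability {n : ℕ} {c s : ℝ} {G g a Ψ h e d r : ℕ → ℝ} (hc : 0 < c) (hs : 0 ≤ s)
    (hg : ∀ j, 0 ≤ g j) (hGg : ∀ j < n, c + g (j + 1) ≤ G j)
    (hh : ∀ j, 0 ≤ h j) (ha : ∀ j, c ≤ a j) (hΨ : ∀ j < n, 0 ≤ Ψ j) (he : ∀ j, 0 ≤ e j)
    (hlin : ∀ j < n, h (j + 1) * G j - h j * g j = a j * Ψ j)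
    (hr : ∀ j < n, |r j| ≤ s * Ψ j + e j)
    (hd : ∀ j < n, d (j + 1) * G j - d j * g j = r j)
    (hsum : ∑ j ∈ Finset.range (n + 1), d j = 0) :
    ∃ D : ℝ, (∀ k ≤ n + 1, |∑ j ∈ Finset.range k, d j| ≤ D) ∧
      ∑ j ∈ Finset.range (n + 1), |d j| ≤ 2 * D ∧
      D ≤ s / c * ∑ j ∈ Finset.range (n + 1), h j + c⁻¹ * ∑ j ∈ Finset.range n, e j := by
  have hGpos : ∀ j < n, 0 < G j := fun j hj => by linarith [hGg j hj, hg (j + 1)]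
  -- the dominating sequence
  let E : ℕ → ℝ := fun j => Nat.rec 0 (fun j x => (x * g j + e j) / |G j|) j
  have hE0 : E 0 = 0 := rfl
  have hEs : ∀ j, E (j + 1) = (E j * g j + e j) / |G j| := fun j => rfl
  have hEn : ∀ j, 0 ≤ E j := by
    intro j
    induction j with
    | zero => exact hE0.ge
    | succ j ih =>
      rw [hEs]
      have := mul_nonneg ih (hg j)
      have := he j
      positivity
  have hErec : ∀ j < n, E (j + 1) * G j = E j * g j + e j := by
    intro j hj
    rw [hEs, abs_of_pos (hGpos j hj)]
    field_simp [(hGpos j hj).ne']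
  have hEsum := sum_recurrence_le hg hGg hEn hE0 hErec
  -- the homogeneous solution
  let u : ℕ → ℝ := fun j => Nat.rec 1 (fun j x => x * g j / |G j|) j
  have hu0 : u 0 = 1 := rfl
  have hus : ∀ j, u (j + 1) = u j * g j / |G j| := fun j => rfl
  have hun : ∀ j, 0 ≤ u j := by
    intro j
    induction j with
    | zero => rw [hu0]; exact zero_le_one
    | succ j ih =>
      rw [hus]
      have := mul_nonneg ih (hg j)
      positivity
  have hurec : ∀ j < n, u (j + 1) * G j = u j * g j := by
    intro j hj
    rw [hus, abs_of_pos (hGpos j hj)]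
    field_simp [(hGpos j hj).ne']
  set S := ∑ j ∈ Finset.range (n + 1), u j with hS
  have hS1 : 1 ≤ S := by
    have := Finset.single_le_sum (f := u) (fun j _ => hun j)
      (Finset.mem_range.2 (Nat.succ_pos n) : 0 ∈ Finset.range (n + 1))
    rwa [hu0] at this
  let q : ℕ → ℝ := fun j => d j - d 0 * u j
  have hqb : ∀ j ≤ n, |q j| ≤ s / c * h j + E j := by
    intro j
    induction j with
    | zero =>
      intro _
      have := hh 0
      have hq0 : q 0 = 0 := by simp [q, hu0]
      rw [hq0, hE0, abs_zero]
      positivity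
    | succ j ih =>
      intro hj
      have hj' : j < n := by omega
      have h1 := ih (by omega)
      have h2 : q (j + 1) * G j = q j * g j + r j := by
        simp only [q]
        linear_combination hd j hj' - d 0 * hurec j hj'
      have hG := hGpos j hj'
      have h3 : |q (j + 1)| * G j ≤ (s / c * h (j + 1) + E (j + 1)) * G j := by
        calc |q (j + 1)| * G j = |q j * g j + r j| := by rw [← h2, abs_mul, abs_of_pos hG]
          _ ≤ |q j| * g j + |r j| := by
            refine (abs_add_le _ _).trans ?_
            rw [abs_mul, abs_of_nonneg (hg j)]
          _ ≤ (s / c * h j + E j) * g j + (s * Ψ j + e j) :=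
            add_le_add (mul_le_mul_of_nonneg_right h1 (hg j)) (hr j hj')
          _ ≤ (s / c * h j + E j) * g j + (s / c * (a j * Ψ j) + e j) := by
            have : s * Ψ j ≤ s / c * (a j * Ψ j) := by
              have h5 := mul_le_mul_of_nonneg_left
                (mul_le_mul_of_nonneg_right (ha j) (hΨ j hj')) (div_nonneg hs hc.le)
              have h6 : s / c * (c * Ψ j) = s * Ψ j := by field_simp
              linarith
            linarith
          _ = (s / c * h (j + 1) + E (j + 1)) * G j := by
            rw [← hlin j hj', add_mul, add_mul, hErec j hj']
            ring
      exact le_of_mul_le_mul_right h3 hG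
  set D := ∑ j ∈ Finset.range (n + 1), |q j| with hD
  have hQ : ∑ j ∈ Finset.range (n + 1), q j = - (d 0 * S) := by
    simp only [q, Finset.sum_sub_distrib, hsum, ← Finset.mul_sum]
    ring
  have hQD : |d 0 * S| ≤ D := by
    rw [← abs_neg, ← hQ]
    exact Finset.abs_sum_le_sum_abs _ _
  refine ⟨D, ?_, ?_, ?_⟩
  · intro k hk
    have hsub : Finset.range k ⊆ Finset.range (n + 1) := Finset.range_subset_range.2 hk
    set P := ∑ j ∈ Finset.range k, q j
    set U := ∑ j ∈ Finset.range k, u j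
    set Q := ∑ j ∈ Finset.range (n + 1) \ Finset.range k, q j
    have hPQ : Q + P = - (d 0 * S) := by rw [← hQ]; exact Finset.sum_sdiff hsub
    have hZ : ∑ j ∈ Finset.range k, d j = P + d 0 * U := by
      simp only [P, U, q, Finset.sum_sub_distrib, ← Finset.mul_sum]
      ring
    have hU0 : 0 ≤ U := Finset.sum_nonneg fun j _ => hun j
    have hUS : U ≤ S := Finset.sum_le_sum_of_subset_of_nonneg hsub fun j _ _ => hun j
    have hPQD : |Q| + |P| ≤ D := by
      refine (add_le_add (Finset.abs_sum_le_sum_abs _ _) (Finset.abs_sum_le_sum_abs _ _)).trans ?_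
      rw [Finset.sum_sdiff hsub]
    have hSp : 0 < S := by linarith
    have ht0 : 0 ≤ U / S := by positivity
    have ht1 : U / S ≤ 1 := (div_le_one hSp).2 hUS
    have hZ' : ∑ j ∈ Finset.range k, d j = (1 - U / S) * P - U / S * Q := by
      rw [hZ]
      have : d 0 = -(Q + P) / S := by field_simp; linarith
      rw [this]
      field_simp
      ring
    rw [hZ']
    refine (abs_sub _ _).trans ?_
    rw [abs_mul, abs_mul, abs_of_nonneg ht0, abs_of_nonneg (by linarith : 0 ≤ 1 - U / S)]
    nlinarith [abs_nonneg P, abs_nonneg Q]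
  · have : ∀ j, |d j| ≤ |q j| + |d 0| * u j := by
      intro j
      have h1 : d j = q j + d 0 * u j := by simp [q]
      calc |d j| = |q j + d 0 * u j| := by rw [← h1]
        _ ≤ _ := (abs_add_le _ _).trans (by rw [abs_mul (d 0), abs_of_nonneg (hun j)])
    refine (Finset.sum_le_sum fun j _ => this j).trans ?_
    rw [Finset.sum_add_distrib, ← Finset.mul_sum]
    rw [abs_mul, abs_of_nonneg (by linarith : 0 ≤ S)] at hQD
    linarith
  · refine (Finset.sum_le_sum fun j hj => hqb j (by
      have := Finset.mem_range.1 hj; omega)).trans ?_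
    rw [Finset.sum_add_distrib, ← Finset.mul_sum]
    have : ∑ j ∈ Finset.range (n + 1), E j ≤ c⁻¹ * ∑ j ∈ Finset.range n, e j := by
      rw [inv_mul_eq_div, le_div_iff₀ hc]
      linarith
    linarith

/-! ### The exponential weights -/

/-- The weight `a / (exp (a h / ε) - 1)` of the fitted scheme. -/
noncomputable def expWeight (ε a h : ℝ) : ℝ := a / (Real.exp (a * h / ε) - 1)

theorem exp_sub_one_pos {ε a h : ℝ} (hε : 0 < ε) (ha : 0 < a) (hh : 0 < h) :
    0 < Real.exp (a * h / ε) - 1 := by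
  have : 0 < a * h / ε := by positivity
  linarith [Real.add_one_lt_exp this.ne']

theorem one_sub_exp_neg_pos {ε a h : ℝ} (hε : 0 < ε) (ha : 0 < a) (hh : 0 < h) :
    0 < 1 - Real.exp (-(a * h / ε)) := by
  have : 0 < a * h / ε := by positivity
  have := Real.exp_lt_exp.2 (neg_lt_zero.2 this)
  rw [Real.exp_zero] at this
  linarith

theorem expWeight_pos {ε a h : ℝ} (hε : 0 < ε) (ha : 0 < a) (hh : 0 < h) :
    0 < expWeight ε a h := div_pos ha (exp_sub_one_pos hε ha hh)

theorem add_expWeight {ε a h : ℝ} (hε : 0 < ε) (ha : 0 < a) (hh : 0 < h) :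
    a + expWeight ε a h = a / (1 - Real.exp (-(a * h / ε))) := by
  have h1 := exp_sub_one_pos hε ha hh
  have h2 := one_sub_exp_neg_pos hε ha hh
  rw [expWeight, Real.exp_neg] at *
  have h3 := Real.exp_pos (a * h / ε)
  have : 1 - (Real.exp (a * h / ε))⁻¹ = (Real.exp (a * h / ε) - 1) / Real.exp (a * h / ε) := by
    field_simp
  rw [this]
  field_simp
  ring

theorem expWeight_antitone {ε a b h : ℝ} (hε : 0 < ε) (ha : 0 < a) (hab : a ≤ b) (hh : 0 < h) :
    expWeight ε b h ≤ expWeight ε a h := by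
  have hb : 0 < b := ha.trans_le hab
  have h1 := exp_sub_one_pos hε ha hh
  have h2 := exp_sub_one_pos hε hb hh
  have hx : 0 < a * h / ε := by positivity
  have hy : 0 < b * h / ε := by positivity
  have hxy : a * h / ε ≤ b * h / ε := by gcongr
  have := convexOn_exp.secant_mono (mem_univ 0) (mem_univ _) (mem_univ _) hx.ne' hy.ne' hxy
  rw [Real.exp_zero, sub_zero, sub_zero, div_le_div_iff₀ hx hy] at this
  rw [expWeight, expWeight, div_le_div_iff₀ h2 h1]
  have h3 : 0 < h / ε := by positivity
  refine le_of_mul_le_mul_right ?_ h3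
  calc b * (Real.exp (a * h / ε) - 1) * (h / ε) = (Real.exp (a * h / ε) - 1) * (b * h / ε) := by ring
    _ ≤ _ := this
    _ = _ := by ring

theorem add_expWeight_monotone {ε a b h : ℝ} (hε : 0 < ε) (ha : 0 < a) (hab : a ≤ b) (hh : 0 < h) :
    a + expWeight ε a h ≤ b + expWeight ε b h := by
  have hb : 0 < b := ha.trans_le hab
  rw [add_expWeight hε ha hh, add_expWeight hε hb hh]
  have h1 := one_sub_exp_neg_pos hε ha hh
  have h2 := one_sub_exp_neg_pos hε hb hh
  have hx : 0 < a * h / ε := by positivity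
  have hy : 0 < b * h / ε := by positivity
  have hxy : -(b * h / ε) ≤ -(a * h / ε) := neg_le_neg (by gcongr)
  have := convexOn_exp.secant_mono (mem_univ 0) (mem_univ _) (mem_univ _)
    (neg_lt_zero.2 hy).ne (neg_lt_zero.2 hx).ne hxy
  rw [Real.exp_zero, sub_zero, sub_zero, ← neg_div_neg_eq, ← neg_div_neg_eq (_ - 1), neg_neg,
    neg_neg, neg_sub, neg_sub, div_le_div_iff₀ hy hx] at this
  rw [div_le_div_iff₀ h1 h2]
  have h3 : 0 < h / ε := by positivity
  refine le_of_mul_le_mul_right ?_ h3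
  calc a * (1 - Real.exp (-(b * h / ε))) * (h / ε)
      = (1 - Real.exp (-(b * h / ε))) * (a * h / ε) := by ring
    _ ≤ _ := this
    _ = _ := by ring

theorem expWeight_dominated {c ε a b h : ℝ} (hε : 0 < ε) (hc : 0 < c) (ha : c ≤ a) (hb : c ≤ b)
    (hh : 0 < h) : c + expWeight ε b h ≤ a + expWeight ε a h := by
  rcases le_total a b with hab | hab
  · have := expWeight_antitone hε (hc.trans_le ha) hab hh
    linarith
  · have := add_expWeight_monotone hε (hc.trans_le hb) hab hh
    linarith

/-! ### First order linear equations `ε w' + a w = G` -/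

theorem hasDerivAt_primitive {g : ℝ → ℝ} (hg : Continuous g) (ξ : ℝ) :
    HasDerivAt (fun x => ∫ s in (0 : ℝ)..x, g s) (g ξ) ξ :=
  (hg.integral_hasStrictDerivAt 0 ξ).hasDerivAt

theorem hasDerivAt_exp_primitive {a : ℝ → ℝ} (ha : Continuous a) (c ξ : ℝ) :
    HasDerivAt (fun x => Real.exp (c * ∫ s in (0 : ℝ)..x, a s))
      (Real.exp (c * ∫ s in (0 : ℝ)..ξ, a s) * (c * a ξ)) ξ :=
  ((hasDerivAt_primitive ha ξ).const_mul c).exp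

theorem continuous_exp_primitive {a : ℝ → ℝ} (ha : Continuous a) (c : ℝ) :
    Continuous (fun x => Real.exp (c * ∫ s in (0 : ℝ)..x, a s)) :=
  continuous_iff_continuousAt.2 fun ξ => (hasDerivAt_exp_primitive ha c ξ).continuousAt

/-- The variation of constants formula. -/
theorem hasDerivAt_variation_of_constants {a G : ℝ → ℝ} {ε : ℝ} (ha : Continuous a)
    (hG : Continuous G) (c ξ : ℝ) :
    HasDerivAt (fun x => Real.exp (-ε⁻¹ * ∫ s in (0 : ℝ)..x, a s) *
        (c + ∫ t in (0 : ℝ)..x, Real.exp (ε⁻¹ * ∫ s in (0 : ℝ)..t, a s) * G t / ε))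
      ((G ξ - a ξ * (Real.exp (-ε⁻¹ * ∫ s in (0 : ℝ)..ξ, a s) *
        (c + ∫ t in (0 : ℝ)..ξ, Real.exp (ε⁻¹ * ∫ s in (0 : ℝ)..t, a s) * G t / ε))) / ε) ξ := by
  have h1 := hasDerivAt_exp_primitive ha (-ε⁻¹) ξ
  have h2 := hasDerivAt_primitive
    (g := fun t => Real.exp (ε⁻¹ * ∫ s in (0 : ℝ)..t, a s) * G t / ε) (((continuous_exp_primitive ha ε⁻¹).mul hG).div_const ε) ξ
  refine (h1.fun_mul (h2.const_add c)).congr_deriv ?_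
  have h3 : Real.exp (-ε⁻¹ * ∫ s in (0 : ℝ)..ξ, a s) * Real.exp (ε⁻¹ * ∫ s in (0 : ℝ)..ξ, a s) = 1 := by
    rw [← Real.exp_add]; simp
  generalize Real.exp (-ε⁻¹ * ∫ s in (0 : ℝ)..ξ, a s) = X at *
  generalize Real.exp (ε⁻¹ * ∫ s in (0 : ℝ)..ξ, a s) = Y at *
  rw [show X * (Y * G ξ / ε) = X * Y * G ξ / ε by ring, h3]
  ring

theorem exists_ode_solution {a G : ℝ → ℝ} {ε : ℝ} (ha : Continuous a)
    (hG : Continuous G) (c : ℝ) :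
    ∃ w : ℝ → ℝ, w 0 = c ∧ ∀ ξ, HasDerivAt w ((G ξ - a ξ * w ξ) / ε) ξ :=
  ⟨_, by simp, hasDerivAt_variation_of_constants ha hG c⟩

/-- Comparison principle. -/
theorem ode_nonneg {a φ φ' : ℝ → ℝ} {ε x : ℝ} (hε : 0 < ε) (ha : Continuous a) (hx : 0 ≤ x)
    (hφ : ∀ s, HasDerivAt φ (φ' s) s) (h0 : 0 ≤ φ 0)
    (h : ∀ s ∈ Icc 0 x, 0 ≤ ε * φ' s + a s * φ s) : 0 ≤ φ x := by
  have hd : ∀ s, HasDerivAt (fun x => Real.exp (ε⁻¹ * ∫ s in (0 : ℝ)..x, a s) * φ x)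
      (Real.exp (ε⁻¹ * ∫ s in (0 : ℝ)..s, a s) * (ε * φ' s + a s * φ s) / ε) s := by
    intro s
    refine ((hasDerivAt_exp_primitive ha ε⁻¹ s).fun_mul (hφ s)).congr_deriv ?_
    field_simp
    ring
  have hm : MonotoneOn (fun x => Real.exp (ε⁻¹ * ∫ s in (0 : ℝ)..x, a s) * φ x) (Icc 0 x) := by
    apply monotoneOn_of_deriv_nonneg (convex_Icc 0 x)
    · exact fun s _ => (hd s).continuousAt.continuousWithinAt
    · exact fun s _ => (hd s).differentiableAt.differentiableWithinAt
    · intro s hs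
      rw [(hd s).deriv]
      have := h s (interior_subset hs)
      positivity
  have := hm (left_mem_Icc.2 hx) (right_mem_Icc.2 hx) hx
  simp only [intervalIntegral.integral_same, mul_zero, Real.exp_zero, one_mul] at this
  exact nonneg_of_mul_nonneg_right (h0.trans this) (Real.exp_pos _)

theorem ode_abs_le {a φ φ' ψ ψ' : ℝ → ℝ} {ε x : ℝ} (hε : 0 < ε) (ha : Continuous a) (hx : 0 ≤ x)
    (hφ : ∀ s, HasDerivAt φ (φ' s) s) (hψ : ∀ s, HasDerivAt ψ (ψ' s) s) (h0 : |φ 0| ≤ ψ 0)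
    (h : ∀ s ∈ Icc 0 x, |ε * φ' s + a s * φ s| ≤ ε * ψ' s + a s * ψ s) : |φ x| ≤ ψ x := by
  rw [abs_le] at h0 ⊢
  constructor
  · have := ode_nonneg hε ha hx (fun s => (hψ s).add (hφ s)) (by simp only [Pi.add_apply]; linarith)
      (fun s hs => by
        have := (abs_le.1 (h s hs)).1
        simp only [Pi.add_apply]
        linarith)
    simp only [Pi.add_apply] at this
    linarith
  · have := ode_nonneg hε ha hx (fun s => (hψ s).sub (hφ s)) (by simp only [Pi.sub_apply]; linarith)
      (fun s hs => by
        have := (abs_le.1 (h s hs)).2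
        simp only [Pi.sub_apply]
        linarith)
    simp only [Pi.sub_apply] at this
    linarith

/-- The derivative of a classical solution extends to a global solution of a first order
equation. -/
theorem exists_flux {T ε α : ℝ} {a F v : ℝ → ℝ} (hT : 0 < T) (hε : 0 < ε) (ha : Continuous a)
    (hF : Continuous F) (hv : ContinuousOn v (Icc 0 T)) (hv2 : ContDiffOn ℝ 2 v (Ioo 0 T))
    (heq : ∀ ξ ∈ Ioo 0 T, ε * deriv (deriv v) ξ + a ξ * deriv v ξ = F ξ) (h0 : v 0 = α) :
    ∃ p : ℝ → ℝ, (∀ ξ, HasDerivAt p ((F ξ - a ξ * p ξ) / ε) ξ) ∧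
      ∀ ξ ∈ Icc 0 T, v ξ = α + ∫ s in (0 : ℝ)..ξ, p s := by
  have hd1 : ∀ ξ ∈ Ioo 0 T, HasDerivAt v (deriv v ξ) ξ := fun ξ hξ =>
    ((hv2.contDiffAt (isOpen_Ioo.mem_nhds hξ)).differentiableAt (by norm_num)).hasDerivAt
  have hd2 : ∀ ξ ∈ Ioo 0 T, HasDerivAt (deriv v) (deriv (deriv v) ξ) ξ := by
    intro ξ hξ
    have h1 : ContDiffOn ℝ (1 + 1) v (Ioo 0 T) := by
      convert hv2 using 1; norm_num
    have h2 := ((contDiffOn_succ_iff_deriv_of_isOpen isOpen_Ioo).1 h1).2.2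
    exact ((h2.contDiffAt (isOpen_Ioo.mem_nhds hξ)).differentiableAt (by norm_num)).hasDerivAt
  let J : ℝ → ℝ := fun x => ∫ t in (0 : ℝ)..x, Real.exp (ε⁻¹ * ∫ s in (0 : ℝ)..t, a s) * F t / ε
  let Φ : ℝ → ℝ := fun x => deriv v x * Real.exp (ε⁻¹ * ∫ s in (0 : ℝ)..x, a s) - J x
  have hΦ : ∀ ξ ∈ Ioo 0 T, HasDerivAt Φ 0 ξ := by
    intro ξ hξ
    have h2 := hasDerivAt_primitive
      (g := fun t => Real.exp (ε⁻¹ * ∫ s in (0 : ℝ)..t, a s) * F t / ε) (((continuous_exp_primitive ha ε⁻¹).mul hF).div_const ε) ξ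
    refine (((hd2 ξ hξ).fun_mul (hasDerivAt_exp_primitive ha ε⁻¹ ξ)).fun_sub h2).congr_deriv ?_
    rw [← heq ξ hξ]
    field_simp
    ring
  have hmid : T / 2 ∈ Ioo 0 T := ⟨by linarith, by linarith⟩
  have hconst : ∀ ξ ∈ Ioo 0 T, Φ ξ = Φ (T / 2) := fun ξ hξ =>
    isOpen_Ioo.is_const_of_deriv_eq_zero isPreconnected_Ioo
      (fun x hx => (hΦ x hx).differentiableAt.differentiableWithinAt)
      (fun x hx => (hΦ x hx).deriv) hξ hmid
  set c := Φ (T / 2)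
  refine ⟨fun x => Real.exp (-ε⁻¹ * ∫ s in (0 : ℝ)..x, a s) * (c + J x),
    hasDerivAt_variation_of_constants ha hF c, ?_⟩
  have hpc : Continuous (fun x => Real.exp (-ε⁻¹ * ∫ s in (0 : ℝ)..x, a s) * (c + J x)) :=
    continuous_iff_continuousAt.2 fun ξ =>
      (hasDerivAt_variation_of_constants ha hF c ξ).continuousAt
  intro ξ hξ
  rw [intervalIntegral.integral_eq_sub_of_hasDerivAt_of_le (f := v) hξ.1
    (hv.mono (Icc_subset_Icc_right hξ.2)) _ (hpc.intervalIntegrable _ _), h0]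
  · ring
  · intro x hx
    have hx' : x ∈ Ioo 0 T := ⟨hx.1, hx.2.trans_le hξ.2⟩
    refine (hd1 x hx').congr_deriv ?_
    rw [← hconst x hx']
    simp only [Φ, sub_add_cancel]
    rw [mul_comm, mul_assoc, ← Real.exp_add]
    simp

/-! ### Structure of the solution of the continuous problem -/

/-- Quadratic Taylor bound on `[0, T]` with derivative `g'`. -/
def TaylorBound (T B : ℝ) (g g' : ℝ → ℝ) : Prop :=
  ∀ x ∈ Icc 0 T, ∀ y ∈ Icc 0 T, |g y - g x - g' x * (y - x)| ≤ B * (y - x) ^ 2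

/-- Globally defined coefficients with quantitative `C^{1,1}` bounds on `[0, T]`;
`kb` bounds `∫ |K ξ ·|`, and `K'` is `∂K/∂ξ`. -/
structure SmoothData (T abar B kb : ℝ) (a f : ℝ → ℝ) (K K' : ℝ → ℝ → ℝ) : Prop where
  T_pos : 0 < T
  abar_pos : 0 < abar
  le_a : ∀ x, abar ≤ a x
  a_le : ∀ x, a x ≤ B
  a_lip : ∀ x y, |a x - a y| ≤ B * |x - y|
  a_taylor : ∃ a', TaylorBound T B a a'
  f_le : ∀ x, |f x| ≤ B
  f_lip : ∀ x y, |f x - f y| ≤ B * |x - y|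
  f_taylor : ∃ f', TaylorBound T B f f'
  K_cont : Continuous fun p : ℝ × ℝ => K p.1 p.2
  K_le : ∀ x y, |K x y| ≤ B
  K_lip_left : ∀ x y η, |K x η - K y η| ≤ B * |x - y|
  K_lip_right : ∀ ξ x y, |K ξ x - K ξ y| ≤ B * |x - y|
  K'_le : ∀ x ∈ Icc 0 T, ∀ η ∈ Icc 0 T, |K' x η| ≤ B
  K_taylor_left : ∀ η ∈ Icc 0 T, TaylorBound T B (fun x => K x η) (fun x => K' x η)
  K_taylor_right : ∀ ξ ∈ Icc 0 T, ∃ k', TaylorBound T B (K ξ) k'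
  kb_le : ∀ ξ ∈ Icc 0 T, ∫ η in (0 : ℝ)..T, |K ξ η| ≤ kb

theorem continuous_of_abs_sub_le {g : ℝ → ℝ} {B : ℝ} (h : ∀ x y, |g x - g y| ≤ B * |x - y|) :
    Continuous g := by
  rcases le_or_gt 0 B with hB | hB
  · exact (LipschitzWith.of_dist_le_mul (K := ⟨B, hB⟩) fun x y => h x y).continuous
  · have := (abs_nonneg _).trans (h 0 1)
    simp at this
    linarith

namespace SmoothData

variable {T abar B kb : ℝ} {a f : ℝ → ℝ} {K K' : ℝ → ℝ → ℝ}

theorem a_cont (h : SmoothData T abar B kb a f K K') : Continuous a :=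
  continuous_of_abs_sub_le h.a_lip

theorem B_pos (h : SmoothData T abar B kb a f K K') : 0 < B :=
  h.abar_pos.trans_le ((h.le_a 0).trans (h.a_le 0))

theorem a_pos (h : SmoothData T abar B kb a f K K') (x : ℝ) : 0 < a x :=
  h.abar_pos.trans_le (h.le_a x)

theorem kb_nonneg (h : SmoothData T abar B kb a f K K') : 0 ≤ kb :=
  (intervalIntegral.integral_nonneg h.T_pos.le fun _ _ => abs_nonneg _).trans
    (h.kb_le 0 (left_mem_Icc.2 h.T_pos.le))

theorem K_row (h : SmoothData T abar B kb a f K K') (ξ : ℝ) : Continuous (K ξ) :=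
  h.K_cont.comp (Continuous.prodMk_right ξ)

end SmoothData

/-- Bounds for the right-hand side `f + lam ∫ K v` in terms of `sup |v|`. -/
theorem rhs_bounds {T abar B kb lam M : ℝ} {a f : ℝ → ℝ} {K K' : ℝ → ℝ → ℝ}
    (h : SmoothData T abar B kb a f K K') {v : ℝ → ℝ} (hv : ContinuousOn v (Icc 0 T))
    (hM : ∀ x ∈ Icc 0 T, |v x| ≤ M) :
    (∀ ξ ∈ Icc 0 T, |f ξ + lam * ∫ η in (0 : ℝ)..T, K ξ η * v η| ≤ B + |lam| * (kb * M)) ∧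
    ∀ x y, |(f x + lam * ∫ η in (0 : ℝ)..T, K x η * v η) -
      (f y + lam * ∫ η in (0 : ℝ)..T, K y η * v η)| ≤ (B + |lam| * (B * M * T)) * |x - y| := by
  have hT := h.T_pos
  have hB := h.B_pos
  have hint : ∀ ξ, IntervalIntegrable (fun η => K ξ η * v η) volume 0 T := fun ξ => by
    apply ContinuousOn.intervalIntegrable
    rw [uIcc_of_le hT.le]
    exact (h.K_row ξ).continuousOn.mul hv
  constructor
  · intro ξ hξ
    refine (abs_add_le _ _).trans (add_le_add (h.f_le ξ) ?_)
    rw [abs_mul]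
    gcongr
    have h1 : |∫ η in (0 : ℝ)..T, K ξ η * v η| ≤ ∫ η in (0 : ℝ)..T, |K ξ η| * M := by
      rw [← Real.norm_eq_abs]
      apply intervalIntegral.norm_integral_le_of_norm_le hT.le
      · refine Filter.Eventually.of_forall fun t ht => ?_
        rw [Real.norm_eq_abs, abs_mul]
        exact mul_le_mul_of_nonneg_left (hM t ⟨ht.1.le, ht.2⟩) (abs_nonneg _)
      · exact (((h.K_row ξ).abs).mul_const M).intervalIntegrable _ _
    rw [intervalIntegral.integral_mul_const] at h1
    exact h1.trans (mul_le_mul_of_nonneg_right (h.kb_le ξ hξ)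
      ((abs_nonneg _).trans (hM ξ hξ)))
  · intro x y
    have h2 : |∫ η in (0 : ℝ)..T, (K x η * v η - K y η * v η)| ≤ B * |x - y| * M * |T - 0| := by
      rw [← Real.norm_eq_abs]
      apply intervalIntegral.norm_integral_le_of_norm_le_const
      intro t ht
      rw [uIoc_of_le hT.le] at ht
      rw [Real.norm_eq_abs, ← sub_mul, abs_mul]
      exact mul_le_mul (h.K_lip_left x y t) (hM t ⟨ht.1.le, ht.2⟩) (abs_nonneg _) (by positivity)
    rw [intervalIntegral.integral_sub (hint x) (hint y), sub_zero, abs_of_pos hT] at h2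
    have h3 : (f x + lam * ∫ η in (0 : ℝ)..T, K x η * v η) -
      (f y + lam * ∫ η in (0 : ℝ)..T, K y η * v η) = (f x - f y) +
        lam * ((∫ η in (0 : ℝ)..T, K x η * v η) - ∫ η in (0 : ℝ)..T, K y η * v η) := by ring
    rw [h3]
    refine (abs_add_le _ _).trans ?_
    rw [abs_mul]
    have := mul_le_mul_of_nonneg_left h2 (abs_nonneg lam)
    linarith [h.f_lip x y]

/-- Bounds for the homogeneous solution `e` of `ε e' + a e = 0`, `e 0 = 1`. -/
theorem homogeneous_bounds {abar B ε : ℝ} {a e : ℝ → ℝ} (hε : 0 < ε) (ha : Continuous a)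
    (hle : ∀ x, abar ≤ a x) (hB : ∀ x, a x ≤ B) (he0 : e 0 = 1)
    (he : ∀ ξ, HasDerivAt e (-(a ξ * e ξ) / ε) ξ) {x : ℝ} (hx : 0 ≤ x) :
    Real.exp (-(B * x / ε)) ≤ e x ∧ e x ≤ Real.exp (-(abar * x / ε)) := by
  have hexp : ∀ c s : ℝ, HasDerivAt (fun x => Real.exp (-(c * x / ε)))
      (Real.exp (-(c * s / ε)) * -(c / ε)) s := by
    intro c s
    have : HasDerivAt (fun x : ℝ => -(c * x / ε)) (-(c / ε)) s := by
      simpa using (((hasDerivAt_id s).const_mul c).div_const ε).fun_neg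
    exact this.exp
  constructor
  · have := ode_nonneg (a := a) hε ha hx (fun s => (he s).fun_sub (hexp B s)) (by simp [he0])
      (fun s _ => by
        have h1 : ε * (-(a s * e s) / ε - Real.exp (-(B * s / ε)) * -(B / ε)) +
          a s * (e s - Real.exp (-(B * s / ε))) = (B - a s) * Real.exp (-(B * s / ε)) := by
          field_simp; ring
        rw [h1]
        exact mul_nonneg (by linarith [hB s]) (Real.exp_pos _).le)
    linarith
  · have := ode_nonneg (a := a) hε ha hx (fun s => (hexp abar s).fun_sub (he s)) (by simp [he0])
      (fun s _ => by
        have h1 : ε * (Real.exp (-(abar * s / ε)) * -(abar / ε) - -(a s * e s) / ε) +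
          a s * (Real.exp (-(abar * s / ε)) - e s) = (a s - abar) * Real.exp (-(abar * s / ε)) := by
          field_simp; ring
        rw [h1]
        exact mul_nonneg (by linarith [hle s]) (Real.exp_pos _).le)
    linarith

/-- A particular solution with small initial slope has a bounded derivative. -/
theorem regular_part_bounds {T abar B ε M L : ℝ} {a F w : ℝ → ℝ} (hε : 0 < ε) (ha : Continuous a)
    (habar : 0 < abar) (hle : ∀ x, abar ≤ a x) (hB : ∀ x, a x ≤ B)
    (halip : ∀ x y, |a x - a y| ≤ B * |x - y|)
    (hF : ∀ x ∈ Icc 0 T, |F x| ≤ M) (hFlip : ∀ x y, |F x - F y| ≤ L * |x - y|)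
    (hw0 : w 0 = F 0 / a 0) (hw : ∀ ξ, HasDerivAt w ((F ξ - a ξ * w ξ) / ε) ξ) :
    ∀ x ∈ Icc 0 T, |w x| ≤ M / abar ∧
      |(F x - a x * w x) / ε| ≤ B * ((L + M / abar * B) / abar) / abar := by
  have hapos : ∀ x, 0 < a x := fun x => habar.trans_le (hle x)
  intro x hx
  have hM : 0 ≤ M := (abs_nonneg _).trans (hF x hx)
  have hL : 0 ≤ L := by
    have := (abs_nonneg _).trans (hFlip 0 1)
    simpa using this
  have hBp : 0 < B := (hapos 0).trans_le (hB 0)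
  have h0 : (0 : ℝ) ∈ Icc 0 T := ⟨le_rfl, hx.1.trans hx.2⟩
  constructor
  · refine ode_abs_le (ψ := fun _ => M / abar) (ψ' := fun _ => 0) hε ha hx.1 hw
      (fun s => hasDerivAt_const s _) ?_ ?_
    · rw [hw0, abs_div, abs_of_pos (hapos 0)]
      exact div_le_div₀ hM (hF 0 h0) habar (hle 0)
    · intro s hs
      have h1 : ε * ((F s - a s * w s) / ε) + a s * w s = F s := by field_simp; ring
      rw [h1, mul_zero, zero_add]
      refine (hF s ⟨hs.1, hs.2.trans hx.2⟩).trans ?_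
      rw [mul_div_assoc', le_div_iff₀ habar, mul_comm]
      exact mul_le_mul_of_nonneg_right (hle s) hM
  · set L' := (L + M / abar * B) / abar with hL'
    have hL'0 : 0 ≤ L' := by positivity
    have hu : |F x / a x| ≤ M / abar := by
      rw [abs_div, abs_of_pos (hapos x)]
      exact div_le_div₀ hM (hF x hx) habar (hle x)
    -- `|F s - a s * u| ≤ a s L' |x - s|`
    have hFa : ∀ s, |F s - a s * (F x / a x)| ≤ a s * (L' * |x - s|) := by
      intro s
      have h1 : F s - a s * (F x / a x) = (F s - F x) - (a s - a x) * (F x / a x) := by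
        have := (hapos x).ne'
        field_simp; ring
      rw [h1]
      refine (abs_sub _ _).trans ?_
      rw [abs_mul]
      have h2 : |F s - F x| + |a s - a x| * |F x / a x| ≤
          L * |x - s| + (B * |x - s|) * (M / abar) := by
        have := hFlip s x
        have h4 := halip s x
        rw [abs_sub_comm s x] at this h4
        gcongr
      refine h2.trans ?_
      have h3 : L * |x - s| + (B * |x - s|) * (M / abar) = abar * (L' * |x - s|) := by
        rw [hL']; field_simp
      rw [h3]
      exact mul_le_mul_of_nonneg_right (hle s) (by positivity)
    have key : |w x - F x / a x| ≤ L' * (x - x) + L' * ε / abar := by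
      refine ode_abs_le (φ := fun s => w s - F x / a x) (ψ := fun s => L' * (x - s) + L' * ε / abar)
        (ψ' := fun _ => -L') hε ha hx.1 (fun s => (hw s).sub_const _) ?_ ?_ ?_
      · intro s
        have := (((hasDerivAt_id s).const_sub x).const_mul L').add_const (L' * ε / abar)
        simpa using this
      · have h1 := hFa 0
        rw [sub_zero, abs_of_nonneg hx.1] at h1
        have h2 : w 0 - F x / a x = (F 0 - a 0 * (F x / a x)) / a 0 := by
          rw [hw0]
          have := (hapos 0).ne'
          field_simp
        have h3 : |w 0 - F x / a x| ≤ L' * x := by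
          rw [h2, abs_div, abs_of_pos (hapos 0), div_le_iff₀ (hapos 0)]
          linarith
        have : 0 ≤ L' * ε / abar := by positivity
        simp only [sub_zero]
        linarith
      · intro s hs
        have h1 : ε * ((F s - a s * w s) / ε) + a s * (w s - F x / a x) =
          F s - a s * (F x / a x) := by field_simp; ring
        rw [h1]
        refine (hFa s).trans ?_
        rw [abs_of_nonneg (by linarith [hs.2])]
        have h2 : ε * L' ≤ a s * (L' * ε / abar) := by
          rw [show a s * (L' * ε / abar) = a s * (L' * ε) / abar by ring, le_div_iff₀ habar]
          have := mul_le_mul_of_nonneg_right (hle s) (by positivity : 0 ≤ L' * ε)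
          linarith
        linarith
    rw [sub_self, mul_zero, zero_add] at key
    have h1 : (F x - a x * w x) / ε = -(a x * (w x - F x / a x)) / ε := by
      have := (hapos x).ne'
      field_simp; ring
    rw [h1, abs_div, abs_neg, abs_mul, abs_of_pos (hapos x), abs_of_pos hε, div_le_iff₀ hε]
    calc a x * |w x - F x / a x| ≤ B * (L' * ε / abar) := by
          have := hB x; gcongr
      _ = B * L' / abar * ε := by ring

theorem integral_exp_neg_mul {c ε : ℝ} (hc : 0 < c) (hε : 0 < ε) (x y : ℝ) :
    ∫ s in x..y, Real.exp (-(c * s / ε)) =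
      ε / c * (Real.exp (-(c * x / ε)) - Real.exp (-(c * y / ε))) := by
  have hd : ∀ s : ℝ, HasDerivAt (fun s => -(ε / c) * Real.exp (-(c * s / ε)))
      (Real.exp (-(c * s / ε))) s := by
    intro s
    have h1 : HasDerivAt (fun x : ℝ => -(c * x / ε)) (-(c / ε)) s := by
      simpa using (((hasDerivAt_id s).const_mul c).div_const ε).fun_neg
    refine (h1.exp.const_mul (-(ε / c))).congr_deriv ?_
    field_simp
  rw [intervalIntegral.integral_eq_sub_of_hasDerivAt (fun s _ => hd s)
    (Continuous.intervalIntegrable (by fun_prop) _ _)]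
  ring

/-- A priori bounds for the two-point boundary value problem. -/
theorem boundary_value_bounds {T abar B ε M α β : ℝ} {a F p : ℝ → ℝ} (hT : 0 < T) (hε : 0 < ε)
    (hε1 : ε ≤ 1) (ha : Continuous a) (hFc : Continuous F)
    (habar : 0 < abar) (hle : ∀ x, abar ≤ a x) (hB : ∀ x, a x ≤ B)
    (hF : ∀ x ∈ Icc 0 T, |F x| ≤ M)
    (hp : ∀ ξ, HasDerivAt p ((F ξ - a ξ * p ξ) / ε) ξ)
    (hβ : α + ∫ s in (0 : ℝ)..T, p s = β) :
    (∀ x ∈ Icc 0 T, |α + ∫ s in (0 : ℝ)..x, p s| ≤ |α| + |β| + T * (M / abar)) ∧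
      |p 0| ≤ (|β - α| + T * (M / abar)) * (B / (1 - Real.exp (-(B * T)))) / ε := by
  obtain ⟨P, hP0, hP⟩ := exists_ode_solution (ε := ε) ha hFc 0
  obtain ⟨e, he0, he⟩ := exists_ode_solution (ε := ε) (G := fun _ => 0) ha continuous_const 1
  have he' : ∀ ξ, HasDerivAt e (-(a ξ * e ξ) / ε) ξ := fun ξ => by simpa using he ξ
  have hBp : 0 < B := habar.trans_le ((hle 0).trans (hB 0))
  have hM : 0 ≤ M := (abs_nonneg _).trans (hF 0 (left_mem_Icc.2 hT.le))
  have hcont : ∀ {g g' : ℝ → ℝ}, (∀ ξ, HasDerivAt g (g' ξ) ξ) → Continuous g := fun h =>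
    continuous_iff_continuousAt.2 fun ξ => (h ξ).continuousAt
  have hPc := hcont hP
  have hec := hcont he
  have hpe : ∀ x, 0 ≤ x → p x = P x + p 0 * e x := by
    intro x hx
    have := ode_abs_le (φ := fun s => p s - (P s + p 0 * e s)) (ψ := fun _ => 0) (ψ' := fun _ => 0)
      hε ha hx (fun s => (hp s).fun_sub ((hP s).fun_add ((he s).const_mul (p 0))))
      (fun s => hasDerivAt_const s _) (by simp [hP0, he0]) (fun s _ => by
        rw [abs_le]
        constructor <;> · apply le_of_eq; field_simp; ring)
    have h1 := abs_nonpos_iff.1 this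
    linarith
  have hPb : ∀ x ∈ Icc 0 T, |P x| ≤ M / abar := by
    intro x hx
    refine ode_abs_le (ψ := fun _ => M / abar) (ψ' := fun _ => 0) hε ha hx.1 hP
      (fun s => hasDerivAt_const s _) (by rw [hP0, abs_zero]; positivity) ?_
    intro s hs
    have h1 : ε * ((F s - a s * P s) / ε) + a s * P s = F s := by field_simp; ring
    rw [h1, mul_zero, zero_add]
    refine (hF s ⟨hs.1, hs.2.trans hx.2⟩).trans ?_
    rw [mul_div_assoc', le_div_iff₀ habar, mul_comm]
    exact mul_le_mul_of_nonneg_right (hle s) hM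
  have hQ : ∀ x y, 0 ≤ x → x ≤ y → y ≤ T → |∫ s in x..y, P s| ≤ (y - x) * (M / abar) := by
    intro x y hx hxy hy
    have := intervalIntegral.norm_integral_le_of_norm_le_const (a := x) (b := y) (f := P)
      (C := M / abar) (fun t ht => by
        rw [uIoc_of_le hxy] at ht
        exact hPb t ⟨hx.trans ht.1.le, ht.2.trans hy⟩)
    rw [abs_of_nonneg (sub_nonneg.2 hxy)] at this
    rw [← Real.norm_eq_abs]
    linarith
  have hpos : ∀ x, 0 ≤ x → 0 ≤ e x := fun x hx =>
    (Real.exp_pos _).le.trans (homogeneous_bounds hε ha hle hB he0 he' hx).1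
  have hint : ∀ x, 0 ≤ x → ∫ s in (0 : ℝ)..x, p s =
      (∫ s in (0 : ℝ)..x, P s) + p 0 * ∫ s in (0 : ℝ)..x, e s := by
    intro x hx
    rw [← intervalIntegral.integral_const_mul, ← intervalIntegral.integral_add
      (hPc.intervalIntegrable _ _) ((hec.const_mul _).intervalIntegrable _ _)]
    apply intervalIntegral.integral_congr
    intro s hs
    rw [uIcc_of_le hx] at hs
    exact hpe s hs.1
  set ET := ∫ s in (0 : ℝ)..T, e s with hETdef
  have hET : ε * ((1 - Real.exp (-(B * T))) / B) ≤ ET := by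
    have h1 : ∫ s in (0 : ℝ)..T, Real.exp (-(B * s / ε)) ≤ ET :=
      intervalIntegral.integral_mono_on hT.le (Continuous.intervalIntegrable (by fun_prop) _ _)
        (hec.intervalIntegrable _ _)
        (fun s hs => (homogeneous_bounds hε ha hle hB he0 he' hs.1).1)
    rw [integral_exp_neg_mul hBp hε] at h1
    refine le_trans ?_ h1
    have h2 : Real.exp (-(B * T / ε)) ≤ Real.exp (-(B * T)) := by
      apply Real.exp_le_exp.2 (neg_le_neg _)
      rw [le_div_iff₀ hε]
      have : 0 < B * T := by positivity
      nlinarith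
    rw [mul_zero, zero_div, neg_zero, Real.exp_zero, mul_div_assoc', div_mul_eq_mul_div]
    gcongr
  have h1e : 0 < 1 - Real.exp (-(B * T)) := by
    have : 0 < B * T := by positivity
    have := Real.exp_lt_exp.2 (neg_lt_zero.2 this)
    rw [Real.exp_zero] at this
    linarith
  have hETpos : 0 < ET := lt_of_lt_of_le (by positivity) hET
  rw [hint T hT.le] at hβ
  have hTT := hQ 0 T le_rfl hT.le le_rfl
  rw [sub_zero] at hTT
  constructor
  · intro x hx
    rw [hint x hx.1]
    set Ex := ∫ s in (0 : ℝ)..x, e s with hEx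
    have hsplit : (∫ s in (0 : ℝ)..x, P s) + ∫ s in x..T, P s = ∫ s in (0 : ℝ)..T, P s :=
      intervalIntegral.integral_add_adjacent_intervals (hPc.intervalIntegrable _ _)
        (hPc.intervalIntegrable _ _)
    have hEsplit : Ex + ∫ s in x..T, e s = ET :=
      intervalIntegral.integral_add_adjacent_intervals (hec.intervalIntegrable _ _)
        (hec.intervalIntegrable _ _)
    have hE0 : 0 ≤ Ex := intervalIntegral.integral_nonneg hx.1 fun s hs => hpos s hs.1
    have hE1 : 0 ≤ ∫ s in x..T, e s :=
      intervalIntegral.integral_nonneg hx.2 fun s hs => hpos s (hx.1.trans hs.1)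
    have ht0 : 0 ≤ Ex / ET := by positivity
    have ht1 : Ex / ET ≤ 1 := (div_le_one hETpos).2 (by linarith)
    have hq1 := hQ 0 x le_rfl hx.1 hx.2
    have hq2 := hQ x T hx.1 hx.2 le_rfl
    set Q1 := ∫ s in (0 : ℝ)..x, P s
    set Q2 := ∫ s in x..T, P s
    have hv : α + (Q1 + p 0 * Ex) = (1 - Ex / ET) * (α + Q1) + Ex / ET * (β - Q2) := by
      have : p 0 = (β - α - (Q1 + Q2)) / ET := by
        rw [hsplit]
        field_simp
        linarith
      rw [this]
      field_simp
      ring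
    rw [hv]
    refine (abs_add_le _ _).trans ?_
    rw [abs_mul, abs_mul, abs_of_nonneg ht0, abs_of_nonneg (by linarith : 0 ≤ 1 - Ex / ET)]
    have hMa : 0 ≤ M / abar := by positivity
    have hA : |α + Q1| ≤ |α| + |β| + T * (M / abar) := by
      have := abs_add_le α Q1
      have := abs_nonneg β
      have := mul_le_mul_of_nonneg_right hx.2 hMa
      linarith
    have hC : |β - Q2| ≤ |α| + |β| + T * (M / abar) := by
      have := abs_sub β Q2
      have := abs_nonneg α
      have := mul_nonneg hx.1 hMa
      linarith
    calc (1 - Ex / ET) * |α + Q1| + Ex / ET * |β - Q2|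
        ≤ (1 - Ex / ET) * (|α| + |β| + T * (M / abar)) + Ex / ET * (|α| + |β| + T * (M / abar)) := by
          have : 0 ≤ 1 - Ex / ET := by linarith
          gcongr
      _ = _ := by ring
  · have h3 : |p 0| * ET ≤ |β - α| + T * (M / abar) := by
      rw [← abs_of_pos hETpos, ← abs_mul]
      have : p 0 * ET = (β - α) - ∫ s in (0 : ℝ)..T, P s := by linarith
      rw [this]
      exact (abs_sub _ _).trans (by linarith)
    have h4 : |p 0| * (ε * ((1 - Real.exp (-(B * T))) / B)) ≤ |β - α| + T * (M / abar) :=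
      (mul_le_mul_of_nonneg_left hET (abs_nonneg _)).trans h3
    rw [le_div_iff₀ hε]
    have h5 : 0 < B / (1 - Real.exp (-(B * T))) := by positivity
    calc |p 0| * ε = |p 0| * (ε * ((1 - Real.exp (-(B * T))) / B)) *
          (B / (1 - Real.exp (-(B * T)))) := by field_simp
      _ ≤ _ := mul_le_mul_of_nonneg_right h4 h5.le

/-- Decomposition of a solution `v`, `v' = w + l`, with regular part `w` and layer part `l`. -/
structure Decomposition (T abar C ε α : ℝ) (a F v w l : ℝ → ℝ) : Prop where
  w_cont : Continuous w
  l_cont : Continuous l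
  ode : ∀ ξ, HasDerivAt (fun x => w x + l x) ((F ξ - a ξ * (w ξ + l ξ)) / ε) ξ
  v_eq : ∀ ξ ∈ Icc 0 T, v ξ = α + ∫ s in (0 : ℝ)..ξ, (w s + l s)
  v_le : ∀ ξ ∈ Icc 0 T, |v ξ| ≤ C
  w_le : ∀ ξ ∈ Icc 0 T, |w ξ| ≤ C
  w_lip : ∀ x ∈ Icc 0 T, ∀ y ∈ Icc 0 T, |w x - w y| ≤ C * |x - y|
  l_le : ∀ ξ ∈ Icc 0 T, |l ξ| ≤ C / ε * Real.exp (-(abar * ξ / ε))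
  l_osc : ∀ x ∈ Icc 0 T, ∀ y ∈ Icc 0 T,
    |l x - l y| ≤ C / ε * |Real.exp (-(abar * x / ε)) - Real.exp (-(abar * y / ε))|

theorem homogeneous_osc {abar B ε : ℝ} {a e : ℝ → ℝ} (hε : 0 < ε) (ha : Continuous a)
    (habar : 0 < abar) (hle : ∀ x, abar ≤ a x) (hB : ∀ x, a x ≤ B) (he0 : e 0 = 1)
    (he : ∀ ξ, HasDerivAt e (-(a ξ * e ξ) / ε) ξ) {x y : ℝ} (hx : 0 ≤ x) (hy : 0 ≤ y) :
    |e x - e y| ≤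
      B / abar * |Real.exp (-(abar * x / ε)) - Real.exp (-(abar * y / ε))| := by
  wlog hxy : x ≤ y generalizing x y
  · have := this hy hx (le_of_not_ge hxy)
    rwa [abs_sub_comm (e y), abs_sub_comm (Real.exp _)] at this
  have hBp : 0 < B := habar.trans_le ((hle 0).trans (hB 0))
  have hpos : ∀ x, 0 ≤ x → 0 ≤ e x := fun x hx =>
    (Real.exp_pos _).le.trans (homogeneous_bounds hε ha hle hB he0 he hx).1
  have hexp : ∀ s : ℝ, HasDerivAt (fun x => B / abar * Real.exp (-(abar * x / ε)))
      (-(B * Real.exp (-(abar * s / ε))) / ε) s := by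
    intro s
    have h1 : HasDerivAt (fun x : ℝ => -(abar * x / ε)) (-(abar / ε)) s := by
      simpa using (((hasDerivAt_id s).const_mul abar).div_const ε).fun_neg
    refine (h1.exp.const_mul (B / abar)).congr_deriv ?_
    field_simp
  have hanti : e y ≤ e x := by
    have : AntitoneOn e (Ici 0) := by
      apply antitoneOn_of_deriv_nonpos (convex_Ici 0)
      · exact fun s _ => (he s).continuousAt.continuousWithinAt
      · exact fun s _ => (he s).differentiableAt.differentiableWithinAt
      · intro s hs
        rw [(he s).deriv, neg_div, neg_nonpos]
        have h1 := hpos s (interior_subset hs)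
        have h2 : 0 ≤ a s := habar.le.trans (hle s)
        positivity
    exact this hx hy hxy
  have hanti2 : B / abar * Real.exp (-(abar * y / ε)) - e y ≤
      B / abar * Real.exp (-(abar * x / ε)) - e x := by
    have : AntitoneOn (fun s => B / abar * Real.exp (-(abar * s / ε)) - e s) (Ici 0) := by
      apply antitoneOn_of_deriv_nonpos (convex_Ici 0)
      · exact fun s _ => ((hexp s).sub (he s)).continuousAt.continuousWithinAt
      · exact fun s _ => ((hexp s).sub (he s)).differentiableAt.differentiableWithinAt
      · intro s hs
        have hs0 : 0 ≤ s := interior_subset hs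
        rw [((hexp s).fun_sub (he s)).deriv, ← sub_div]
        apply div_nonpos_of_nonpos_of_nonneg _ hε.le
        have h1 := hpos s hs0
        have h2 := (homogeneous_bounds hε ha hle hB he0 he hs0).2
        have h3 := mul_le_mul (hB s) h2 h1 hBp.le
        linarith
    exact this hx hy hxy
  rw [abs_of_nonneg (by linarith), abs_of_nonneg, mul_sub]
  · linarith
  · have : Real.exp (-(abar * y / ε)) ≤ Real.exp (-(abar * x / ε)) := by
      apply Real.exp_le_exp.2 (neg_le_neg _)
      gcongr
    linarith

/-- Uniform decomposition of solutions. -/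
theorem exists_decomposition {T abar B kb lam α β : ℝ} {a f : ℝ → ℝ} {K K' : ℝ → ℝ → ℝ}
    (h : SmoothData T abar B kb a f K K') (hlam : |lam| * (kb * T) < abar) :
    ∃ C : ℝ, 0 < C ∧ ∀ ε v, 0 < ε → ε ≤ 1 → IsSolution T ε lam α β a f K v →
      ∃ w l, Decomposition T abar C ε α a
        (fun ξ => f ξ + lam * ∫ η in (0 : ℝ)..T, K ξ η * v η) v w l := by
  have hT := h.T_pos
  have hab := h.abar_pos
  have hB := h.B_pos
  have hkb := h.kb_nonneg
  set V := (|α| + |β| + T * (B / abar)) / (1 - |lam| * (kb * T) / abar) with hV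
  have hden : 0 < 1 - |lam| * (kb * T) / abar := by
    have := (div_lt_one hab).2 hlam
    linarith
  have hV0 : 0 ≤ V := by positivity
  set M := B + |lam| * (kb * V) with hMdef
  have hM0 : 0 ≤ M := by positivity
  set L := B + |lam| * (B * V * T) with hLdef
  have hL0 : 0 ≤ L := by positivity
  set C1 := B * ((L + M / abar * B) / abar) / abar
  have hC10 : 0 ≤ C1 := by positivity
  have h1e : 0 < 1 - Real.exp (-(B * T)) := by
    have : 0 < B * T := by positivity
    have := Real.exp_lt_exp.2 (neg_lt_zero.2 this)
    rw [Real.exp_zero] at this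
    linarith
  set C2 := (|β - α| + T * (M / abar)) * (B / (1 - Real.exp (-(B * T)))) + M / abar with hC2
  have hC20 : 0 ≤ C2 := by positivity
  have hBa : 1 ≤ B / abar := (one_le_div hab).2 ((h.le_a 0).trans (h.a_le 0))
  refine ⟨V + M / abar + C1 + C2 * (B / abar) + 1, by positivity, ?_⟩
  intro ε v hε hε1 hs
  set F : ℝ → ℝ := fun ξ => f ξ + lam * ∫ η in (0 : ℝ)..T, K ξ η * v η with hFdef
  obtain ⟨x₀, hx₀, hmax⟩ := isCompact_Icc.exists_isMaxOn (nonempty_Icc.2 hT.le) hs.continuousOn.abs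
  have hFl := rhs_bounds (lam := lam) h hs.continuousOn (fun x hx => hmax hx)
  have hFc : Continuous F := continuous_of_abs_sub_le hFl.2
  obtain ⟨p, hp, hvp⟩ := exists_flux hT hε h.a_cont hFc hs.continuousOn hs.contDiffOn hs.equation
    hs.left_bc
  have hβ : α + ∫ s in (0 : ℝ)..T, p s = β := by
    rw [← hvp T (right_mem_Icc.2 hT.le), hs.right_bc]
  have hvV : ∀ x ∈ Icc 0 T, |v x| ≤ V := by
    have h1 := (boundary_value_bounds hT hε hε1 h.a_cont hFc hab h.le_a h.a_le hFl.1 hp hβ).1 x₀ hx₀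
    rw [← hvp x₀ hx₀] at h1
    intro x hx
    refine (hmax hx : |v x| ≤ |v x₀|).trans ?_
    rw [hV, le_div_iff₀ hden]
    have h2 : T * ((B + |lam| * (kb * |v x₀|)) / abar) =
      T * (B / abar) + |v x₀| * (|lam| * (kb * T) / abar) := by ring
    rw [h2] at h1
    linarith
  obtain ⟨hFM, hFL⟩ := rhs_bounds (lam := lam) h hs.continuousOn hvV
  have hp0 := (boundary_value_bounds hT hε hε1 h.a_cont hFc hab h.le_a h.a_le hFM hp hβ).2
  obtain ⟨w, hw0, hw⟩ := exists_ode_solution (ε := ε) h.a_cont hFc (F 0 / a 0)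
  obtain ⟨e, he0, he⟩ := exists_ode_solution (ε := ε) (G := fun _ => 0) h.a_cont continuous_const 1
  have he' : ∀ ξ, HasDerivAt e (-(a ξ * e ξ) / ε) ξ := fun ξ => by simpa using he ξ
  have hcont : ∀ {g g' : ℝ → ℝ}, (∀ ξ, HasDerivAt g (g' ξ) ξ) → Continuous g := fun h =>
    continuous_iff_continuousAt.2 fun ξ => (h ξ).continuousAt
  have hreg := regular_part_bounds hε h.a_cont hab h.le_a h.a_le h.a_lip hFM hFL hw0 hw
  have hw0b := (hreg 0 (left_mem_Icc.2 hT.le)).1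
  set c := p 0 - w 0 with hc
  have hcb : |c| ≤ C2 / ε := by
    have h1 : M / abar ≤ M / abar / ε := by
      rw [le_div_iff₀ hε]
      have : 0 ≤ M / abar := by positivity
      nlinarith
    refine (abs_sub _ _).trans ?_
    rw [hC2, add_div]
    linarith
  have hpe : ∀ x, 0 ≤ x → p x = w x + c * e x := by
    intro x hx
    have := ode_abs_le (φ := fun s => p s - (w s + c * e s)) (ψ := fun _ => 0) (ψ' := fun _ => 0)
      hε h.a_cont hx (fun s => (hp s).fun_sub ((hw s).fun_add ((he s).const_mul c)))
      (fun s => hasDerivAt_const s _) (by simp [hc, he0]) (fun s _ => by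
        rw [abs_le]
        constructor <;> · apply le_of_eq; field_simp; ring)
    have h1 := abs_nonpos_iff.1 this
    linarith
  have hMa : 0 ≤ M / abar := by positivity
  have hCB : 0 ≤ C2 * (B / abar) := by positivity
  refine ⟨w, fun x => c * e x, ⟨hcont hw, (hcont he).const_mul c, ?_, ?_, ?_, ?_, ?_, ?_, ?_⟩⟩
  · intro ξ
    refine ((hw ξ).fun_add ((he ξ).const_mul c)).congr_deriv ?_
    simp only [F]
    ring
  · intro ξ hξ
    rw [hvp ξ hξ]
    congr 1
    apply intervalIntegral.integral_congr
    intro s hs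
    rw [uIcc_of_le hξ.1] at hs
    exact hpe s hs.1
  · intro ξ hξ
    linarith [hvV ξ hξ]
  · intro ξ hξ
    linarith [(hreg ξ hξ).1]
  · intro x hx y hy
    have h1 : ‖w x - w y‖ ≤ C1 * ‖x - y‖ :=
      (convex_Icc 0 T).norm_image_sub_le_of_norm_hasDerivWithin_le
        (fun z _ => (hw z).hasDerivWithinAt) (fun z hz => (hreg z hz).2) hy hx
    rw [Real.norm_eq_abs, Real.norm_eq_abs] at h1
    refine h1.trans (mul_le_mul_of_nonneg_right ?_ (abs_nonneg _))
    linarith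
  · intro ξ hξ
    have h1 := homogeneous_bounds hε h.a_cont h.le_a h.a_le he0 he' hξ.1
    rw [abs_mul, abs_of_nonneg ((Real.exp_pos _).le.trans h1.1)]
    have h2 : C2 ≤ V + M / abar + C1 + C2 * (B / abar) + 1 := by
      have := mul_le_mul_of_nonneg_left hBa hC20
      linarith
    have h3 : C2 / ε ≤ (V + M / abar + C1 + C2 * (B / abar) + 1) / ε := by gcongr
    exact mul_le_mul (hcb.trans h3) h1.2 ((Real.exp_pos _).le.trans h1.1) (by positivity)
  · intro x hx y hy
    have h1 := homogeneous_osc hε h.a_cont hab h.le_a h.a_le he0 he' hx.1 hy.1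
    rw [← mul_sub, abs_mul]
    set X := |Real.exp (-(abar * x / ε)) - Real.exp (-(abar * y / ε))|
    have hX : 0 ≤ X := abs_nonneg _
    calc |c| * |e x - e y| ≤ C2 / ε * (B / abar * X) := by gcongr
      _ = C2 * (B / abar) / ε * X := by ring
      _ ≤ _ := by
        gcongr
        linarith

/-! ### Estimates on a single mesh cell -/

/-- Decrease of the layer function `exp (-abar s / ε)` over `[x, y]`. -/
noncomputable def layerDrop (abar ε x y : ℝ) : ℝ :=
  Real.exp (-(abar * x / ε)) - Real.exp (-(abar * y / ε))

/-- Order of the variation of the flux over a cell. -/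
noncomputable def cellErr (abar ε x y : ℝ) : ℝ :=
  (y - x) ^ 2 + min (layerDrop abar ε x y) ((y - x) * layerDrop abar ε x y / ε)

theorem layerDrop_nonneg {abar ε x y : ℝ} (ha : 0 < abar) (hε : 0 < ε) (hxy : x ≤ y) :
    0 ≤ layerDrop abar ε x y := by
  rw [layerDrop, sub_nonneg]
  apply Real.exp_le_exp.2 (neg_le_neg _)
  gcongr

theorem cellErr_nonneg {abar ε x y : ℝ} (ha : 0 < abar) (hε : 0 < ε) (hxy : x ≤ y) :
    0 ≤ cellErr abar ε x y := by
  have h1 := layerDrop_nonneg ha hε hxy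
  have h2 : 0 ≤ y - x := sub_nonneg.2 hxy
  rw [cellErr]
  have : 0 ≤ min (layerDrop abar ε x y) ((y - x) * layerDrop abar ε x y / ε) :=
    le_min h1 (by positivity)
  positivity

theorem integral_abs_sub_mean_le_two_mul {g : ℝ → ℝ} (hg : Continuous g) {x y : ℝ} (hxy : x < y) :
    ∫ s in x..y, |g s - (∫ t in x..y, g t) / (y - x)| ≤ 2 * ∫ s in x..y, |g s| := by
  have hpos : 0 < y - x := sub_pos.2 hxy
  set m := (∫ t in x..y, g t) / (y - x)
  have h1 : ∫ s in x..y, |g s - m| ≤ ∫ s in x..y, (|g s| + |m|) :=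
    intervalIntegral.integral_mono_on hxy.le (Continuous.intervalIntegrable (by fun_prop) _ _)
      (Continuous.intervalIntegrable (by fun_prop) _ _) (fun s _ => abs_sub _ _)
  rw [intervalIntegral.integral_add (Continuous.intervalIntegrable (by fun_prop) _ _)
    (Continuous.intervalIntegrable (by fun_prop) _ _), intervalIntegral.integral_const,
    smul_eq_mul] at h1
  have h2 : (y - x) * |m| = |∫ t in x..y, g t| := by
    simp only [m, abs_div, abs_of_pos hpos]
    field_simp
  have h3 := intervalIntegral.abs_integral_le_integral_abs (f := g) (μ := volume) hxy.le
  linarith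

theorem integral_abs_sub_mean_le_osc {g : ℝ → ℝ} (hg : Continuous g) {x y ω : ℝ} (hxy : x < y)
    (hω : ∀ s ∈ Icc x y, ∀ t ∈ Icc x y, |g s - g t| ≤ ω) :
    ∫ s in x..y, |g s - (∫ t in x..y, g t) / (y - x)| ≤ (y - x) * ω := by
  have hpos : 0 < y - x := sub_pos.2 hxy
  have h1 : ∀ s ∈ Icc x y, |g s - (∫ t in x..y, g t) / (y - x)| ≤ ω := by
    intro s hs
    have h2 : g s - (∫ t in x..y, g t) / (y - x) = (∫ t in x..y, (g s - g t)) / (y - x) := by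
      rw [intervalIntegral.integral_sub (Continuous.intervalIntegrable (by fun_prop) _ _)
        (hg.intervalIntegrable _ _), intervalIntegral.integral_const, smul_eq_mul]
      field_simp
    rw [h2, abs_div, abs_of_pos hpos, div_le_iff₀ hpos]
    have := intervalIntegral.norm_integral_le_of_norm_le_const (a := x) (b := y)
      (f := fun t => g s - g t) (C := ω) (fun t ht => by
        rw [uIoc_of_le hxy.le] at ht
        exact hω s hs t ⟨ht.1.le, ht.2⟩)
    rwa [abs_of_pos hpos] at this
  calc ∫ s in x..y, |g s - (∫ t in x..y, g t) / (y - x)| ≤ ∫ _ in x..y, ω :=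
        intervalIntegral.integral_mono_on hxy.le (Continuous.intervalIntegrable (by fun_prop) _ _)
          (Continuous.intervalIntegrable (by fun_prop) _ _) h1
    _ = _ := by rw [intervalIntegral.integral_const, smul_eq_mul]

namespace Decomposition

variable {T abar C ε α : ℝ} {a F v w l : ℝ → ℝ}

theorem flux_cont (D : Decomposition T abar C ε α a F v w l) : Continuous fun s => w s + l s :=
  D.w_cont.add D.l_cont

theorem C_nonneg (D : Decomposition T abar C ε α a F v w l) (hT : 0 < T) : 0 ≤ C :=
  (abs_nonneg _).trans (D.v_le 0 (left_mem_Icc.2 hT.le))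

theorem sub_eq_integral (D : Decomposition T abar C ε α a F v w l) {x y : ℝ} (hx : x ∈ Icc 0 T)
    (hy : y ∈ Icc 0 T) : v y - v x = ∫ s in x..y, (w s + l s) := by
  rw [D.v_eq x hx, D.v_eq y hy]
  have := intervalIntegral.integral_add_adjacent_intervals (μ := volume)
    (D.flux_cont.intervalIntegrable 0 x) (D.flux_cont.intervalIntegrable x y)
  linarith

theorem integral_abs_layer_le (D : Decomposition T abar C ε α a F v w l) (ha : 0 < abar)
    (hε : 0 < ε) {x y : ℝ} (hx : 0 ≤ x) (hxy : x ≤ y) (hy : y ≤ T) :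
    ∫ s in x..y, |l s| ≤ C / abar * layerDrop abar ε x y := by
  have h1 : ∫ s in x..y, |l s| ≤ ∫ s in x..y, C / ε * Real.exp (-(abar * s / ε)) :=
    intervalIntegral.integral_mono_on hxy (D.l_cont.abs.intervalIntegrable _ _)
      (Continuous.intervalIntegrable (by fun_prop) _ _)
      (fun s hs => D.l_le s ⟨hx.trans hs.1, hs.2.trans hy⟩)
  rw [intervalIntegral.integral_const_mul, integral_exp_neg_mul ha hε] at h1
  refine h1.trans (le_of_eq ?_)
  rw [layerDrop]
  field_simp

theorem integral_abs_flux_le (D : Decomposition T abar C ε α a F v w l) (ha : 0 < abar)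
    (hε : 0 < ε) {x y : ℝ} (hx : 0 ≤ x) (hxy : x ≤ y) (hy : y ≤ T) :
    ∫ s in x..y, |w s + l s| ≤ C * ((y - x) + layerDrop abar ε x y / abar) := by
  have h0 : ∫ s in x..y, |w s + l s| ≤ ∫ s in x..y, (C + |l s|) :=
    intervalIntegral.integral_mono_on hxy (D.flux_cont.abs.intervalIntegrable _ _)
      ((continuous_const.add D.l_cont.abs).intervalIntegrable _ _)
      (fun s hs => (abs_add_le _ _).trans
        (add_le_add (D.w_le s ⟨hx.trans hs.1, hs.2.trans hy⟩) le_rfl))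
  rw [intervalIntegral.integral_add (continuous_const.intervalIntegrable _ _)
    (D.l_cont.abs.intervalIntegrable _ _), intervalIntegral.integral_const, smul_eq_mul] at h0
  have h1 := D.integral_abs_layer_le ha hε hx hxy hy
  calc _ ≤ (y - x) * C + C / abar * layerDrop abar ε x y := by linarith
    _ = _ := by ring

theorem integral_abs_flux_sub_mean_le (D : Decomposition T abar C ε α a F v w l) (ha : 0 < abar)
    (hε : 0 < ε) {x y : ℝ} (hx : 0 ≤ x) (hxy : x < y) (hy : y ≤ T) :
    ∫ s in x..y, |w s + l s - (v y - v x) / (y - x)| ≤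
      C * (1 + 2 / abar) * cellErr abar ε x y := by
  have hpos : 0 < y - x := sub_pos.2 hxy
  have hT : 0 < T := hx.trans_lt (hxy.trans_le hy)
  have hC := D.C_nonneg hT
  have hwc := D.w_cont
  have hlc := D.l_cont
  have hμ := layerDrop_nonneg ha hε hxy.le
  have hmem : ∀ s ∈ Icc x y, s ∈ Icc 0 T := fun s hs => ⟨hx.trans hs.1, hs.2.trans hy⟩
  rw [D.sub_eq_integral (hmem x (left_mem_Icc.2 hxy.le)) (hmem y (right_mem_Icc.2 hxy.le)),
    intervalIntegral.integral_add (hwc.intervalIntegrable _ _) (hlc.intervalIntegrable _ _)]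
  have h1 := integral_abs_sub_mean_le_osc hwc hxy (ω := C * (y - x)) (fun s hs t ht => by
    refine (D.w_lip s (hmem s hs) t (hmem t ht)).trans (mul_le_mul_of_nonneg_left ?_ hC)
    rw [abs_le]; constructor <;> linarith [hs.1, hs.2, ht.1, ht.2])
  have h2 := integral_abs_sub_mean_le_two_mul hlc hxy
  have h3 := D.integral_abs_layer_le ha hε hx hxy.le hy
  have h4 := integral_abs_sub_mean_le_osc hlc hxy (ω := C / ε * layerDrop abar ε x y)
    (fun s hs t ht => by
      refine (D.l_osc s (hmem s hs) t (hmem t ht)).trans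
        (mul_le_mul_of_nonneg_left ?_ (by positivity))
      have hmono : ∀ {p q : ℝ}, p ≤ q → Real.exp (-(abar * q / ε)) ≤ Real.exp (-(abar * p / ε)) :=
        fun hpq => Real.exp_le_exp.2 (neg_le_neg (by gcongr))
      rw [layerDrop, abs_le]
      constructor <;> linarith [hmono hs.1, hmono hs.2, hmono ht.1, hmono ht.2])
  set mw := (∫ t in x..y, w t) / (y - x)
  set ml := (∫ t in x..y, l t) / (y - x)
  have h5 : ∫ s in x..y, |w s + l s - ((∫ t in x..y, w t) + ∫ t in x..y, l t) / (y - x)| ≤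
      ∫ s in x..y, (|w s - mw| + |l s - ml|) := by
    refine intervalIntegral.integral_mono_on hxy.le
      (Continuous.intervalIntegrable (by fun_prop) _ _)
      (Continuous.intervalIntegrable (by fun_prop) _ _) (fun s _ => ?_)
    refine le_trans (le_of_eq ?_) (abs_add_le _ _)
    congr 1
    simp only [mw, ml]
    ring
  rw [intervalIntegral.integral_add (Continuous.intervalIntegrable (by fun_prop) _ _)
    (Continuous.intervalIntegrable (by fun_prop) _ _)] at h5
  have h6 : ∫ s in x..y, |l s - ml| ≤ C * (1 + 2 / abar) *
      min (layerDrop abar ε x y) ((y - x) * layerDrop abar ε x y / ε) := by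
    rw [mul_min_of_nonneg _ _ (by positivity)]
    apply le_min
    · calc _ ≤ 2 * (C / abar * layerDrop abar ε x y) := by linarith
        _ = C * (2 / abar) * layerDrop abar ε x y := by ring
        _ ≤ _ := by gcongr; linarith
    · calc _ ≤ C * 1 * ((y - x) * layerDrop abar ε x y / ε) := by
            refine h4.trans (le_of_eq (by ring))
        _ ≤ _ := by
          gcongr
          have : 0 < 2 / abar := by positivity
          linarith
  have h7 : (y - x) * (C * (y - x)) ≤ C * (1 + 2 / abar) * (y - x) ^ 2 := by
    calc _ = C * 1 * (y - x) ^ 2 := by ring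
      _ ≤ _ := by
        gcongr
        have : 0 < 2 / abar := by positivity
        linarith
  rw [cellErr]
  linarith

end Decomposition

theorem taylor_interpolation {T B : ℝ} {k k' : ℝ → ℝ} (hk : TaylorBound T B k k') {x y s : ℝ}
    (hB : 0 ≤ B) (hx : 0 ≤ x) (hxy : x < y) (hy : y ≤ T) (hs : s ∈ Icc x y) :
    |k s - (k x + (k y - k x) / (y - x) * (s - x))| ≤ 2 * B * (y - x) ^ 2 := by
  have hpos : 0 < y - x := sub_pos.2 hxy
  have hxm : x ∈ Icc 0 T := ⟨hx, hxy.le.trans hy⟩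
  have h1 := hk x hxm s ⟨hx.trans hs.1, hs.2.trans hy⟩
  have h2 := hk x hxm y ⟨hx.trans hxy.le, hy⟩
  set t := (s - x) / (y - x)
  have ht0 : 0 ≤ t := div_nonneg (by linarith [hs.1]) hpos.le
  have ht1 : t ≤ 1 := (div_le_one hpos).2 (by linarith [hs.2])
  have h3 : k s - (k x + (k y - k x) / (y - x) * (s - x)) =
      (k s - k x - k' x * (s - x)) - t * (k y - k x - k' x * (y - x)) := by
    simp only [t]
    field_simp
    ring
  rw [h3]
  refine (abs_sub _ _).trans ?_
  rw [abs_mul, abs_of_nonneg ht0]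
  have h4 : t * |k y - k x - k' x * (y - x)| ≤ 1 * (B * (y - x) ^ 2) :=
    mul_le_mul ht1 h2 (abs_nonneg _) zero_le_one
  have h5 : (s - x) ^ 2 ≤ (y - x) ^ 2 :=
    pow_le_pow_left₀ (by linarith [hs.1]) (by linarith [hs.2]) 2
  have h6 := mul_le_mul_of_nonneg_left h5 hB
  linarith

theorem integral_linear_mul_linear (c₀ c₁ d₀ d₁ x y : ℝ) :
    ∫ s in x..y, (c₀ + c₁ * (s - x)) * (d₀ + d₁ * (s - x)) =
      (y - x) * (c₀ * d₀ + (c₀ + c₁ * (y - x)) * (d₀ + d₁ * (y - x))) / 2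
        - (y - x) * (c₁ * (y - x)) * (d₁ * (y - x)) / 6 := by
  have hd : ∀ s : ℝ, HasDerivAt (fun s => c₀ * d₀ * (s - x) + (c₀ * d₁ + c₁ * d₀) / 2 * (s - x) ^ 2
      + c₁ * d₁ / 3 * (s - x) ^ 3) ((c₀ + c₁ * (s - x)) * (d₀ + d₁ * (s - x))) s := by
    intro s
    have h0 := (hasDerivAt_id s).sub_const x
    refine (((h0.const_mul (c₀ * d₀)).fun_add ((h0.fun_pow 2).const_mul
      ((c₀ * d₁ + c₁ * d₀) / 2))).fun_add ((h0.fun_pow 3).const_mul (c₁ * d₁ / 3))).congr_deriv ?_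
    simp
    ring
  rw [intervalIntegral.integral_eq_sub_of_hasDerivAt (fun s _ => hd s)
    (Continuous.intervalIntegrable (by fun_prop) _ _)]
  ring

/-- Trapezoidal rule on one cell. -/
theorem Decomposition.trapezoid_cell {T abar C ε α B : ℝ} {a F v w l k k' : ℝ → ℝ}
    (D : Decomposition T abar C ε α a F v w l) (ha : 0 < abar) (hε : 0 < ε) (hB : 0 ≤ B)
    (hk : TaylorBound T B k k') (hkb : ∀ s, |k s| ≤ B) (hkl : ∀ s t, |k s - k t| ≤ B * |s - t|)
    {x y : ℝ} (hx : 0 ≤ x) (hxy : x < y) (hy : y ≤ T) :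
    |(∫ s in x..y, k s * v s) - (y - x) * (k x * v x + k y * v y) / 2| ≤
      B * C * (6 + 6 / abar) * ((y - x) * cellErr abar ε x y
        + (y - x) ^ 2 * layerDrop abar ε x y) := by
  have hpos : 0 < y - x := sub_pos.2 hxy
  have hT : 0 < T := hx.trans_lt (hxy.trans_le hy)
  have hC := D.C_nonneg hT
  have hmem : ∀ s ∈ Icc x y, s ∈ Icc 0 T := fun s hs => ⟨hx.trans hs.1, hs.2.trans hy⟩
  have hxm := hmem x (left_mem_Icc.2 hxy.le)
  have hym := hmem y (right_mem_Icc.2 hxy.le)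
  have hkc : Continuous k := continuous_of_abs_sub_le hkl
  have hvc : ContinuousOn v (uIcc x y) := by
    rw [uIcc_of_le hxy.le]
    have : ContinuousOn (fun ξ => α + ∫ s in (0 : ℝ)..ξ, (w s + l s)) (Icc x y) :=
      (continuous_const.add (continuous_iff_continuousAt.2 fun ξ =>
        (hasDerivAt_primitive D.flux_cont ξ).continuousAt)).continuousOn
    exact this.congr fun s hs => D.v_eq s (hmem s hs)
  set m := (v y - v x) / (y - x) with hm
  set n := (k y - k x) / (y - x) with hn
  set μ := layerDrop abar ε x y
  set I := ∫ s in x..y, |w s + l s - m| with hI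
  have hμ : 0 ≤ μ := layerDrop_nonneg ha hε hxy.le
  have hIb : I ≤ C * (1 + 2 / abar) * cellErr abar ε x y :=
    D.integral_abs_flux_sub_mean_le ha hε hx hxy hy
  have hI0 : 0 ≤ I := intervalIntegral.integral_nonneg hxy.le fun _ _ => abs_nonneg _
  have hlin := integral_linear_mul_linear (k x) n (v x) m x y
  have hnx : n * (y - x) = k y - k x := by rw [hn]; field_simp
  have hmx : m * (y - x) = v y - v x := by rw [hm]; field_simp
  rw [hnx, hmx, add_sub_cancel, add_sub_cancel] at hlin
  have hnB : |n| * (y - x) ≤ B * (y - x) := by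
    rw [← abs_of_pos hpos, ← abs_mul, abs_of_pos hpos, hnx]
    have := hkl y x
    rwa [abs_of_pos hpos] at this
  -- deviation of `v` from its interpolant
  have hvdev : ∀ s ∈ Icc x y, |v s - (v x + m * (s - x))| ≤ I := by
    intro s hs
    have h1 : v s - (v x + m * (s - x)) = ∫ t in x..s, (w t + l t - m) := by
      rw [intervalIntegral.integral_sub (D.flux_cont.intervalIntegrable _ _)
        (continuous_const.intervalIntegrable _ _), ← D.sub_eq_integral hxm (hmem s hs),
        intervalIntegral.integral_const, smul_eq_mul]
      ring
    rw [h1]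
    refine (intervalIntegral.abs_integral_le_integral_abs hs.1).trans ?_
    have hc : Continuous fun t => |w t + l t - m| := (D.flux_cont.sub continuous_const).abs
    have := intervalIntegral.integral_add_adjacent_intervals (μ := volume)
      (hc.intervalIntegrable x s) (hc.intervalIntegrable s y)
    have h2 : 0 ≤ ∫ t in s..y, |w t + l t - m| :=
      intervalIntegral.integral_nonneg hs.2 fun _ _ => abs_nonneg _
    linarith
  have hint : IntervalIntegrable (fun s => k s * v s) volume x y :=
    (hkc.continuousOn.mul hvc).intervalIntegrable
  have hcl : Continuous fun s => (k x + n * (s - x)) * (v x + m * (s - x)) := by fun_prop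
  have hdev : |∫ s in x..y, (k s * v s - (k x + n * (s - x)) * (v x + m * (s - x)))| ≤
      (2 * B * (y - x) ^ 2 * C + 2 * B * I) * |y - x| := by
    rw [← Real.norm_eq_abs]
    apply intervalIntegral.norm_integral_le_of_norm_le_const
    intro s hs
    rw [uIoc_of_le hxy.le] at hs
    have hs' : s ∈ Icc x y := ⟨hs.1.le, hs.2⟩
    have h1 : k s * v s - (k x + n * (s - x)) * (v x + m * (s - x)) =
        (k s - (k x + n * (s - x))) * v s + (k x + n * (s - x)) * (v s - (v x + m * (s - x))) := by
      ring
    have h2 : |k x + n * (s - x)| ≤ 2 * B := by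
      set t := (s - x) / (y - x)
      have ht0 : 0 ≤ t := div_nonneg (by linarith [hs'.1]) hpos.le
      have ht1 : t ≤ 1 := (div_le_one hpos).2 (by linarith [hs'.2])
      have h3 : k x + n * (s - x) = (1 - t) * k x + t * k y := by
        simp only [t, n]; field_simp; ring
      rw [h3]
      refine (abs_add_le _ _).trans ?_
      rw [abs_mul, abs_mul, abs_of_nonneg ht0, abs_of_nonneg (by linarith : 0 ≤ 1 - t)]
      nlinarith [hkb x, hkb y, abs_nonneg (k x), abs_nonneg (k y)]
    rw [Real.norm_eq_abs, h1]
    refine (abs_add_le _ _).trans ?_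
    rw [abs_mul, abs_mul]
    have h4 := taylor_interpolation hk hB hx hxy hy hs'
    exact add_le_add (mul_le_mul h4 (D.v_le s (hmem s hs')) (abs_nonneg _) (by positivity))
      (mul_le_mul h2 (hvdev s hs') (abs_nonneg _) (by positivity))
  rw [intervalIntegral.integral_sub hint (hcl.intervalIntegrable _ _), hlin, abs_of_pos hpos] at hdev
  have hdv : |v y - v x| ≤ C * ((y - x) + μ / abar) := by
    rw [D.sub_eq_integral hxm hym]
    exact (intervalIntegral.abs_integral_le_integral_abs hxy.le).trans
      (D.integral_abs_flux_le ha hε hx hxy.le hy)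
  have hdk : |k y - k x| ≤ B * (y - x) := by
    have := hkl y x
    rwa [abs_of_pos hpos] at this
  have hprod : |(y - x) * (k y - k x) * (v y - v x) / 6| ≤
      (y - x) * (B * (y - x)) * (C * ((y - x) + μ / abar)) := by
    rw [abs_div, abs_mul, abs_mul, abs_of_pos hpos, abs_of_pos (by norm_num : (0 : ℝ) < 6)]
    have h1 : (y - x) * |k y - k x| * |v y - v x| ≤
      (y - x) * (B * (y - x)) * (C * ((y - x) + μ / abar)) := by gcongr
    have h2 : 0 ≤ (y - x) * |k y - k x| * |v y - v x| := by positivity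
    linarith
  have herr : (y - x) ^ 2 ≤ cellErr abar ε x y := by
    rw [cellErr]
    have : 0 ≤ min (layerDrop abar ε x y) ((y - x) * layerDrop abar ε x y / ε) :=
      le_min hμ (by positivity)
    linarith
  have htot : |(∫ s in x..y, k s * v s) - (y - x) * (k x * v x + k y * v y) / 2| ≤
      (2 * B * (y - x) ^ 2 * C + 2 * B * I) * (y - x) +
        (y - x) * (B * (y - x)) * (C * ((y - x) + μ / abar)) := by
    have h1 : (∫ s in x..y, k s * v s) - (y - x) * (k x * v x + k y * v y) / 2 =
        ((∫ s in x..y, k s * v s) - ((y - x) * (k x * v x + k y * v y) / 2 -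
          (y - x) * (k y - k x) * (v y - v x) / 6)) - (y - x) * (k y - k x) * (v y - v x) / 6 := by
      ring
    rw [h1]
    exact (abs_sub _ _).trans (add_le_add hdev hprod)
  refine htot.trans ?_
  set e := cellErr abar ε x y
  have he : 0 ≤ e := (sq_nonneg _).trans herr
  calc _ ≤ (2 * B * e * C + 2 * B * (C * (1 + 2 / abar) * e)) * (y - x) +
        (B * C * e * (y - x) + B * C / abar * ((y - x) ^ 2 * μ)) := by
        have h1 : (y - x) * (B * (y - x)) * (C * ((y - x) + μ / abar)) =
          B * C * (y - x) ^ 2 * (y - x) + B * C / abar * ((y - x) ^ 2 * μ) := by ring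
        rw [h1]
        gcongr
    _ = B * C * (5 + 4 / abar) * ((y - x) * e) + B * C * (1 / abar) * ((y - x) ^ 2 * μ) := by ring
    _ ≤ B * C * (6 + 6 / abar) * ((y - x) * e) + B * C * (6 + 6 / abar) * ((y - x) ^ 2 * μ) := by
        gcongr
        · norm_num
        · norm_num
        · have : 1 / abar ≤ 6 / abar := by gcongr; norm_num
          linarith
    _ = _ := by ring

/-! ### Exponential hat functions -/

/-- Increasing branch of the hat function on `[x, y]`. -/
noncomputable def leftHat (ε a x y s : ℝ) : ℝ :=
  (Real.exp (a * (s - x) / ε) - 1) / (Real.exp (a * (y - x) / ε) - 1)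

/-- Decreasing branch of the hat function on `[x, y]`. -/
noncomputable def rightHat (ε a x y s : ℝ) : ℝ :=
  (1 - Real.exp (-(a * (y - s) / ε))) / (1 - Real.exp (-(a * (y - x) / ε)))

section hats

variable {ε a x y : ℝ}

theorem continuous_leftHat : Continuous (leftHat ε a x y) := by
  unfold leftHat; fun_prop

theorem continuous_rightHat : Continuous (rightHat ε a x y) := by
  unfold rightHat; fun_prop

theorem leftHat_mem (hε : 0 < ε) (ha : 0 < a) (hxy : x < y) {s : ℝ} (hs : s ∈ Icc x y) :
    0 ≤ leftHat ε a x y s ∧ leftHat ε a x y s ≤ 1 := by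
  have h1 := exp_sub_one_pos hε ha (sub_pos.2 hxy)
  have h2 : 0 ≤ a * (s - x) / ε := div_nonneg (mul_nonneg ha.le (by linarith [hs.1])) hε.le
  have h3 := Real.one_le_exp h2
  have h4 : Real.exp (a * (s - x) / ε) ≤ Real.exp (a * (y - x) / ε) := by
    apply Real.exp_le_exp.2
    have := hs.2
    gcongr
  exact ⟨div_nonneg (by linarith) h1.le, (div_le_one h1).2 (by linarith)⟩

theorem rightHat_mem (hε : 0 < ε) (ha : 0 < a) (hxy : x < y) {s : ℝ} (hs : s ∈ Icc x y) :
    0 ≤ rightHat ε a x y s ∧ rightHat ε a x y s ≤ 1 := by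
  have h1 := one_sub_exp_neg_pos hε ha (sub_pos.2 hxy)
  have h2 : 0 ≤ a * (y - s) / ε := div_nonneg (mul_nonneg ha.le (by linarith [hs.2])) hε.le
  have h3 : Real.exp (-(a * (y - s) / ε)) ≤ 1 := Real.exp_le_one_iff.2 (by linarith)
  have h4 : Real.exp (-(a * (y - x) / ε)) ≤ Real.exp (-(a * (y - s) / ε)) := by
    apply Real.exp_le_exp.2 (neg_le_neg _)
    have := hs.1
    gcongr
  exact ⟨div_nonneg (by linarith) h1.le, (div_le_one h1).2 (by linarith)⟩

theorem leftHat_left : leftHat ε a x y x = 0 := by simp [leftHat]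

theorem leftHat_right (hε : 0 < ε) (ha : 0 < a) (hxy : x < y) : leftHat ε a x y y = 1 :=
  div_self (exp_sub_one_pos hε ha (sub_pos.2 hxy)).ne'

theorem rightHat_left (hε : 0 < ε) (ha : 0 < a) (hxy : x < y) : rightHat ε a x y x = 1 :=
  div_self (one_sub_exp_neg_pos hε ha (sub_pos.2 hxy)).ne'

theorem rightHat_right : rightHat ε a x y y = 0 := by simp [rightHat]

theorem hasDerivAt_exp_left (ε a x s : ℝ) :
    HasDerivAt (fun s => Real.exp (a * (s - x) / ε)) (Real.exp (a * (s - x) / ε) * (a / ε)) s := by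
  have h1 : HasDerivAt (fun s : ℝ => a * (s - x) / ε) (a / ε) s := by
    simpa using ((((hasDerivAt_id s).sub_const x).const_mul a).div_const ε)
  exact h1.exp

theorem hasDerivAt_exp_right (ε a y s : ℝ) :
    HasDerivAt (fun s => Real.exp (-(a * (y - s) / ε)))
      (Real.exp (-(a * (y - s) / ε)) * (a / ε)) s := by
  have h1 : HasDerivAt (fun s : ℝ => -(a * (y - s) / ε)) (a / ε) s := by
    refine (((((hasDerivAt_id s).const_sub y).const_mul a).div_const ε).fun_neg).congr_deriv ?_
    ring
  exact h1.exp

theorem hasDerivAt_leftHat (hε : 0 < ε) (ha : 0 < a) (hxy : x < y) (s : ℝ) :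
    HasDerivAt (leftHat ε a x y) ((a * leftHat ε a x y s + expWeight ε a (y - x)) / ε) s := by
  refine (((hasDerivAt_exp_left ε a x s).sub_const 1).div_const _).congr_deriv ?_
  have h1 := (exp_sub_one_pos hε ha (sub_pos.2 hxy)).ne'
  rw [leftHat, expWeight]
  generalize Real.exp (a * (y - x) / ε) = Y at *
  field_simp
  ring

theorem hasDerivAt_rightHat (hε : 0 < ε) (ha : 0 < a) (hxy : x < y) (s : ℝ) :
    HasDerivAt (rightHat ε a x y)
      ((a * rightHat ε a x y s + -(a + expWeight ε a (y - x))) / ε) s := by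
  refine (((hasDerivAt_exp_right ε a y s).const_sub 1).div_const _).congr_deriv ?_
  have h1 := (one_sub_exp_neg_pos hε ha (sub_pos.2 hxy)).ne'
  rw [rightHat, add_expWeight hε ha (sub_pos.2 hxy)]
  generalize Real.exp (-(a * (y - x) / ε)) = Y at *
  field_simp
  ring

theorem integral_leftHat (hε : 0 < ε) (ha : 0 < a) (hxy : x < y) :
    ∫ s in x..y, leftHat ε a x y s = ε / a - (y - x) / (Real.exp (a * (y - x) / ε) - 1) := by
  have h1 := (exp_sub_one_pos hε ha (sub_pos.2 hxy)).ne'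
  have hd : ∀ s, HasDerivAt (fun s => (ε / a * Real.exp (a * (s - x) / ε) - s) /
      (Real.exp (a * (y - x) / ε) - 1)) (leftHat ε a x y s) s := by
    intro s
    refine (((((hasDerivAt_exp_left ε a x s).const_mul (ε / a)).fun_sub
      (hasDerivAt_id s))).div_const _).congr_deriv ?_
    rw [leftHat]
    congr 1
    field_simp
  rw [intervalIntegral.integral_eq_sub_of_hasDerivAt (fun s _ => hd s)
    (continuous_leftHat.intervalIntegrable _ _), sub_self, mul_zero, zero_div, Real.exp_zero]
  generalize Real.exp (a * (y - x) / ε) = Y at *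
  field_simp
  ring

theorem integral_rightHat (hε : 0 < ε) (ha : 0 < a) (hxy : x < y) :
    ∫ s in x..y, rightHat ε a x y s =
      (y - x) / (1 - Real.exp (-(a * (y - x) / ε))) - ε / a := by
  have h1 := (one_sub_exp_neg_pos hε ha (sub_pos.2 hxy)).ne'
  have hd : ∀ s, HasDerivAt (fun s => (s - ε / a * Real.exp (-(a * (y - s) / ε))) /
      (1 - Real.exp (-(a * (y - x) / ε)))) (rightHat ε a x y s) s := by
    intro s
    refine (((hasDerivAt_id s).fun_sub ((hasDerivAt_exp_right ε a y s).const_mul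
      (ε / a))).div_const _).congr_deriv ?_
    rw [rightHat]
    congr 1
    field_simp
  rw [intervalIntegral.integral_eq_sub_of_hasDerivAt (fun s _ => hd s)
    (continuous_rightHat.intervalIntegrable _ _), sub_self, mul_zero, zero_div, neg_zero,
    Real.exp_zero]
  generalize Real.exp (-(a * (y - x) / ε)) = Y at *
  field_simp
  ring

theorem integral_mul_leftHat (hε : 0 < ε) (ha : 0 < a) (hxy : x < y) :
    ∫ s in x..y, (s - y) * leftHat ε a x y s =
      1 / (Real.exp (a * (y - x) / ε) - 1) * ((y - x) * (ε / a - x) + (y ^ 2 / 2 - x ^ 2 / 2))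
        - ε ^ 2 / a ^ 2 := by
  have h1 := (exp_sub_one_pos hε ha (sub_pos.2 hxy)).ne'
  have hd : ∀ s, HasDerivAt (fun s => (((s - y) * (ε / a) - ε ^ 2 / a ^ 2) *
      Real.exp (a * (s - x) / ε) - (s - y) ^ 2 / 2) /
      (Real.exp (a * (y - x) / ε) - 1)) ((s - y) * leftHat ε a x y s) s := by
    intro s
    have h0 := (hasDerivAt_id s).sub_const y
    refine (((((h0.mul_const (ε / a)).sub_const (ε ^ 2 / a ^ 2)).fun_mul
      (hasDerivAt_exp_left ε a x s)).fun_sub ((h0.fun_pow 2).div_const 2)).div_const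
        _).congr_deriv ?_
    rw [leftHat, mul_div_assoc']
    simp
    field_simp
    ring
  rw [intervalIntegral.integral_eq_sub_of_hasDerivAt (fun s _ => hd s)
    (((continuous_id.sub continuous_const).mul continuous_leftHat).intervalIntegrable _ _),
    sub_self, sub_self, mul_zero, zero_div, Real.exp_zero]
  generalize Real.exp (a * (y - x) / ε) = Y at *
  field_simp
  ring

theorem integral_mul_rightHat (hε : 0 < ε) (ha : 0 < a) (hxy : x < y) :
    ∫ s in x..y, (s - x) * rightHat ε a x y s =
      1 / (1 - Real.exp (-(a * (y - x) / ε))) *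
        ((y - x) * (y - ε / a) - (y ^ 2 / 2 - x ^ 2 / 2)) + ε ^ 2 / a ^ 2 := by
  have h1 := (one_sub_exp_neg_pos hε ha (sub_pos.2 hxy)).ne'
  have hd : ∀ s, HasDerivAt (fun s => ((s - x) ^ 2 / 2 - ((s - x) * (ε / a) - ε ^ 2 / a ^ 2) *
      Real.exp (-(a * (y - s) / ε))) /
      (1 - Real.exp (-(a * (y - x) / ε)))) ((s - x) * rightHat ε a x y s) s := by
    intro s
    have h0 := (hasDerivAt_id s).sub_const x
    refine ((((h0.fun_pow 2).div_const 2).fun_sub (((h0.mul_const (ε / a)).sub_const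
      (ε ^ 2 / a ^ 2)).fun_mul (hasDerivAt_exp_right ε a y s))).div_const _).congr_deriv ?_
    rw [rightHat, mul_div_assoc']
    simp
    field_simp
    ring
  rw [intervalIntegral.integral_eq_sub_of_hasDerivAt (fun s _ => hd s)
    (((continuous_id.sub continuous_const).mul continuous_rightHat).intervalIntegrable _ _),
    sub_self, sub_self, mul_zero, zero_div, neg_zero, Real.exp_zero]
  generalize Real.exp (-(a * (y - x) / ε)) = Y at *
  field_simp
  ring

end hats

namespace Decomposition

variable {T abar C ε α : ℝ} {a F v w l : ℝ → ℝ}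

/-- Exactness of the fitted scheme: testing the equation with `ψ`, `ε ψ' = b ψ + κ`. -/
theorem hat_identity (D : Decomposition T abar C ε α a F v w l) (hε : 0 < ε) (ha : Continuous a)
    (hF : Continuous F) {ψ : ℝ → ℝ} {b κ : ℝ} (hψ : ∀ s, HasDerivAt ψ ((b * ψ s + κ) / ε) s)
    {x y : ℝ} (hx : x ∈ Icc 0 T) (hy : y ∈ Icc 0 T) :
    ε * ψ y * (w y + l y) - ε * ψ x * (w x + l x) - κ * (v y - v x) =
      ∫ s in x..y, ψ s * (F s - (a s - b) * (w s + l s)) := by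
  have hψc : Continuous ψ := continuous_iff_continuousAt.2 fun s => (hψ s).continuousAt
  have hwc := D.w_cont
  have hlc := D.l_cont
  have hd : ∀ s, HasDerivAt (fun s => ε * ψ s * (w s + l s) -
      κ * ∫ t in (0 : ℝ)..s, (w t + l t)) (ψ s * (F s - (a s - b) * (w s + l s))) s := by
    intro s
    refine ((((hψ s).const_mul ε).fun_mul (D.ode s)).fun_sub
      ((hasDerivAt_primitive D.flux_cont s).const_mul κ)).congr_deriv ?_
    field_simp
    ring
  rw [intervalIntegral.integral_eq_sub_of_hasDerivAt (fun s _ => hd s)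
    (Continuous.intervalIntegrable (by fun_prop) _ _), D.v_eq x hx, D.v_eq y hy]
  ring

/-- Consistency error of the tested equation on one cell. -/
theorem hat_consistency (D : Decomposition T abar C ε α a F v w l) (ha : Continuous a)
    (hF : Continuous F) {ψ : ℝ → ℝ} (hψc : Continuous ψ) {b φ₀ φ₁ a₁ δ δa x₀ x y : ℝ}
    (hxy : x < y) (hψ : ∀ s ∈ Icc x y, 0 ≤ ψ s ∧ ψ s ≤ 1) (hx₀ : x₀ ∈ Icc x y)
    (hδ : ∀ s ∈ Icc x y, |F s - φ₀ - φ₁ * (s - x₀)| ≤ δ)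
    (hδa : ∀ s ∈ Icc x y, |a s - b - a₁ * (s - x₀)| ≤ δa) :
    |(∫ s in x..y, ψ s * (F s - (a s - b) * (w s + l s))) -
      (φ₀ * (∫ s in x..y, ψ s) + φ₁ * (∫ s in x..y, (s - x₀) * ψ s)
        - a₁ * (∫ s in x..y, (s - x₀) * ψ s) * ((v y - v x) / (y - x)))| ≤
      (y - x) * δ + δa * (∫ s in x..y, |w s + l s|) +
        |a₁| * (y - x) * ∫ s in x..y, |w s + l s - (v y - v x) / (y - x)| := by
  have hwc := D.w_cont
  have hlc := D.l_cont
  set m := (v y - v x) / (y - x)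
  have h1 : (∫ s in x..y, ψ s * (F s - (a s - b) * (w s + l s))) -
      (φ₀ * (∫ s in x..y, ψ s) + φ₁ * (∫ s in x..y, (s - x₀) * ψ s)
        - a₁ * (∫ s in x..y, (s - x₀) * ψ s) * m) =
      ∫ s in x..y, (ψ s * (F s - (a s - b) * (w s + l s)) - (φ₀ * ψ s + φ₁ * ((s - x₀) * ψ s)
        - (a₁ * m) * ((s - x₀) * ψ s))) := by
    rw [intervalIntegral.integral_sub, intervalIntegral.integral_sub,
      intervalIntegral.integral_add, intervalIntegral.integral_const_mul,
      intervalIntegral.integral_const_mul, intervalIntegral.integral_const_mul]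
    · ring
    all_goals exact Continuous.intervalIntegrable (by fun_prop) _ _
  have h2 : ∫ s in x..y, (δ + δa * |w s + l s| + |a₁| * (y - x) * |w s + l s - m|) =
      (y - x) * δ + δa * (∫ s in x..y, |w s + l s|) +
        |a₁| * (y - x) * ∫ s in x..y, |w s + l s - m| := by
    rw [intervalIntegral.integral_add, intervalIntegral.integral_add,
      intervalIntegral.integral_const_mul, intervalIntegral.integral_const_mul,
      intervalIntegral.integral_const, smul_eq_mul]
    all_goals exact Continuous.intervalIntegrable (by fun_prop) _ _
  rw [h1, ← h2, ← Real.norm_eq_abs]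
  apply intervalIntegral.norm_integral_le_of_norm_le hxy.le
  · refine Filter.Eventually.of_forall fun s hs => ?_
    have hs' : s ∈ Icc x y := ⟨hs.1.le, hs.2⟩
    obtain ⟨hψ0, hψ1⟩ := hψ s hs'
    have h3 : ψ s * (F s - (a s - b) * (w s + l s)) - (φ₀ * ψ s + φ₁ * ((s - x₀) * ψ s)
        - (a₁ * m) * ((s - x₀) * ψ s)) = ψ s * ((F s - φ₀ - φ₁ * (s - x₀)) +
          -(a s - b - a₁ * (s - x₀)) * (w s + l s) + -(a₁ * (s - x₀)) * (w s + l s - m)) := by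
      ring
    have h4 : |s - x₀| ≤ y - x := by
      rw [abs_le]; constructor <;> linarith [hs'.1, hs'.2, hx₀.1, hx₀.2]
    rw [Real.norm_eq_abs, h3, abs_mul, abs_of_nonneg hψ0]
    have h5 : |(F s - φ₀ - φ₁ * (s - x₀)) +
          -(a s - b - a₁ * (s - x₀)) * (w s + l s) + -(a₁ * (s - x₀)) * (w s + l s - m)| ≤
        δ + δa * |w s + l s| + |a₁| * (y - x) * |w s + l s - m| := by
      refine (abs_add_le _ _).trans (add_le_add ((abs_add_le _ _).trans (add_le_add (hδ s hs') ?_)) ?_)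
      · rw [abs_mul, abs_neg]
        exact mul_le_mul_of_nonneg_right (hδa s hs') (abs_nonneg _)
      · rw [abs_mul, abs_neg, abs_mul]
        gcongr
    calc _ ≤ 1 * _ := mul_le_mul_of_nonneg_right hψ1 (abs_nonneg _)
      _ ≤ _ := by rw [one_mul]; exact h5
  · exact Continuous.intervalIntegrable (by fun_prop) _ _

end Decomposition

/-! ### The piecewise uniform mesh -/

section mesh

variable {T abar ε : ℝ} {N : ℕ}

theorem transition_pos (hT : 0 < T) (ha : 0 < abar) (hε : 0 < ε) (hN : 2 ≤ N) :
    0 < transition T abar ε N := by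
  have : 0 < Real.log N := Real.log_pos (by exact_mod_cast hN)
  rw [transition]
  exact lt_min (by positivity) (by positivity)

theorem transition_le : transition T abar ε N ≤ T / 2 := min_le_left _ _

theorem mesh_zero : mesh T abar ε N 0 = 0 := by simp [mesh]

theorem mesh_half (hN : 2 ≤ N) (he : Even N) :
    mesh T abar ε N (N / 2) = transition T abar ε N := by
  obtain ⟨m, rfl⟩ := he
  have h0 : (m + m) / 2 = m := by omega
  have hm : (m : ℝ) ≠ 0 := by
    have : m ≠ 0 := by omega
    exact_mod_cast this
  rw [mesh, h0, if_pos (by omega)]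
  push_cast
  field_simp
  ring

theorem mesh_last (hN : 2 ≤ N) : mesh T abar ε N N = T := by
  rw [mesh, if_neg (by omega)]
  have : (N : ℝ) ≠ 0 := by
    have : N ≠ 0 := by omega
    exact_mod_cast this
  field_simp
  ring

theorem mesh_step_fine {j : ℕ} (hj : j < N / 2) :
    mesh T abar ε N (j + 1) - mesh T abar ε N j = 2 * transition T abar ε N / N := by
  rw [mesh, mesh, if_pos (by omega), if_pos (by omega)]
  push_cast
  ring

theorem mesh_step_coarse (hN : 2 ≤ N) (he : Even N) {j : ℕ} (hj : N / 2 ≤ j) :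
    mesh T abar ε N (j + 1) - mesh T abar ε N j = 2 * (T - transition T abar ε N) / N := by
  rcases hj.eq_or_lt with rfl | hj'
  · rw [mesh_half hN he, mesh, if_neg (by omega)]
    obtain ⟨m, rfl⟩ := he
    have h0 : (m + m) / 2 = m := by omega
    rw [h0]
    push_cast
    ring
  · rw [mesh, mesh, if_neg (by omega), if_neg (by omega)]
    push_cast
    ring

theorem mesh_step_bounds (hT : 0 < T) (ha : 0 < abar) (hε : 0 < ε) (hN : 2 ≤ N) (he : Even N)
    (j : ℕ) : 0 < mesh T abar ε N (j + 1) - mesh T abar ε N j ∧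
      mesh T abar ε N (j + 1) - mesh T abar ε N j ≤ 2 * T / N := by
  have hρ := transition_pos hT ha hε hN
  have hρT := transition_le (T := T) (abar := abar) (ε := ε) (N := N)
  have hNp : (0 : ℝ) < N := by
    have : 0 < N := by omega
    exact_mod_cast this
  rcases lt_or_ge j (N / 2) with hj | hj
  · rw [mesh_step_fine hj]
    exact ⟨by positivity, by gcongr; linarith⟩
  · rw [mesh_step_coarse hN he hj]
    have : 0 < T - transition T abar ε N := by linarith
    exact ⟨by positivity, by gcongr; linarith⟩

theorem mesh_strictMono (hT : 0 < T) (ha : 0 < abar) (hε : 0 < ε) (hN : 2 ≤ N) (he : Even N) :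
    StrictMono (mesh T abar ε N) :=
  strictMono_nat_of_lt_succ fun j => sub_pos.1 (mesh_step_bounds hT ha hε hN he j).1

theorem mesh_mem (hT : 0 < T) (ha : 0 < abar) (hε : 0 < ε) (hN : 2 ≤ N) (he : Even N) {j : ℕ}
    (hj : j ≤ N) : mesh T abar ε N j ∈ Icc 0 T := by
  have hm := (mesh_strictMono hT ha hε hN he).monotone
  constructor
  · have := hm (Nat.zero_le j)
    rwa [mesh_zero] at this
  · have := hm hj
    rwa [mesh_last hN] at this

theorem sum_layerDrop_mesh_le (hN : 2 ≤ N) :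
    ∑ j ∈ Finset.range N, layerDrop abar ε (mesh T abar ε N j) (mesh T abar ε N (j + 1)) ≤ 1 := by
  have := Finset.sum_range_sub' (fun j => Real.exp (-(abar * mesh T abar ε N j / ε))) N
  simp only [layerDrop]
  rw [this, mesh_zero, mesh_last hN]
  have := Real.exp_pos (-(abar * T / ε))
  simp
  exact this.le

theorem fine_step_sq_div_le (hT : 0 < T) (ha : 0 < abar) (hε : 0 < ε) (hN : 2 ≤ N) :
    (2 * transition T abar ε N / N) ^ 2 / ε ≤ 2 * T / abar * (((N : ℝ) ^ 2)⁻¹ * Real.log N) := by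
  have hρ := transition_pos hT ha hε hN
  have h1 := transition_le (T := T) (abar := abar) (ε := ε) (N := N)
  have h2 : transition T abar ε N ≤ abar⁻¹ * ε * Real.log N := min_le_right _ _
  have hNp : (0 : ℝ) < N := by
    have : 0 < N := by omega
    exact_mod_cast this
  have h3 : transition T abar ε N ^ 2 ≤ T / 2 * (abar⁻¹ * ε * Real.log N) := by
    rw [sq]
    exact mul_le_mul h1 h2 hρ.le (by positivity)
  rw [div_le_iff₀ hε, div_pow, div_le_iff₀ (by positivity)]
  calc (2 * transition T abar ε N) ^ 2 = 4 * transition T abar ε N ^ 2 := by ring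
    _ ≤ 4 * (T / 2 * (abar⁻¹ * ε * Real.log N)) := by linarith
    _ = _ := by field_simp; ring

/-- Weighted sum of the cell errors. -/
theorem sum_cellErr_mesh_le (hT : 0 < T) (ha : 0 < abar) (hε : 0 < ε) (hN : 3 ≤ N) (he : Even N) :
    ∑ j ∈ Finset.range N, (mesh T abar ε N (j + 1) - mesh T abar ε N j) *
        cellErr abar ε (mesh T abar ε N j) (mesh T abar ε N (j + 1)) ≤
      (4 * T ^ 3 + 2 * T / abar + 2 * T) * (((N : ℝ) ^ 2)⁻¹ * Real.log N) := by
  have hN2 : 2 ≤ N := by omega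
  have hNp : (0 : ℝ) < N := by
    have : 0 < N := by omega
    exact_mod_cast this
  have hlog : 1 ≤ Real.log N := by
    rw [Real.le_log_iff_exp_le hNp]
    have h3 : (3 : ℝ) ≤ N := by exact_mod_cast hN
    linarith [Real.exp_one_lt_d9]
  set x := mesh T abar ε N with hx
  set ρ := transition T abar ε N with hρdef
  set Q := ((N : ℝ) ^ 2)⁻¹ * Real.log N
  have hNQ : ((N : ℝ) ^ 2)⁻¹ ≤ Q := le_mul_of_one_le_right (by positivity) hlog
  have hstep := mesh_step_bounds hT ha hε hN2 he
  have hmono := (mesh_strictMono hT ha hε hN2 he).monotone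
  have hμ : ∀ j, 0 ≤ layerDrop abar ε (x j) (x (j + 1)) := fun j =>
    layerDrop_nonneg ha hε (hmono (Nat.le_succ j))
  have hfine := fine_step_sq_div_le hT ha hε hN2
  set E : ℝ → ℝ := fun s => Real.exp (-(abar * s / ε))
  have hsum1 : ∑ j ∈ Finset.range N, (x (j + 1) - x j) ^ 3 ≤ 4 * T ^ 3 * Q := by
    have h1 : ∀ j ∈ Finset.range N, (x (j + 1) - x j) ^ 3 ≤ (2 * T / N) ^ 2 * (x (j + 1) - x j) := by
      intro j _
      obtain ⟨h2, h3⟩ := hstep j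
      have := pow_le_pow_left₀ h2.le h3 2
      calc _ = (x (j + 1) - x j) ^ 2 * (x (j + 1) - x j) := by ring
        _ ≤ _ := mul_le_mul_of_nonneg_right this h2.le
    refine (Finset.sum_le_sum h1).trans ?_
    rw [← Finset.mul_sum, Finset.sum_range_sub, hx, mesh_zero, mesh_last hN2, sub_zero]
    calc (2 * T / N) ^ 2 * T = 4 * T ^ 3 * ((N : ℝ) ^ 2)⁻¹ := by field_simp; ring
      _ ≤ _ := by gcongr
  have hsum2 : ∑ j ∈ Finset.range N, (x (j + 1) - x j) *
      min (layerDrop abar ε (x j) (x (j + 1)))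
        ((x (j + 1) - x j) * layerDrop abar ε (x j) (x (j + 1)) / ε) ≤
      2 * T / abar * Q + 2 * T * Q := by
    have hmuls := sum_layerDrop_mesh_le (T := T) (abar := abar) (ε := ε) hN2
    have hQ0 : 0 ≤ Q := le_trans (by positivity) hNQ
    have hsmall : ∀ j, x (j + 1) - x j = 2 * ρ / N → (x (j + 1) - x j) *
        min (layerDrop abar ε (x j) (x (j + 1)))
          ((x (j + 1) - x j) * layerDrop abar ε (x j) (x (j + 1)) / ε) ≤
        2 * T / abar * Q * layerDrop abar ε (x j) (x (j + 1)) := by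
      intro j hj
      calc _ ≤ (x (j + 1) - x j) *
          ((x (j + 1) - x j) * layerDrop abar ε (x j) (x (j + 1)) / ε) :=
            mul_le_mul_of_nonneg_left (min_le_right _ _) (hstep j).1.le
        _ = (2 * ρ / N) ^ 2 / ε * layerDrop abar ε (x j) (x (j + 1)) := by rw [hj]; ring
        _ ≤ _ := mul_le_mul_of_nonneg_right hfine (hμ j)
    have hc0 : 0 ≤ 2 * T / abar * Q := by positivity
    rcases min_choice (T / 2) (abar⁻¹ * ε * Real.log N) with hρ | hρ
    · have hρ' : ρ = T / 2 := hρ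
      have h1 : ∀ j ∈ Finset.range N, _ := fun j _ => hsmall j (by
        rcases lt_or_ge j (N / 2) with hj | hj
        · exact mesh_step_fine hj
        · rw [hx, mesh_step_coarse hN2 he hj, ← hρdef, hρ']; ring)
      refine (Finset.sum_le_sum h1).trans ?_
      rw [← Finset.mul_sum]
      have := mul_le_mul_of_nonneg_left hmuls hc0
      have : 0 ≤ 2 * T * Q := by positivity
      linarith
    · have hρ' : ρ = abar⁻¹ * ε * Real.log N := hρ
      have h1 : ∀ j ∈ Finset.range N, (x (j + 1) - x j) *
          min (layerDrop abar ε (x j) (x (j + 1)))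
            ((x (j + 1) - x j) * layerDrop abar ε (x j) (x (j + 1)) / ε) ≤
          2 * T / abar * Q * layerDrop abar ε (x j) (x (j + 1)) +
            2 * T / N * (E (x (max j (N / 2))) - E (x (max (j + 1) (N / 2)))) := by
        intro j _
        rcases lt_or_ge j (N / 2) with hj | hj
        · rw [max_eq_right hj.le, max_eq_right (by omega), sub_self, mul_zero, add_zero]
          exact hsmall j (mesh_step_fine hj)
        · rw [max_eq_left hj, max_eq_left (by omega)]
          have h2 : E (x j) - E (x (j + 1)) = layerDrop abar ε (x j) (x (j + 1)) := rfl
          rw [h2]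
          have h3 := mul_nonneg hc0 (hμ j)
          calc _ ≤ (x (j + 1) - x j) * layerDrop abar ε (x j) (x (j + 1)) :=
                mul_le_mul_of_nonneg_left (min_le_left _ _) (hstep j).1.le
            _ ≤ 2 * T / N * layerDrop abar ε (x j) (x (j + 1)) :=
                mul_le_mul_of_nonneg_right (hstep j).2 (hμ j)
            _ ≤ _ := by linarith
      refine (Finset.sum_le_sum h1).trans ?_
      rw [Finset.sum_add_distrib, ← Finset.mul_sum, ← Finset.mul_sum,
        Finset.sum_range_sub' (fun j => E (x (max j (N / 2)))),
        max_eq_right (Nat.zero_le _), max_eq_left (by omega)]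
      have h2 : E (x (N / 2)) = (N : ℝ)⁻¹ := by
        simp only [E, hx]
        rw [mesh_half hN2 he, ← hρdef, hρ']
        have : -(abar * (abar⁻¹ * ε * Real.log N) / ε) = -Real.log N := by field_simp
        rw [this, Real.exp_neg, Real.exp_log hNp]
      have h3 : 0 < E (x N) := Real.exp_pos _
      have h4 : 2 * T / N * (E (x (N / 2)) - E (x N)) ≤ 2 * T * Q := by
        rw [h2]
        calc _ ≤ 2 * T / N * (N : ℝ)⁻¹ := by gcongr; linarith
          _ = 2 * T * ((N : ℝ) ^ 2)⁻¹ := by field_simp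
          _ ≤ _ := by gcongr
      have := mul_le_mul_of_nonneg_left hmuls hc0
      linarith
  have hsplit : ∑ j ∈ Finset.range N, (x (j + 1) - x j) * cellErr abar ε (x j) (x (j + 1)) =
      ∑ j ∈ Finset.range N, (x (j + 1) - x j) ^ 3 +
      ∑ j ∈ Finset.range N, (x (j + 1) - x j) *
      min (layerDrop abar ε (x j) (x (j + 1)))
        ((x (j + 1) - x j) * layerDrop abar ε (x j) (x (j + 1)) / ε) := by
    rw [← Finset.sum_add_distrib]
    refine Finset.sum_congr rfl fun j _ => ?_
    rw [cellErr]
    ring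
  rw [hsplit]
  linarith

end mesh

/-! ### Quadrature on the mesh -/

theorem step_succ (x : ℕ → ℝ) (j : ℕ) : step x (j + 1) = x (j + 1) - x j := rfl

theorem sum_hbar_mul {N : ℕ} (hN : 1 ≤ N) (x g : ℕ → ℝ) :
    ∑ j ∈ Finset.range (N + 1), hbar N x j * g j =
      ∑ j ∈ Finset.range N, (x (j + 1) - x j) * (g j + g (j + 1)) / 2 := by
  have h1 : ∀ j, hbar N x j * g j = (if j = 0 then 0 else step x j / 2 * g j) +
      (if j = N then 0 else step x (j + 1) / 2 * g j) := by
    intro j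
    unfold hbar
    split_ifs with h0 hN' hN'
    · omega
    · subst h0; simp
    · subst hN'; simp
    · ring
  simp only [h1]
  rw [Finset.sum_add_distrib, Finset.sum_range_succ', Finset.sum_range_succ _ N]
  simp only [Nat.add_eq_zero_iff, one_ne_zero, and_false, if_false, if_true, add_zero]
  have h2 : ∑ j ∈ Finset.range N, (if j = N then 0 else step x (j + 1) / 2 * g j) =
      ∑ j ∈ Finset.range N, step x (j + 1) / 2 * g j :=
    Finset.sum_congr rfl fun j hj => if_neg (Finset.mem_range.1 hj).ne
  rw [h2, ← Finset.sum_add_distrib]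
  refine Finset.sum_congr rfl fun j _ => ?_
  rw [step_succ]
  ring

theorem hbar_nonneg {N : ℕ} {x : ℕ → ℝ} (hx : StrictMono x) (j : ℕ) :
    0 ≤ hbar N x j := by
  have h : ∀ i, 0 ≤ step x i := fun i => sub_nonneg.2 (hx.monotone (Nat.sub_le i 1))
  unfold hbar
  split_ifs
  · exact div_nonneg (h 1) two_pos.le
  · exact div_nonneg (h N) two_pos.le
  · exact div_nonneg (add_nonneg (h _) (h _)) two_pos.le

theorem sum_hbar {N : ℕ} (hN : 1 ≤ N) (x : ℕ → ℝ) :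
    ∑ j ∈ Finset.range (N + 1), hbar N x j = x N - x 0 := by
  have := sum_hbar_mul hN x (fun _ => 1)
  simp only [mul_one] at this
  rw [this, ← Finset.sum_range_sub]
  refine Finset.sum_congr rfl fun j _ => ?_
  ring

theorem sum_hbar_abs_le {N : ℕ} {x : ℕ → ℝ} (hx : StrictMono x) (hN : 1 ≤ N) {k : ℝ → ℝ} {B H : ℝ}
    (hB : 0 ≤ B) (hk : ∀ s t, |k s - k t| ≤ B * |s - t|) (hH : ∀ j, x (j + 1) - x j ≤ H) :
    ∑ j ∈ Finset.range (N + 1), hbar N x j * |k (x j)| ≤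
      (∫ s in (x 0)..(x N), |k s|) + B * (x N - x 0) * H := by
  have hkc : Continuous k := continuous_of_abs_sub_le hk
  rw [sum_hbar_mul hN x (fun j => |k (x j)|), ← intervalIntegral.sum_integral_adjacent_intervals
    (fun j _ => hkc.abs.intervalIntegrable _ _), mul_right_comm, ← Finset.sum_range_sub,
    Finset.mul_sum, ← Finset.sum_add_distrib]
  refine Finset.sum_le_sum fun j _ => ?_
  have hpos : 0 < x (j + 1) - x j := sub_pos.2 (hx (Nat.lt_succ_self j))
  have h1 : ∀ s ∈ Icc (x j) (x (j + 1)),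
      (|k (x j)| + |k (x (j + 1))|) / 2 - B * H ≤ |k s| := by
    intro s hs
    have key : ∀ t ∈ Icc (x j) (x (j + 1)), |k t| - B * H ≤ |k s| := by
      intro t ht
      have h2 := hk t s
      have h3 : |t - s| ≤ H := by
        have := hH j
        rw [abs_le]; constructor <;> linarith [hs.1, hs.2, ht.1, ht.2]
      have h4 := abs_sub_abs_le_abs_sub (k t) (k s)
      have := mul_le_mul_of_nonneg_left h3 hB
      linarith
    have ha := key (x j) (left_mem_Icc.2 (by linarith))
    have hb := key (x (j + 1)) (right_mem_Icc.2 (by linarith))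
    linarith
  have h2 : ∫ _ in (x j)..(x (j + 1)), ((|k (x j)| + |k (x (j + 1))|) / 2 - B * H) ≤
      ∫ s in (x j)..(x (j + 1)), |k s| :=
    intervalIntegral.integral_mono_on (by linarith) (continuous_const.intervalIntegrable _ _)
      (hkc.abs.intervalIntegrable _ _) h1
  rw [intervalIntegral.integral_const, smul_eq_mul] at h2
  linarith

theorem one_le_log {N : ℕ} (hN : 3 ≤ N) : 1 ≤ Real.log N := by
  have h3 : (3 : ℝ) ≤ N := by exact_mod_cast hN
  rw [Real.le_log_iff_exp_le (by linarith)]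
  linarith [Real.exp_one_lt_d9]

theorem sq_mesh_width_le {T : ℝ} {N : ℕ} (hN : 3 ≤ N) :
    (2 * T / N) ^ 2 ≤ 4 * T ^ 2 * (((N : ℝ) ^ 2)⁻¹ * Real.log N) := by
  have h1 := le_mul_of_one_le_right (by positivity : 0 ≤ ((N : ℝ) ^ 2)⁻¹) (one_le_log hN)
  calc (2 * T / N) ^ 2 = 4 * T ^ 2 * ((N : ℝ) ^ 2)⁻¹ := by rw [div_pow]; ring
    _ ≤ _ := by gcongr

/-- Composite trapezoidal rule for `∫ k v`. -/
theorem Decomposition.trapezoid {T abar C ε α B : ℝ} {a F v w l k k' : ℝ → ℝ}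
    (D : Decomposition T abar C ε α a F v w l) (hT : 0 < T) (ha : 0 < abar) (hε : 0 < ε)
    (hB : 0 ≤ B)
    (hk : TaylorBound T B k k') (hkb : ∀ s, |k s| ≤ B) (hkl : ∀ s t, |k s - k t| ≤ B * |s - t|)
    {N : ℕ} (hN : 3 ≤ N) (he : Even N) :
    |(∫ s in (0 : ℝ)..T, k s * v s) - ∑ j ∈ Finset.range (N + 1), hbar N (mesh T abar ε N) j *
        (k (mesh T abar ε N j) * v (mesh T abar ε N j))| ≤
      B * C * (6 + 6 / abar) * (4 * T ^ 3 + 2 * T / abar + 2 * T + 4 * T ^ 2) *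
        (((N : ℝ) ^ 2)⁻¹ * Real.log N) := by
  have hN2 : 2 ≤ N := by omega
  set x := mesh T abar ε N with hx
  have hmono := mesh_strictMono hT ha hε hN2 he
  have hstep := mesh_step_bounds hT ha hε hN2 he
  have hC := D.C_nonneg hT
  have hkc : Continuous k := continuous_of_abs_sub_le hkl
  have hvc : ContinuousOn v (Icc 0 T) := by
    have : ContinuousOn (fun ξ => α + ∫ s in (0 : ℝ)..ξ, (w s + l s)) (Icc 0 T) :=
      (continuous_const.add (continuous_iff_continuousAt.2 fun ξ =>
        (hasDerivAt_primitive D.flux_cont ξ).continuousAt)).continuousOn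
    exact this.congr fun s hs => D.v_eq s hs
  have hint : ∀ j < N, IntervalIntegrable (fun s => k s * v s) volume (x j) (x (j + 1)) := by
    intro j hj
    apply ContinuousOn.intervalIntegrable
    rw [uIcc_of_le (hmono.monotone (Nat.le_succ j))]
    exact hkc.continuousOn.mul (hvc.mono (Icc_subset_Icc (mesh_mem hT ha hε hN2 he hj.le).1
      (mesh_mem hT ha hε hN2 he hj).2))
  have h1 := intervalIntegral.sum_integral_adjacent_intervals hint
  rw [hx, mesh_zero, mesh_last hN2, ← hx] at h1
  rw [sum_hbar_mul (by omega) x (fun j => k (x j) * v (x j)), ← h1, ← Finset.sum_sub_distrib]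
  refine (Finset.abs_sum_le_sum_abs _ _).trans ?_
  refine (Finset.sum_le_sum fun j hj => D.trapezoid_cell ha hε hB hk hkb hkl
    (mesh_mem hT ha hε hN2 he (Finset.mem_range.1 hj).le).1 (hmono (Nat.lt_succ_self j))
    (mesh_mem hT ha hε hN2 he (Finset.mem_range.1 hj)).2).trans ?_
  rw [← Finset.mul_sum, Finset.sum_add_distrib]
  have h2 := sum_cellErr_mesh_le hT ha hε hN he
  have h3 : ∑ j ∈ Finset.range N, (x (j + 1) - x j) ^ 2 * layerDrop abar ε (x j) (x (j + 1)) ≤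
      (2 * T / N) ^ 2 := by
    have h4 : ∀ j ∈ Finset.range N, (x (j + 1) - x j) ^ 2 * layerDrop abar ε (x j) (x (j + 1)) ≤
        (2 * T / N) ^ 2 * layerDrop abar ε (x j) (x (j + 1)) := fun j _ =>
      mul_le_mul_of_nonneg_right (pow_le_pow_left₀ (hstep j).1.le (hstep j).2 2)
        (layerDrop_nonneg ha hε (hmono.monotone (Nat.le_succ j)))
    refine (Finset.sum_le_sum h4).trans ?_
    rw [← Finset.mul_sum]
    exact mul_le_of_le_one_right (sq_nonneg _) (sum_layerDrop_mesh_le hN2)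
  have h5 := sq_mesh_width_le (T := T) hN
  rw [mul_assoc (B * C * (6 + 6 / abar))]
  refine mul_le_mul_of_nonneg_left ?_ (by positivity)
  rw [add_mul]
  exact add_le_add h2 (h3.trans h5)

/-! ### The scheme in terms of increments -/

theorem fitted_flux_identity {ε h h' d d' A₁ A₂ : ℝ} (hε : ε ≠ 0) (hh : h ≠ 0) (hh' : h' ≠ 0) :
    ε * (d' / h' - d / h) * (1 - A₁ * h' / (2 * ε) + A₂ * h / (2 * ε)) + (A₁ + A₂) * (d + d') / 2 =
      (ε + (h + h') / 2 * A₂) * (d' / h') - (ε - (h + h') / 2 * A₁) * (d / h) := by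
  field_simp
  ring

section increments

variable {ε : ℝ} {a : ℝ → ℝ} {N : ℕ} {x : ℕ → ℝ}

theorem hbar_interior {j : ℕ} (hj : j + 1 < N) :
    hbar N x (j + 1) = ((x (j + 1) - x j) + (x (j + 2) - x (j + 1))) / 2 := by
  rw [hbar, if_neg (by omega), if_neg (by omega)]
  rfl

theorem hbar_interior_pos (hx : StrictMono x) {j : ℕ} (hj : j + 1 < N) :
    0 < hbar N x (j + 1) := by
  rw [hbar_interior hj]
  have := hx (Nat.lt_succ_self j)
  have := hx (Nat.lt_succ_self (j + 1))
  linarith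

theorem hbar_mul_chi1 (hε : 0 < ε) (ha : ∀ s, 0 < a s) (hx : StrictMono x) {j : ℕ}
    (hj : j + 1 < N) : hbar N x (j + 1) * chi1 ε a N x (j + 1) =
      ∫ s in (x j)..(x (j + 1)), leftHat ε (a (x (j + 1))) (x j) (x (j + 1)) s := by
  rw [chi1, mul_inv_cancel_left₀ (hbar_interior_pos hx hj).ne',
    integral_leftHat hε (ha _) (hx (Nat.lt_succ_self j)), step_succ]

theorem hbar_mul_chi2 (hε : 0 < ε) (ha : ∀ s, 0 < a s) (hx : StrictMono x) {j : ℕ}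
    (hj : j + 1 < N) : hbar N x (j + 1) * chi2 ε a N x (j + 1) =
      ∫ s in (x (j + 1))..(x (j + 2)), rightHat ε (a (x (j + 1))) (x (j + 1)) (x (j + 2)) s := by
  rw [chi2, mul_inv_cancel_left₀ (hbar_interior_pos hx hj).ne',
    integral_rightHat hε (ha _) (hx (Nat.lt_succ_self (j + 1))), step_succ]

theorem hbar_mul_gamma1 (hε : 0 < ε) (ha : ∀ s, 0 < a s) (hx : StrictMono x) {j : ℕ}
    (hj : j + 1 < N) : hbar N x (j + 1) * gamma1 ε a N x (j + 1) =
      ∫ s in (x j)..(x (j + 1)),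
        (s - x (j + 1)) * leftHat ε (a (x (j + 1))) (x j) (x (j + 1)) s := by
  rw [gamma1, mul_inv_cancel_left₀ (hbar_interior_pos hx hj).ne',
    integral_mul_leftHat hε (ha _) (hx (Nat.lt_succ_self j)), step_succ, Nat.add_sub_cancel]

theorem hbar_mul_gamma2 (hε : 0 < ε) (ha : ∀ s, 0 < a s) (hx : StrictMono x) {j : ℕ}
    (hj : j + 1 < N) : hbar N x (j + 1) * gamma2 ε a N x (j + 1) =
      ∫ s in (x (j + 1))..(x (j + 2)),
        (s - x (j + 1)) * rightHat ε (a (x (j + 1))) (x (j + 1)) (x (j + 2)) s := by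
  rw [gamma2, mul_inv_cancel_left₀ (hbar_interior_pos hx hj).ne',
    integral_mul_rightHat hε (ha _) (hx (Nat.lt_succ_self (j + 1))), step_succ]

theorem sub_mul_integral_leftHat {b p q : ℝ} (hε : 0 < ε) (hb : 0 < b) (hpq : p < q) :
    ε - b * (∫ s in p..q, leftHat ε b p q s) = (q - p) * expWeight ε b (q - p) := by
  rw [integral_leftHat hε hb hpq, expWeight]
  field_simp
  ring

theorem add_mul_integral_rightHat {b p q : ℝ} (hε : 0 < ε) (hb : 0 < b) (hpq : p < q) :
    ε + b * (∫ s in p..q, rightHat ε b p q s) = (q - p) * (b + expWeight ε b (q - p)) := by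
  rw [integral_rightHat hε hb hpq, add_expWeight hε hb (sub_pos.2 hpq)]
  field_simp
  ring

/-- The difference operator, multiplied by `ħ_i`, in terms of increments. -/
theorem hbar_mul_operator (hε : 0 < ε) (ha : ∀ s, 0 < a s) (hx : StrictMono x) {j : ℕ}
    (hj : j + 1 < N) (y : ℕ → ℝ) :
    hbar N x (j + 1) * (ε * theta ε a N x (j + 1) * secondDiff N x y (j + 1) +
        coeffA ε a N x (j + 1) * centralDiff N x y (j + 1)) =
      (y (j + 2) - y (j + 1)) *
          (a (x (j + 1)) + expWeight ε (a (x (j + 1))) (x (j + 2) - x (j + 1)))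
        - (y (j + 1) - y j) * expWeight ε (a (x (j + 1))) (x (j + 1) - x j)
        + fwdDiff x (fun k => a (x k)) (j + 1) *
          ((∫ s in (x j)..(x (j + 1)),
              (s - x (j + 1)) * leftHat ε (a (x (j + 1))) (x j) (x (j + 1)) s) *
              ((y (j + 1) - y j) / (x (j + 1) - x j)) +
            (∫ s in (x (j + 1))..(x (j + 2)),
              (s - x (j + 1)) * rightHat ε (a (x (j + 1))) (x (j + 1)) (x (j + 2)) s) *
              ((y (j + 2) - y (j + 1)) / (x (j + 2) - x (j + 1)))) := by
  have hp1 : x j < x (j + 1) := hx (Nat.lt_succ_self j)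
  have hp2 : x (j + 1) < x (j + 2) := hx (Nat.lt_succ_self (j + 1))
  have hh : x (j + 1) - x j ≠ 0 := (sub_pos.2 hp1).ne'
  have hh' : x (j + 2) - x (j + 1) ≠ 0 := (sub_pos.2 hp2).ne'
  have hb := hbar_interior_pos hx hj
  have e1 := sub_mul_integral_leftHat hε (ha (x (j + 1))) hp1
  have e2 := add_mul_integral_rightHat hε (ha (x (j + 1))) hp2
  rw [← hbar_mul_chi1 hε ha hx hj] at e1
  rw [← hbar_mul_chi2 hε ha hx hj] at e2
  rw [← hbar_mul_gamma1 hε ha hx hj, ← hbar_mul_gamma2 hε ha hx hj]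
  have key := fitted_flux_identity (d := y (j + 1) - y j) (d' := y (j + 2) - y (j + 1))
    (A₁ := aHat1 ε a N x (j + 1)) (A₂ := aHat2 ε a N x (j + 1)) hε.ne' hh hh'
  rw [← hbar_interior (x := x) hj] at key
  have l1 : hbar N x (j + 1) * (ε * theta ε a N x (j + 1) * secondDiff N x y (j + 1) +
        coeffA ε a N x (j + 1) * centralDiff N x y (j + 1)) =
      ε * ((y (j + 2) - y (j + 1)) / (x (j + 2) - x (j + 1)) -
        (y (j + 1) - y j) / (x (j + 1) - x j)) *
        (1 - aHat1 ε a N x (j + 1) * (x (j + 2) - x (j + 1)) / (2 * ε) +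
          aHat2 ε a N x (j + 1) * (x (j + 1) - x j) / (2 * ε)) +
        (aHat1 ε a N x (j + 1) + aHat2 ε a N x (j + 1)) *
          ((y (j + 1) - y j) + (y (j + 2) - y (j + 1))) / 2 := by
    rw [secondDiff, centralDiff, theta, coeffA, fwdDiff, bwdDiff, step_succ, step_succ,
      Nat.add_sub_cancel]
    field_simp
    ring
  rw [l1, key]
  have e1' : ε - hbar N x (j + 1) * aHat1 ε a N x (j + 1) =
      (x (j + 1) - x j) * expWeight ε (a (x (j + 1))) (x (j + 1) - x j) -
        fwdDiff x (fun k => a (x k)) (j + 1) * (hbar N x (j + 1) * gamma1 ε a N x (j + 1)) := by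
    rw [← e1, aHat1]; ring
  have e2' : ε + hbar N x (j + 1) * aHat2 ε a N x (j + 1) =
      (x (j + 2) - x (j + 1)) *
          (a (x (j + 1)) + expWeight ε (a (x (j + 1))) (x (j + 2) - x (j + 1))) +
        fwdDiff x (fun k => a (x k)) (j + 1) * (hbar N x (j + 1) * gamma2 ε a N x (j + 1)) := by
    rw [← e2, aHat2]; ring
  rw [e1', e2']
  generalize expWeight ε (a (x (j + 1))) (x (j + 1) - x j) = g1
  generalize expWeight ε (a (x (j + 1))) (x (j + 2) - x (j + 1)) = g2
  field_simp
  ring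

end increments

theorem TaylorBound.hasDerivAt {T B : ℝ} {g g' : ℝ → ℝ} (h : TaylorBound T B g g') {x : ℝ}
    (hx : x ∈ Ioo 0 T) : HasDerivAt g (g' x) x := by
  rw [hasDerivAt_iff_isLittleO]
  refine Asymptotics.IsBigO.trans_isLittleO (g := fun y => (y - x) ^ 2) ?_ ?_
  · refine Asymptotics.IsBigO.of_bound B ?_
    filter_upwards [isOpen_Ioo.mem_nhds hx] with y hy
    have := h x (Ioo_subset_Icc_self hx) y (Ioo_subset_Icc_self hy)
    rw [Real.norm_eq_abs, Real.norm_eq_abs, abs_of_nonneg (sq_nonneg (y - x)), smul_eq_mul,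
      mul_comm (y - x)]
    exact this
  · have h1 : (fun y : ℝ => (y - x) ^ 2) = fun y => (y - x) * (y - x) := by
      funext y; ring
    rw [h1]
    have h2 : (fun y : ℝ => y - x) =o[nhds x] (fun _ => (1 : ℝ)) := by
      rw [Asymptotics.isLittleO_one_iff]
      have : Filter.Tendsto (fun y : ℝ => y - x) (nhds x) (nhds (x - x)) :=
        (continuous_id.sub continuous_const).tendsto x
      rwa [sub_self] at this
    simpa using h2.mul_isBigO (Asymptotics.isBigO_refl (fun y : ℝ => y - x) (nhds x))

theorem taylor_secant {T B : ℝ} {g g' : ℝ → ℝ} (h : TaylorBound T B g g') (hB : 0 ≤ B)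
    {p q s H : ℝ} (hp : p ∈ Icc 0 T) (hq : q ∈ Icc 0 T) (hs : s ∈ Icc 0 T) (hpq : p < q)
    (hqH : q - p ≤ H) (hsH : |s - p| ≤ H) :
    |g s - g p - (g q - g p) / (q - p) * (s - p)| ≤ 2 * B * H ^ 2 := by
  have hpos : 0 < q - p := sub_pos.2 hpq
  have h1 := h p hp s hs
  have h2 := h p hp q hq
  have h3 : g s - g p - (g q - g p) / (q - p) * (s - p) = (g s - g p - g' p * (s - p)) -
      (g q - g p - g' p * (q - p)) / (q - p) * (s - p) := by
    field_simp; ring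
  rw [h3]
  refine (abs_sub _ _).trans ?_
  rw [abs_mul, abs_div, abs_of_pos hpos]
  have h4 : |g q - g p - g' p * (q - p)| / (q - p) ≤ B * H := by
    rw [div_le_iff₀ hpos]
    refine h2.trans ?_
    calc B * (q - p) ^ 2 = B * (q - p) * (q - p) := by ring
      _ ≤ B * H * (q - p) := by gcongr
  have hH : 0 ≤ H := (abs_nonneg _).trans hsH
  have h5 : (s - p) ^ 2 ≤ H ^ 2 := sq_le_sq' (abs_le.1 hsH).1 (abs_le.1 hsH).2
  have h6 := mul_le_mul_of_nonneg_left h5 hB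
  have h7 := mul_le_mul h4 hsH (abs_nonneg _) (by positivity)
  calc _ ≤ B * H ^ 2 + B * H * H := by linarith
    _ = _ := by ring

section moments

variable {ε b p q : ℝ}

theorem integral_leftHat_bounds (hε : 0 < ε) (hb : 0 < b) (hpq : p < q) :
    0 ≤ (∫ s in p..q, leftHat ε b p q s) ∧ (∫ s in p..q, leftHat ε b p q s) ≤ q - p := by
  refine ⟨intervalIntegral.integral_nonneg hpq.le fun s hs => (leftHat_mem hε hb hpq hs).1, ?_⟩
  have : ∫ s in p..q, leftHat ε b p q s ≤ ∫ _ in p..q, (1 : ℝ) :=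
    intervalIntegral.integral_mono_on hpq.le (continuous_leftHat.intervalIntegrable _ _)
      (continuous_const.intervalIntegrable _ _) fun s hs => (leftHat_mem hε hb hpq hs).2
  simpa using this

theorem integral_rightHat_bounds (hε : 0 < ε) (hb : 0 < b) (hpq : p < q) :
    0 ≤ (∫ s in p..q, rightHat ε b p q s) ∧ (∫ s in p..q, rightHat ε b p q s) ≤ q - p := by
  refine ⟨intervalIntegral.integral_nonneg hpq.le fun s hs => (rightHat_mem hε hb hpq hs).1, ?_⟩
  have : ∫ s in p..q, rightHat ε b p q s ≤ ∫ _ in p..q, (1 : ℝ) :=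
    intervalIntegral.integral_mono_on hpq.le (continuous_rightHat.intervalIntegrable _ _)
      (continuous_const.intervalIntegrable _ _) fun s hs => (rightHat_mem hε hb hpq hs).2
  simpa using this

theorem abs_integral_moment_le {ψ : ℝ → ℝ} (hψc : Continuous ψ) (hpq : p < q)
    (hψ : ∀ s ∈ Icc p q, 0 ≤ ψ s) {r : ℝ} (hr : r ∈ Icc p q) :
    |∫ s in p..q, (s - r) * ψ s| ≤ (q - p) * ∫ s in p..q, ψ s := by
  rw [← intervalIntegral.integral_const_mul, ← Real.norm_eq_abs]
  apply intervalIntegral.norm_integral_le_of_norm_le hpq.le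
  · refine Filter.Eventually.of_forall fun s hs => ?_
    rw [Real.norm_eq_abs, abs_mul, abs_of_nonneg (hψ s ⟨hs.1.le, hs.2⟩)]
    refine mul_le_mul_of_nonneg_right ?_ (hψ s ⟨hs.1.le, hs.2⟩)
    rw [abs_le]; constructor <;> linarith [hs.1, hs.2, hr.1, hr.2]
  · exact (hψc.const_mul _).intervalIntegrable _ _

end moments

/-- Consistency weight of a cell. -/
noncomputable def cellConsistency (abar ε C B δ δa x y : ℝ) : ℝ :=
  (y - x) * δ + δa * (C * ((y - x) + layerDrop abar ε x y / abar)) +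
    B * (y - x) * (C * (1 + 2 / abar) * cellErr abar ε x y)

theorem sum_cellConsistency_le {T abar ε C B δ₀ δ₁ : ℝ} {N : ℕ} (hT : 0 < T) (ha : 0 < abar)
    (hε : 0 < ε) (hC : 0 ≤ C) (hB : 0 ≤ B) (hδ₁ : 0 ≤ δ₁) (hN : 3 ≤ N) (he : Even N) :
    ∑ j ∈ Finset.range N, cellConsistency abar ε C B (δ₀ * (((N : ℝ) ^ 2)⁻¹ * Real.log N))
        (δ₁ * (((N : ℝ) ^ 2)⁻¹ * Real.log N)) (mesh T abar ε N j) (mesh T abar ε N (j + 1)) ≤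
      (T * δ₀ + δ₁ * (C * (T + 1 / abar)) +
        B * (C * (1 + 2 / abar)) * (4 * T ^ 3 + 2 * T / abar + 2 * T)) *
        (((N : ℝ) ^ 2)⁻¹ * Real.log N) := by
  have hN2 : 2 ≤ N := by omega
  have h1 := sum_cellErr_mesh_le hT ha hε hN he
  have h2 := sum_layerDrop_mesh_le (T := T) (abar := abar) (ε := ε) hN2
  have hlog := one_le_log hN
  set Q := ((N : ℝ) ^ 2)⁻¹ * Real.log N
  have hQ : 0 ≤ Q := by positivity
  set x := mesh T abar ε N with hx
  have h3 : ∑ j ∈ Finset.range N, (x (j + 1) - x j) = T := by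
    rw [Finset.sum_range_sub, hx, mesh_zero, mesh_last hN2, sub_zero]
  have h4 : ∀ j, cellConsistency abar ε C B (δ₀ * Q) (δ₁ * Q) (x j) (x (j + 1)) =
      (δ₀ * Q + δ₁ * Q * C) * (x (j + 1) - x j) +
      δ₁ * Q * C / abar * layerDrop abar ε (x j) (x (j + 1)) +
      B * (C * (1 + 2 / abar)) * ((x (j + 1) - x j) * cellErr abar ε (x j) (x (j + 1))) := by
    intro j
    rw [cellConsistency]
    ring
  simp only [h4]
  rw [Finset.sum_add_distrib, Finset.sum_add_distrib, ← Finset.mul_sum, ← Finset.mul_sum,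
    ← Finset.mul_sum, h3]
  have h5 := mul_le_mul_of_nonneg_left h2 (by positivity : 0 ≤ δ₁ * Q * C / abar)
  have h6 := mul_le_mul_of_nonneg_left h1 (by positivity : 0 ≤ B * (C * (1 + 2 / abar)))
  calc _ ≤ (δ₀ * Q + δ₁ * Q * C) * T + δ₁ * Q * C / abar * 1 +
      B * (C * (1 + 2 / abar)) * ((4 * T ^ 3 + 2 * T / abar + 2 * T) * Q) := by linarith
    _ = _ := by ring

section main

variable {T abar B kb lam α β C ε : ℝ} {a f v w l : ℝ → ℝ} {K K' : ℝ → ℝ → ℝ} {N : ℕ}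

/-- Local linear approximation of the right-hand side near a mesh point. -/
theorem rhs_linear_approx (h : SmoothData T abar B kb a f K K')
    (D : Decomposition T abar C ε α a
      (fun ξ => f ξ + lam * ∫ η in (0 : ℝ)..T, K ξ η * v η) v w l)
    (hε : 0 < ε) (hN : 3 ≤ N) (he : Even N) {j : ℕ} (hj : j + 1 < N) {s : ℝ} (hs : s ∈ Icc 0 T)
    (hsH : |s - mesh T abar ε N (j + 1)| ≤ 2 * T / N) :
    |(f s + lam * ∫ η in (0 : ℝ)..T, K s η * v η) -
      (f (mesh T abar ε N (j + 1)) + lam * ∑ k ∈ Finset.range (N + 1), hbar N (mesh T abar ε N) k *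
        (K (mesh T abar ε N (j + 1)) (mesh T abar ε N k) * v (mesh T abar ε N k))) -
      (fwdDiff (mesh T abar ε N) (fun k => f (mesh T abar ε N k)) (j + 1) +
        lam * ∑ k ∈ Finset.range (N + 1), hbar N (mesh T abar ε N) k *
        (K' (mesh T abar ε N (j + 1)) (mesh T abar ε N k) * v (mesh T abar ε N k))) *
        (s - mesh T abar ε N (j + 1))| ≤
      (8 * B * T ^ 2 + |lam| * (B * C * (6 + 6 / abar) *
        (4 * T ^ 3 + 2 * T / abar + 2 * T + 4 * T ^ 2) + 4 * T ^ 3 * B * C)) *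
        (((N : ℝ) ^ 2)⁻¹ * Real.log N) := by
  have hT := h.T_pos
  have hab := h.abar_pos
  have hB := h.B_pos
  have hC := D.C_nonneg hT
  have hN2 : 2 ≤ N := by omega
  have hsq := sq_mesh_width_le (T := T) hN
  have hmono := mesh_strictMono hT hab hε hN2 he
  have hstep := mesh_step_bounds hT hab hε hN2 he
  have hmem : ∀ {k}, k ≤ N → mesh T abar ε N k ∈ Icc 0 T := fun hk => mesh_mem hT hab hε hN2 he hk
  obtain ⟨k', hk'⟩ := h.K_taylor_right s hs
  have htrap := D.trapezoid hT hab hε hB.le hk' (h.K_le s) (h.K_lip_right s) hN he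
  have hsum : ∑ k ∈ Finset.range (N + 1), hbar N (mesh T abar ε N) k = T := by
    rw [sum_hbar (by omega), mesh_zero, mesh_last hN2, sub_zero]
  set H := 2 * T / N with hH
  set x := mesh T abar ε N with hx
  set Q := ((N : ℝ) ^ 2)⁻¹ * Real.log N
  obtain ⟨f', hf'⟩ := h.f_taylor
  have hfs := taylor_secant hf' hB.le (hmem hj.le) (hmem hj) hs (hmono (Nat.lt_succ_self (j + 1)))
    (hstep (j + 1)).2 hsH
  have hfw : fwdDiff x (fun k => f (x k)) (j + 1) =
    (f (x (j + 1 + 1)) - f (x (j + 1))) / (x (j + 1 + 1) - x (j + 1)) := rfl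
  have hker : |(∑ k ∈ Finset.range (N + 1), hbar N x k * (K s (x k) * v (x k))) -
      (∑ k ∈ Finset.range (N + 1), hbar N x k * (K (x (j + 1)) (x k) * v (x k))) -
      (∑ k ∈ Finset.range (N + 1), hbar N x k * (K' (x (j + 1)) (x k) * v (x k))) *
        (s - x (j + 1))| ≤ T * (B * H ^ 2 * C) := by
    rw [Finset.sum_mul, ← Finset.sum_sub_distrib, ← Finset.sum_sub_distrib]
    refine (Finset.abs_sum_le_sum_abs _ _).trans ?_
    rw [← hsum, Finset.sum_mul]
    refine Finset.sum_le_sum fun k hk => ?_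
    have hkm := hmem (Nat.lt_succ_iff.1 (Finset.mem_range.1 hk))
    have h1 := h.K_taylor_left (x k) hkm (x (j + 1)) (hmem hj.le) s hs
    have h2 : hbar N x k * (K s (x k) * v (x k)) - hbar N x k * (K (x (j + 1)) (x k) * v (x k)) -
        hbar N x k * (K' (x (j + 1)) (x k) * v (x k)) * (s - x (j + 1)) = hbar N x k *
        ((K s (x k) - K (x (j + 1)) (x k) - K' (x (j + 1)) (x k) * (s - x (j + 1))) * v (x k)) := by
      ring
    rw [h2, abs_mul, abs_of_nonneg (hbar_nonneg hmono k), abs_mul]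
    refine mul_le_mul_of_nonneg_left ?_ (hbar_nonneg hmono k)
    have h3 : (s - x (j + 1)) ^ 2 ≤ H ^ 2 := sq_le_sq' (abs_le.1 hsH).1 (abs_le.1 hsH).2
    exact mul_le_mul (h1.trans (mul_le_mul_of_nonneg_left h3 hB.le)) (D.v_le _ hkm) (abs_nonneg _)
      (by positivity)
  rw [hfw]
  set S0 := ∑ k ∈ Finset.range (N + 1), hbar N x k * (K s (x k) * v (x k))
  set S1 := ∑ k ∈ Finset.range (N + 1), hbar N x k * (K (x (j + 1)) (x k) * v (x k))
  set S2 := ∑ k ∈ Finset.range (N + 1), hbar N x k * (K' (x (j + 1)) (x k) * v (x k))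
  set I := ∫ η in (0 : ℝ)..T, K s η * v η
  set fx := (f (x (j + 1 + 1)) - f (x (j + 1))) / (x (j + 1 + 1) - x (j + 1))
  have hsplit : (f s + lam * I) - (f (x (j + 1)) + lam * S1) - (fx + lam * S2) * (s - x (j + 1)) =
      (f s - f (x (j + 1)) - fx * (s - x (j + 1))) +
      lam * ((I - S0) + (S0 - S1 - S2 * (s - x (j + 1)))) := by ring
  rw [hsplit]
  refine (abs_add_le _ _).trans ?_
  rw [abs_mul]
  have h4 := (abs_add_le (I - S0) (S0 - S1 - S2 * (s - x (j + 1)))).trans (add_le_add htrap hker)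
  have h5 := mul_le_mul_of_nonneg_left h4 (abs_nonneg lam)
  have h6 : 2 * B * H ^ 2 ≤ 2 * B * (4 * T ^ 2 * Q) := by gcongr
  have h7 : |lam| * (T * (B * H ^ 2 * C)) ≤ |lam| * (T * (B * (4 * T ^ 2 * Q) * C)) := by gcongr
  calc _ ≤ 2 * B * (4 * T ^ 2 * Q) + (|lam| * (B * C * (6 + 6 / abar) *
        (4 * T ^ 3 + 2 * T / abar + 2 * T + 4 * T ^ 2) * Q) +
        |lam| * (T * (B * (4 * T ^ 2 * Q) * C))) := by linarith
    _ = _ := by ring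

/-- Consistency of the scheme at an interior mesh point. -/
theorem consistency (h : SmoothData T abar B kb a f K K')
    (D : Decomposition T abar C ε α a
      (fun ξ => f ξ + lam * ∫ η in (0 : ℝ)..T, K ξ η * v η) v w l)
    (hFc : Continuous (fun ξ => f ξ + lam * ∫ η in (0 : ℝ)..T, K ξ η * v η))
    (hε : 0 < ε) (hN : 3 ≤ N) (he : Even N) {δ δa : ℝ} (x : ℕ → ℝ) (hx : x = mesh T abar ε N)
    (hδ : δ = (8 * B * T ^ 2 + |lam| * (B * C * (6 + 6 / abar) *
        (4 * T ^ 3 + 2 * T / abar + 2 * T + 4 * T ^ 2) + 4 * T ^ 3 * B * C)) *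
        (((N : ℝ) ^ 2)⁻¹ * Real.log N))
    (hδa : δa = 8 * B * T ^ 2 * (((N : ℝ) ^ 2)⁻¹ * Real.log N))
    {j : ℕ} (hj : j + 1 < N) :
    |hbar N x (j + 1) * (ε * theta ε a N x (j + 1) * secondDiff N x (fun k => v (x k)) (j + 1) +
        coeffA ε a N x (j + 1) * centralDiff N x (fun k => v (x k)) (j + 1)) -
      ((f (x (j + 1)) + lam * ∑ k ∈ Finset.range (N + 1), hbar N x k *
        (K (x (j + 1)) (x k) * v (x k))) *
        ((∫ s in (x j)..(x (j + 1)), leftHat ε (a (x (j + 1))) (x j) (x (j + 1)) s) +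
        ∫ s in (x (j + 1))..(x (j + 2)), rightHat ε (a (x (j + 1))) (x (j + 1)) (x (j + 2)) s) +
      (fwdDiff x (fun k => f (x k)) (j + 1) + lam * ∑ k ∈ Finset.range (N + 1), hbar N x k *
        (K' (x (j + 1)) (x k) * v (x k))) *
        ((∫ s in (x j)..(x (j + 1)),
          (s - x (j + 1)) * leftHat ε (a (x (j + 1))) (x j) (x (j + 1)) s) +
        ∫ s in (x (j + 1))..(x (j + 2)),
          (s - x (j + 1)) * rightHat ε (a (x (j + 1))) (x (j + 1)) (x (j + 2)) s))| ≤
      cellConsistency abar ε C B δ δa (x j) (x (j + 1)) +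
        cellConsistency abar ε C B δ δa (x (j + 1)) (x (j + 2)) := by
  have hT := h.T_pos
  have hab := h.abar_pos
  have hB := h.B_pos
  have hC := D.C_nonneg hT
  have hN2 : 2 ≤ N := by omega
  have hlog := one_le_log hN
  have hmono : StrictMono x := hx ▸ mesh_strictMono hT hab hε hN2 he
  have hstep : ∀ j, 0 < x (j + 1) - x j ∧ x (j + 1) - x j ≤ 2 * T / N :=
    hx ▸ mesh_step_bounds hT hab hε hN2 he
  have hmem : ∀ {k}, k ≤ N → x k ∈ Icc 0 T := fun hk => hx ▸ mesh_mem hT hab hε hN2 he hk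
  have hp1 : x j < x (j + 1) := hmono (Nat.lt_succ_self j)
  have hp2 : x (j + 1) < x (j + 2) := hmono (Nat.lt_succ_self (j + 1))
  have hm0 := hmem (by omega : j ≤ N)
  have hm1 := hmem (by omega : j + 1 ≤ N)
  have hm2 := hmem (by omega : j + 2 ≤ N)
  have hb := h.a_pos (x (j + 1))
  have hδ' : ∀ s ∈ Icc 0 T, |s - x (j + 1)| ≤ 2 * T / N → _ := fun s hs hsH => by
    have := rhs_linear_approx h D hε hN he hj hs (hx ▸ hsH)
    rw [← hδ, ← hx] at this
    exact this
  obtain ⟨a', ha'⟩ := h.a_taylor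
  have hδa' : ∀ s ∈ Icc 0 T, |s - x (j + 1)| ≤ 2 * T / N →
      |a s - a (x (j + 1)) - fwdDiff x (fun k => a (x k)) (j + 1) * (s - x (j + 1))| ≤ δa := by
    intro s hs hsH
    have h1 := taylor_secant ha' hB.le hm1 hm2 hs hp2 (hstep (j + 1)).2 hsH
    refine h1.trans ?_
    have := sq_mesh_width_le (T := T) hN
    rw [hδa]
    calc _ ≤ 2 * B * (4 * T ^ 2 * (((N : ℝ) ^ 2)⁻¹ * Real.log N)) := by gcongr
      _ = _ := by ring
  have hδa0 : 0 ≤ δa := by rw [hδa]; positivity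
  have ha1 : |fwdDiff x (fun k => a (x k)) (j + 1)| ≤ B := by
    rw [fwdDiff, step_succ, abs_div, div_le_iff₀ (abs_pos.2 (sub_pos.2 hp2).ne')]
    exact h.a_lip _ _
  have hsub1 : ∀ s ∈ Icc (x j) (x (j + 1)), s ∈ Icc 0 T ∧ |s - x (j + 1)| ≤ 2 * T / N := by
    intro s hs
    refine ⟨⟨hm0.1.trans hs.1, hs.2.trans hm1.2⟩, ?_⟩
    have := (hstep j).2
    rw [abs_le]; constructor <;> linarith [hs.1, hs.2]
  have hsub2 : ∀ s ∈ Icc (x (j + 1)) (x (j + 2)), s ∈ Icc 0 T ∧ |s - x (j + 1)| ≤ 2 * T / N := by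
    intro s hs
    refine ⟨⟨hm1.1.trans hs.1, hs.2.trans hm2.2⟩, ?_⟩
    have : x (j + 2) - x (j + 1) ≤ 2 * T / N := (hstep (j + 1)).2
    rw [abs_le]; constructor <;> linarith [hs.1, hs.2]
  have hid1 := D.hat_identity hε h.a_cont hFc (hasDerivAt_leftHat hε hb hp1) hm0 hm1
  have hid2 := D.hat_identity hε h.a_cont hFc (hasDerivAt_rightHat hε hb hp2) hm1 hm2
  rw [leftHat_left, leftHat_right hε hb hp1] at hid1
  rw [rightHat_right, rightHat_left hε hb hp2] at hid2
  have hc1 := D.hat_consistency h.a_cont hFc continuous_leftHat hp1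
    (fun s hs => leftHat_mem hε hb hp1 hs) (right_mem_Icc.2 hp1.le)
    (fun s hs => hδ' s (hsub1 s hs).1 (hsub1 s hs).2)
    (fun s hs => hδa' s (hsub1 s hs).1 (hsub1 s hs).2)
  have hc2 := D.hat_consistency h.a_cont hFc continuous_rightHat hp2
    (fun s hs => rightHat_mem hε hb hp2 hs) (left_mem_Icc.2 hp2.le)
    (fun s hs => hδ' s (hsub2 s hs).1 (hsub2 s hs).2)
    (fun s hs => hδa' s (hsub2 s hs).1 (hsub2 s hs).2)
  rw [← hid1] at hc1
  rw [← hid2] at hc2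
  have hcell : ∀ {p q : ℝ}, p ∈ Icc 0 T → q ∈ Icc 0 T → p < q →
      (q - p) * δ + δa * (∫ s in p..q, |w s + l s|) +
        |fwdDiff x (fun k => a (x k)) (j + 1)| * (q - p) *
          (∫ s in p..q, |w s + l s - (v q - v p) / (q - p)|) ≤
      cellConsistency abar ε C B δ δa p q := by
    intro p q hp hq hpq
    have h1 := D.integral_abs_flux_le hab hε hp.1 hpq.le hq.2
    have h2 := D.integral_abs_flux_sub_mean_le hab hε hp.1 hpq hq.2
    have h3 : 0 ≤ q - p := sub_nonneg.2 hpq.le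
    rw [cellConsistency]
    have h4 : 0 ≤ ∫ s in p..q, |w s + l s - (v q - v p) / (q - p)| :=
      intervalIntegral.integral_nonneg hpq.le fun _ _ => abs_nonneg _
    gcongr
  have hd1 := hc1.trans (hcell hm0 hm1 hp1)
  have hd2 := hc2.trans (hcell hm1 hm2 hp2)
  rw [hbar_mul_operator hε h.a_pos hmono hj]
  refine le_trans (le_of_eq ?_) ((abs_add_le _ _).trans (add_le_add hd1 hd2))
  congr 1
  ring

end main

section main

variable {T abar B kb lam α β C ε : ℝ} {a f v w l : ℝ → ℝ} {K K' : ℝ → ℝ → ℝ} {N : ℕ}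

/-- The right-hand side of the scheme, multiplied by `ħ_i`. -/
theorem hbar_mul_rhs (h : SmoothData T abar B kb a f K K') (hε : 0 < ε) {x : ℕ → ℝ}
    (hx : StrictMono x) (hmem : ∀ {k}, k ≤ N → x k ∈ Icc 0 T) {j : ℕ} (hj : j + 1 < N)
    (hxj : x (j + 1) ∈ Ioo 0 T) (y : ℕ → ℝ) :
    hbar N x (j + 1) * (fHat ε a f N x (j + 1) + lam * ∑ k ∈ Finset.range (N + 1),
        hbar N x k * discreteKernel ε a K N x (j + 1) k * y k) =
      (f (x (j + 1)) + lam * ∑ k ∈ Finset.range (N + 1), hbar N x k *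
        (K (x (j + 1)) (x k) * y k)) *
        ((∫ s in (x j)..(x (j + 1)), leftHat ε (a (x (j + 1))) (x j) (x (j + 1)) s) +
        ∫ s in (x (j + 1))..(x (j + 2)), rightHat ε (a (x (j + 1))) (x (j + 1)) (x (j + 2)) s) +
      (fwdDiff x (fun k => f (x k)) (j + 1) + lam * ∑ k ∈ Finset.range (N + 1), hbar N x k *
        (K' (x (j + 1)) (x k) * y k)) *
        ((∫ s in (x j)..(x (j + 1)),
          (s - x (j + 1)) * leftHat ε (a (x (j + 1))) (x j) (x (j + 1)) s) +
        ∫ s in (x (j + 1))..(x (j + 2)),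
          (s - x (j + 1)) * rightHat ε (a (x (j + 1))) (x (j + 1)) (x (j + 2)) s) := by
  rw [← hbar_mul_chi1 hε h.a_pos hx hj, ← hbar_mul_chi2 hε h.a_pos hx hj,
    ← hbar_mul_gamma1 hε h.a_pos hx hj, ← hbar_mul_gamma2 hε h.a_pos hx hj]
  have h1 : ∑ k ∈ Finset.range (N + 1), hbar N x k * discreteKernel ε a K N x (j + 1) k * y k =
      (chi1 ε a N x (j + 1) + chi2 ε a N x (j + 1)) *
        (∑ k ∈ Finset.range (N + 1), hbar N x k * (K (x (j + 1)) (x k) * y k)) +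
      (gamma1 ε a N x (j + 1) + gamma2 ε a N x (j + 1)) *
        ∑ k ∈ Finset.range (N + 1), hbar N x k * (K' (x (j + 1)) (x k) * y k) := by
    rw [Finset.mul_sum, Finset.mul_sum, ← Finset.sum_add_distrib]
    refine Finset.sum_congr rfl fun k hk => ?_
    rw [discreteKernel, ((h.K_taylor_left (x k)
      (hmem (Nat.lt_succ_iff.1 (Finset.mem_range.1 hk)))).hasDerivAt hxj).deriv]
    ring
  rw [h1, fHat]
  ring

/-- The error increments satisfy a perturbed two-point recurrence. -/
theorem error_recurrence (h : SmoothData T abar B kb a f K K')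
    (D : Decomposition T abar C ε α a
      (fun ξ => f ξ + lam * ∫ η in (0 : ℝ)..T, K ξ η * v η) v w l)
    (hFc : Continuous (fun ξ => f ξ + lam * ∫ η in (0 : ℝ)..T, K ξ η * v η))
    (hε : 0 < ε) (hN : 3 ≤ N) (he : Even N) {δ δa M H : ℝ} (x : ℕ → ℝ) (hx : x = mesh T abar ε N)
    (hH : H = 2 * T / N)
    (hδ : δ = (8 * B * T ^ 2 + |lam| * (B * C * (6 + 6 / abar) *
        (4 * T ^ 3 + 2 * T / abar + 2 * T + 4 * T ^ 2) + 4 * T ^ 3 * B * C)) *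
        (((N : ℝ) ^ 2)⁻¹ * Real.log N))
    (hδa : δa = 8 * B * T ^ 2 * (((N : ℝ) ^ 2)⁻¹ * Real.log N)) {y z : ℕ → ℝ}
    (hy : IsDiscreteSolution ε lam α β a f K N x y) (hz : ∀ k, z k = v (x k) - y k)
    (hM : ∀ k ≤ N, |z k| ≤ M) {j : ℕ} (hj : j + 1 < N) :
    |(z (j + 2) - z (j + 1)) *
          (a (x (j + 1)) + expWeight ε (a (x (j + 1))) (x (j + 2) - x (j + 1)))
        - (z (j + 1) - z j) * expWeight ε (a (x (j + 1))) (x (j + 1) - x j)| ≤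
      |lam| * ((kb + 2 * B * T * H) * M) *
        ((∫ s in (x j)..(x (j + 1)), leftHat ε (a (x (j + 1))) (x j) (x (j + 1)) s) +
        ∫ s in (x (j + 1))..(x (j + 2)), rightHat ε (a (x (j + 1))) (x (j + 1)) (x (j + 2)) s) +
      (B * H * (|z (j + 1) - z j| + |z (j + 2) - z (j + 1)|) +
        (cellConsistency abar ε C B δ δa (x j) (x (j + 1)) +
        cellConsistency abar ε C B δ δa (x (j + 1)) (x (j + 2)))) := by
  have hT := h.T_pos
  have hab := h.abar_pos
  have hB := h.B_pos
  have hN2 : 2 ≤ N := by omega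
  have hmono : StrictMono x := hx ▸ mesh_strictMono hT hab hε hN2 he
  have hstep : ∀ j, 0 < x (j + 1) - x j ∧ x (j + 1) - x j ≤ H :=
    hH ▸ hx ▸ mesh_step_bounds hT hab hε hN2 he
  have hmem : ∀ {k}, k ≤ N → x k ∈ Icc 0 T := fun hk => hx ▸ mesh_mem hT hab hε hN2 he hk
  have hp1 : x j < x (j + 1) := hmono (Nat.lt_succ_self j)
  have hp2 : x (j + 1) < x (j + 2) := hmono (Nat.lt_succ_self (j + 1))
  have hxj : x (j + 1) ∈ Ioo 0 T :=
    ⟨(hmem (by omega : j ≤ N)).1.trans_lt hp1, hp2.trans_le (hmem (by omega : j + 2 ≤ N)).2⟩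
  have hb := h.a_pos (x (j + 1))
  have hM0 : 0 ≤ M := (abs_nonneg _).trans (hM 0 (Nat.zero_le _))
  have hH0 : 0 ≤ H := (hstep 0).1.le.trans (hstep 0).2
  have hcons := consistency h D hFc hε hN he x hx hδ hδa hj
  have hyeq := congrArg (fun t => hbar N x (j + 1) * t)
    (hy.equation (j + 1) (by omega) (by omega))
  rw [hbar_mul_rhs h hε hmono hmem hj hxj y, hbar_mul_operator hε h.a_pos hmono hj] at hyeq
  rw [hbar_mul_operator hε h.a_pos hmono hj] at hcons
  have hΨ1 := integral_leftHat_bounds hε hb hp1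
  have hΨ2 := integral_rightHat_bounds hε hb hp2
  have hΓ1 := abs_integral_moment_le (continuous_leftHat (ε := ε) (a := a (x (j + 1)))) hp1
    (fun s hs => (leftHat_mem hε hb hp1 hs).1) (right_mem_Icc.2 hp1.le)
  have hΓ2 := abs_integral_moment_le (continuous_rightHat (ε := ε) (a := a (x (j + 1)))) hp2
    (fun s hs => (rightHat_mem hε hb hp2 hs).1) (left_mem_Icc.2 hp2.le)
  have ha1 : |fwdDiff x (fun k => a (x k)) (j + 1)| ≤ B := by
    rw [fwdDiff, step_succ, abs_div, div_le_iff₀ (abs_pos.2 (sub_pos.2 hp2).ne')]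
    exact h.a_lip _ _
  have hK1 : |∑ k ∈ Finset.range (N + 1), hbar N x k * (K (x (j + 1)) (x k) * z k)| ≤
      (kb + B * T * H) * M := by
    have h1 := sum_hbar_abs_le hmono (by omega) hB.le (h.K_lip_right (x (j + 1)))
      (fun j => (hstep j).2) (N := N)
    have h2 : x 0 = 0 := by rw [hx, mesh_zero]
    have h3 : x N = T := by rw [hx, mesh_last hN2]
    rw [h2, h3, sub_zero] at h1
    have h4 := h.kb_le (x (j + 1)) (Ioo_subset_Icc_self hxj)
    refine (Finset.abs_sum_le_sum_abs _ _).trans ?_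
    calc _ ≤ ∑ k ∈ Finset.range (N + 1), hbar N x k * |K (x (j + 1)) (x k)| * M := by
          refine Finset.sum_le_sum fun k hk => ?_
          rw [abs_mul, abs_mul, abs_of_nonneg (hbar_nonneg hmono k), ← mul_assoc]
          have := hbar_nonneg hmono k (N := N)
          have := hM k (Nat.lt_succ_iff.1 (Finset.mem_range.1 hk))
          gcongr
      _ ≤ _ := by
          rw [← Finset.sum_mul]
          gcongr
          linarith
  have hK2 : |∑ k ∈ Finset.range (N + 1), hbar N x k * (K' (x (j + 1)) (x k) * z k)| ≤
      B * T * M := by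
    have h1 := sum_hbar (by omega : 1 ≤ N) x
    have h2 : x 0 = 0 := by rw [hx, mesh_zero]
    have h3 : x N = T := by rw [hx, mesh_last hN2]
    rw [h2, h3, sub_zero] at h1
    refine (Finset.abs_sum_le_sum_abs _ _).trans ?_
    calc _ ≤ ∑ k ∈ Finset.range (N + 1), hbar N x k * (B * M) := by
          refine Finset.sum_le_sum fun k hk => ?_
          have hkN := Nat.lt_succ_iff.1 (Finset.mem_range.1 hk)
          rw [abs_mul, abs_mul, abs_of_nonneg (hbar_nonneg hmono k)]
          have := hbar_nonneg hmono k (N := N)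
          have := hM k hkN
          have := h.K'_le (x (j + 1)) (Ioo_subset_Icc_self hxj) (x k) (hmem hkN)
          gcongr
      _ = _ := by rw [← Finset.sum_mul, h1]; ring
  have hlinK : ∀ k : ℝ → ℝ, ∑ i ∈ Finset.range (N + 1), hbar N x i * (k (x i) * z i) =
      (∑ i ∈ Finset.range (N + 1), hbar N x i * (k (x i) * v (x i))) -
      ∑ i ∈ Finset.range (N + 1), hbar N x i * (k (x i) * y i) := by
    intro k
    rw [← Finset.sum_sub_distrib]
    refine Finset.sum_congr rfl fun i _ => ?_
    rw [hz]; ring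
  rw [hlinK (K (x (j + 1)))] at hK1
  rw [hlinK (K' (x (j + 1)))] at hK2
  set Ψ1 := ∫ s in (x j)..(x (j + 1)), leftHat ε (a (x (j + 1))) (x j) (x (j + 1)) s
  set Ψ2 := ∫ s in (x (j + 1))..(x (j + 2)),
    rightHat ε (a (x (j + 1))) (x (j + 1)) (x (j + 2)) s
  set Γ1 := ∫ s in (x j)..(x (j + 1)),
    (s - x (j + 1)) * leftHat ε (a (x (j + 1))) (x j) (x (j + 1)) s
  set Γ2 := ∫ s in (x (j + 1))..(x (j + 2)),
    (s - x (j + 1)) * rightHat ε (a (x (j + 1))) (x (j + 1)) (x (j + 2)) s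
  set SKv := ∑ k ∈ Finset.range (N + 1), hbar N x k * (K (x (j + 1)) (x k) * v (x k))
  set SKy := ∑ k ∈ Finset.range (N + 1), hbar N x k * (K (x (j + 1)) (x k) * y k)
  set SKv' := ∑ k ∈ Finset.range (N + 1), hbar N x k * (K' (x (j + 1)) (x k) * v (x k))
  set SKy' := ∑ k ∈ Finset.range (N + 1), hbar N x k * (K' (x (j + 1)) (x k) * y k)
  set ρ := cellConsistency abar ε C B δ δa (x j) (x (j + 1)) +
        cellConsistency abar ε C B δ δa (x (j + 1)) (x (j + 2))
  set G := a (x (j + 1)) + expWeight ε (a (x (j + 1))) (x (j + 2) - x (j + 1))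
  set g := expWeight ε (a (x (j + 1))) (x (j + 1) - x j)
  set aξ := fwdDiff x (fun k => a (x k)) (j + 1)
  set fξ := fwdDiff x (fun k => f (x k)) (j + 1)
  have hdz1 : z (j + 1) - z j = (v (x (j + 1)) - v (x j)) - (y (j + 1) - y j) := by
    rw [hz, hz]; ring
  have hdz2 : z (j + 2) - z (j + 1) = (v (x (j + 2)) - v (x (j + 1))) - (y (j + 2) - y (j + 1)) := by
    rw [hz, hz]; ring
  have hm1 : |Γ1 * ((z (j + 1) - z j) / (x (j + 1) - x j))| ≤ H * |z (j + 1) - z j| := by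
    have hp := (hstep j).1
    rw [abs_mul, abs_div, abs_of_pos hp, mul_div_assoc', div_le_iff₀ hp]
    calc _ ≤ ((x (j + 1) - x j) * H) * |z (j + 1) - z j| := by
          refine mul_le_mul_of_nonneg_right (hΓ1.trans ?_) (abs_nonneg _)
          exact mul_le_mul_of_nonneg_left (hΨ1.2.trans (hstep j).2) hp.le
      _ = _ := by ring
  have hm2 : |Γ2 * ((z (j + 2) - z (j + 1)) / (x (j + 2) - x (j + 1)))| ≤
      H * |z (j + 2) - z (j + 1)| := by
    have hp : 0 < x (j + 2) - x (j + 1) := (hstep (j + 1)).1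
    rw [abs_mul, abs_div, abs_of_pos hp, mul_div_assoc', div_le_iff₀ hp]
    calc _ ≤ ((x (j + 2) - x (j + 1)) * H) * |z (j + 2) - z (j + 1)| := by
          refine mul_le_mul_of_nonneg_right (hΓ2.trans ?_) (abs_nonneg _)
          exact mul_le_mul_of_nonneg_left (hΨ2.2.trans (hstep (j + 1)).2) hp.le
      _ = _ := by ring
  have hpert : |aξ * (Γ1 * ((z (j + 1) - z j) / (x (j + 1) - x j)) +
      Γ2 * ((z (j + 2) - z (j + 1)) / (x (j + 2) - x (j + 1))))| ≤
      B * H * (|z (j + 1) - z j| + |z (j + 2) - z (j + 1)|) := by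
    rw [abs_mul]
    have h1 := (abs_add_le (Γ1 * ((z (j + 1) - z j) / (x (j + 1) - x j)))
      (Γ2 * ((z (j + 2) - z (j + 1)) / (x (j + 2) - x (j + 1))))).trans (add_le_add hm1 hm2)
    calc _ ≤ B * (H * |z (j + 1) - z j| + H * |z (j + 2) - z (j + 1)|) :=
          mul_le_mul ha1 h1 (abs_nonneg _) hB.le
      _ = _ := by ring
  have hΓ : |Γ1 + Γ2| ≤ H * (Ψ1 + Ψ2) := by
    have h1 : (x (j + 1) - x j) * Ψ1 ≤ H * Ψ1 := mul_le_mul_of_nonneg_right (hstep j).2 hΨ1.1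
    have h2 : (x (j + 2) - x (j + 1)) * Ψ2 ≤ H * Ψ2 :=
      mul_le_mul_of_nonneg_right (hstep (j + 1)).2 hΨ2.1
    have := abs_add_le Γ1 Γ2
    linarith
  have hΨ0 : 0 ≤ Ψ1 + Ψ2 := add_nonneg hΨ1.1 hΨ2.1
  have hkern : |lam * ((SKv - SKy) * (Ψ1 + Ψ2) + (SKv' - SKy') * (Γ1 + Γ2))| ≤
      |lam| * ((kb + 2 * B * T * H) * M) * (Ψ1 + Ψ2) := by
    rw [abs_mul, mul_assoc |lam|]
    refine mul_le_mul_of_nonneg_left ((abs_add_le _ _).trans ?_) (abs_nonneg _)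
    rw [abs_mul, abs_mul, abs_of_nonneg hΨ0]
    calc _ ≤ (kb + B * T * H) * M * (Ψ1 + Ψ2) + B * T * M * (H * (Ψ1 + Ψ2)) := by gcongr
      _ = _ := by ring
  have hfinal : (z (j + 2) - z (j + 1)) * G - (z (j + 1) - z j) * g =
      lam * ((SKv - SKy) * (Ψ1 + Ψ2) + (SKv' - SKy') * (Γ1 + Γ2)) +
      (-(aξ * (Γ1 * ((z (j + 1) - z j) / (x (j + 1) - x j)) +
        Γ2 * ((z (j + 2) - z (j + 1)) / (x (j + 2) - x (j + 1))))) +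
      ((v (x (j + 2)) - v (x (j + 1))) * G - (v (x (j + 1)) - v (x j)) * g +
        aξ * (Γ1 * ((v (x (j + 1)) - v (x j)) / (x (j + 1) - x j)) +
          Γ2 * ((v (x (j + 2)) - v (x (j + 1))) / (x (j + 2) - x (j + 1)))) -
        ((f (x (j + 1)) + lam * SKv) * (Ψ1 + Ψ2) + (fξ + lam * SKv') * (Γ1 + Γ2)))) := by
    rw [hdz1, hdz2]
    linear_combination -hyeq
  rw [hfinal]
  refine (abs_add_le _ _).trans (add_le_add hkern ((abs_add_le _ _).trans (add_le_add ?_ hcons)))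
  rw [abs_neg]
  exact hpert

theorem sum_consecutive_le {n : ℕ} {u : ℕ → ℝ} (hu : ∀ j, 0 ≤ u j) :
    ∑ j ∈ Finset.range n, (u j + u (j + 1)) ≤ 2 * ∑ j ∈ Finset.range (n + 1), u j := by
  rw [Finset.sum_add_distrib]
  have h1 := Finset.sum_range_succ u n
  have h2 := Finset.sum_range_succ' u n
  have := hu n
  have := hu 0
  linarith

/-- Uniform error estimate for globally defined smooth coefficients. -/
theorem smooth_error_estimate (h : SmoothData T abar B kb a f K K')
    (hlam : |lam| * (kb * T) < abar) :
    ∃ (C : ℝ) (N₀ : ℕ), ∀ (ε : ℝ) (N : ℕ), 0 < ε → ε ≤ 1 → N₀ ≤ N → Even N →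
      ∀ (v : ℝ → ℝ) (y : ℕ → ℝ), IsSolution T ε lam α β a f K v →
        IsDiscreteSolution ε lam α β a f K N (mesh T abar ε N) y →
        maxNorm N (fun i => v (mesh T abar ε N i) - y i) ≤ C * ((N : ℝ) ^ 2)⁻¹ * Real.log N := by
  have hT := h.T_pos
  have hab := h.abar_pos
  have hB := h.B_pos
  have hkb := h.kb_nonneg
  obtain ⟨C, hC, hdec⟩ := exists_decomposition (α := α) (β := β) h hlam
  set κ := |lam| * (kb * T) / abar with hκ
  have hκ1 : κ < 1 := (div_lt_one hab).2 hlam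
  set c' := (|lam| * (2 * B * T) * T + 4 * B) / abar with hc'
  have hc'0 : 0 ≤ c' := by positivity
  set δ₀ := 8 * B * T ^ 2 + |lam| * (B * C * (6 + 6 / abar) *
        (4 * T ^ 3 + 2 * T / abar + 2 * T + 4 * T ^ 2) + 4 * T ^ 3 * B * C) with hδ₀
  set δ₁ := 8 * B * T ^ 2 with hδ₁
  set R := T * δ₀ + δ₁ * (C * (T + 1 / abar)) +
        B * (C * (1 + 2 / abar)) * (4 * T ^ 3 + 2 * T / abar + 2 * T) with hR
  obtain ⟨N₁, hN₁⟩ := exists_nat_ge (4 * T * c' / (1 - κ))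
  refine ⟨4 * R / (abar * (1 - κ)), max 3 N₁, ?_⟩
  intro ε N hε hε1 hNN he v y hv hy
  have hN : 3 ≤ N := (le_max_left _ _).trans hNN
  have hN2 : 2 ≤ N := by omega
  have hNp : (0 : ℝ) < N := by
    have : 0 < N := by omega
    exact_mod_cast this
  obtain ⟨w, l, D⟩ := hdec ε v hε hε1 hv
  have hFc : Continuous (fun ξ => f ξ + lam * ∫ η in (0 : ℝ)..T, K ξ η * v η) :=
    continuous_of_abs_sub_le (rhs_bounds (lam := lam) h hv.continuousOn D.v_le).2
  set x := mesh T abar ε N with hx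
  have hmono : StrictMono x := mesh_strictMono hT hab hε hN2 he
  have hstep := mesh_step_bounds hT hab hε hN2 he
  have hx0 : x 0 = 0 := mesh_zero
  have hxN : x N = T := mesh_last hN2
  set z : ℕ → ℝ := fun i => v (x i) - y i with hz
  set M := maxNorm N z with hMdef
  have hM : ∀ k ≤ N, |z k| ≤ M := fun k hk =>
    Finset.le_sup' (fun i => |z i|) (Finset.mem_range.2 (Nat.lt_succ_of_le hk))
  have hM0 : 0 ≤ M := (abs_nonneg _).trans (hM 0 (Nat.zero_le _))
  have hz0 : z 0 = 0 := by simp only [z]; rw [hx0, hv.left_bc, hy.left_bc, sub_self]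
  have hzN : z N = 0 := by simp only [z]; rw [hxN, hv.right_bc, hy.right_bc, sub_self]
  obtain ⟨n, rfl⟩ : ∃ n, N = n + 1 := ⟨N - 1, by omega⟩
  set H := 2 * T / ((n + 1 : ℕ) : ℝ) with hH
  have hH0 : 0 ≤ H := by positivity
  set Q := (((n + 1 : ℕ) : ℝ) ^ 2)⁻¹ * Real.log ((n + 1 : ℕ) : ℝ) with hQ
  set δ := δ₀ * Q with hδ
  set δa := δ₁ * Q with hδa
  have hrec := fun j (hj : j + 1 < n + 1) =>
    error_recurrence h D hFc hε hN he x hx hH hδ hδa hy (fun k => rfl) hM hj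
  have hQ0 : 0 ≤ Q := by
    have := one_le_log hN
    positivity
  have hδ₀0 : 0 ≤ δ₀ := by positivity
  have hcell : ∀ j, 0 ≤ cellConsistency abar ε C B δ δa (x j) (x (j + 1)) := by
    intro j
    have h1 := layerDrop_nonneg hab hε (hmono.monotone (Nat.le_succ j))
    have h2 := cellErr_nonneg hab hε (hmono.monotone (Nat.le_succ j))
    have h3 : 0 < x (j + 1) - x j := (hstep j).1
    rw [cellConsistency]
    positivity
  have hsum0 : ∀ k, ∑ j ∈ Finset.range k, (z (j + 1) - z j) = z k := by
    intro k
    rw [Finset.sum_range_sub, hz0, sub_zero]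
  obtain ⟨E, hE1, hE2, hE3⟩ := recurrence_stability (n := n) (c := abar)
    (s := |lam| * ((kb + 2 * B * T * H) * M))
    (G := fun j => a (x (j + 1)) + expWeight ε (a (x (j + 1))) (x (j + 2) - x (j + 1)))
    (g := fun j => expWeight ε (a (x (j + 1))) (x (j + 1) - x j))
    (a := fun j => a (x (j + 1)))
    (Ψ := fun j => (∫ s in (x j)..(x (j + 1)), leftHat ε (a (x (j + 1))) (x j) (x (j + 1)) s) +
        ∫ s in (x (j + 1))..(x (j + 2)), rightHat ε (a (x (j + 1))) (x (j + 1)) (x (j + 2)) s)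
    (h := fun j => x (j + 1) - x j)
    (e := fun j => B * H * (|z (j + 1) - z j| + |z (j + 2) - z (j + 1)|) +
        (cellConsistency abar ε C B δ δa (x j) (x (j + 1)) +
        cellConsistency abar ε C B δ δa (x (j + 1)) (x (j + 2))))
    (d := fun j => z (j + 1) - z j)
    (r := fun j => (z (j + 2) - z (j + 1)) *
          (a (x (j + 1)) + expWeight ε (a (x (j + 1))) (x (j + 2) - x (j + 1)))
        - (z (j + 1) - z j) * expWeight ε (a (x (j + 1))) (x (j + 1) - x j))
    hab (by positivity)
    (fun j => (expWeight_pos hε (h.a_pos _) (hstep j).1).le)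
    (fun j _ => expWeight_dominated hε hab (h.le_a _) (h.le_a _) (hstep (j + 1)).1)
    (fun j => (hstep j).1.le) (fun j => h.le_a _)
    (fun j _ => add_nonneg
      (integral_leftHat_bounds hε (h.a_pos _) (hmono (Nat.lt_succ_self j))).1
      (integral_rightHat_bounds hε (h.a_pos _) (hmono (Nat.lt_succ_self (j + 1)))).1)
    (fun j => by
      have := hcell j
      have : 0 ≤ cellConsistency abar ε C B δ δa (x (j + 1)) (x (j + 2)) := hcell (j + 1)
      positivity)
    (fun j _ => by
      have e1 := sub_mul_integral_leftHat hε (h.a_pos (x (j + 1))) (hmono (Nat.lt_succ_self j))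
      have e2 := add_mul_integral_rightHat hε (h.a_pos (x (j + 1)))
        (hmono (Nat.lt_succ_self (j + 1)))
      linear_combination e1 - e2)
    (fun j hj => hrec j (by omega)) (fun j _ => rfl)
    (by rw [hsum0, hzN])
  have hME : M ≤ E := by
    refine Finset.sup'_le _ _ fun k hk => ?_
    have := hE1 k (Nat.lt_succ_iff.1 (Finset.mem_range.1 hk))
    rwa [hsum0] at this
  have hE0 : 0 ≤ E := hM0.trans hME
  have hxsum : ∑ j ∈ Finset.range (n + 1), (x (j + 1) - x j) = T := by
    rw [Finset.sum_range_sub, hx0, hxN, sub_zero]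
  have hesum : ∑ j ∈ Finset.range n, (B * H * (|z (j + 1) - z j| + |z (j + 2) - z (j + 1)|) +
        (cellConsistency abar ε C B δ δa (x j) (x (j + 1)) +
        cellConsistency abar ε C B δ δa (x (j + 1)) (x (j + 2)))) ≤
      B * H * (2 * (2 * E)) + 2 * (R * Q) := by
    rw [Finset.sum_add_distrib, ← Finset.mul_sum]
    have h1 := sum_consecutive_le (n := n) (u := fun j => |z (j + 1) - z j|) fun j => abs_nonneg _
    have h2 := sum_consecutive_le (n := n)
      (u := fun j => cellConsistency abar ε C B δ δa (x j) (x (j + 1))) hcell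
    have h3 := sum_cellConsistency_le (δ₀ := δ₀) (δ₁ := δ₁) hT hab hε hC.le hB.le
      (by positivity) hN he
    have h4 : B * H * ∑ j ∈ Finset.range n, (|z (j + 1) - z j| + |z (j + 2) - z (j + 1)|) ≤
        B * H * (2 * (2 * E)) := by
      refine mul_le_mul_of_nonneg_left ?_ (by positivity)
      exact h1.trans (by linarith)
    refine add_le_add h4 (h2.trans ?_)
    exact mul_le_mul_of_nonneg_left h3 two_pos.le
  rw [hxsum] at hE3
  have hbound : E ≤ κ * E + H * c' * E + abar⁻¹ * (2 * (R * Q)) := by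
    have h1 := mul_le_mul_of_nonneg_left hesum (inv_nonneg.2 hab.le)
    have h2 : |lam| * ((kb + 2 * B * T * H) * M) / abar * T ≤
        |lam| * ((kb + 2 * B * T * H) * E) / abar * T := by gcongr
    calc E ≤ |lam| * ((kb + 2 * B * T * H) * E) / abar * T +
          abar⁻¹ * (B * H * (2 * (2 * E)) + 2 * (R * Q)) := by linarith
      _ = _ := by
        rw [hκ, hc']
        field_simp
        ring
  have hHc : H * c' ≤ (1 - κ) / 2 := by
    have h1 : (N₁ : ℝ) ≤ ((n + 1 : ℕ) : ℝ) := by exact_mod_cast (le_max_right _ _).trans hNN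
    have h2 := hN₁.trans h1
    rw [div_le_iff₀ (by linarith)] at h2
    rw [hH, div_mul_eq_mul_div, div_le_iff₀ hNp]
    linarith
  have hfin : E * ((1 - κ) / 2) ≤ abar⁻¹ * (2 * (R * Q)) := by
    have := mul_le_mul_of_nonneg_right hHc hE0
    linarith
  have h1κ : 0 < 1 - κ := by linarith
  refine hME.trans ?_
  rw [mul_assoc, ← hQ]
  calc E = E * ((1 - κ) / 2) * (2 / (1 - κ)) := by field_simp
    _ ≤ abar⁻¹ * (2 * (R * Q)) * (2 / (1 - κ)) :=
      mul_le_mul_of_nonneg_right hfin (by positivity)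
    _ = _ := by field_simp; ring

end main

/-! ### Reduction to globally defined coefficients -/

/-- A `C²` function on a compact convex set has uniformly bounded values and first derivatives and
satisfies a uniform quadratic Taylor estimate. -/
theorem exists_taylor_bound {E : Type*} [NormedAddCommGroup E] [NormedSpace ℝ E] {S : Set E}
    (hSc : IsCompact S) (hS : Convex ℝ S) (hSu : UniqueDiffOn ℝ S) {φ : E → ℝ}
    (hφ : ContDiffOn ℝ 2 φ S) :
    ∃ B : ℝ, 0 ≤ B ∧ (∀ x ∈ S, |φ x| ≤ B) ∧ (∀ x ∈ S, ‖fderivWithin ℝ φ S x‖ ≤ B) ∧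
      (∀ x ∈ S, ∀ y ∈ S, |φ x - φ y| ≤ B * ‖x - y‖) ∧
      ∀ x ∈ S, ∀ y ∈ S, |φ y - φ x - fderivWithin ℝ φ S x (y - x)| ≤ B * ‖y - x‖ ^ 2 := by
  have hφ' : ContDiffOn ℝ 1 (fderivWithin ℝ φ S) S := hφ.fderivWithin hSu (by norm_num)
  obtain ⟨B₀, hB₀⟩ := hSc.exists_bound_of_continuousOn hφ.continuousOn
  obtain ⟨B₁, hB₁⟩ := hSc.exists_bound_of_continuousOn hφ'.continuousOn
  obtain ⟨B₂, hB₂⟩ := hSc.exists_bound_of_continuousOn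
    (hφ'.continuousOn_fderivWithin hSu le_rfl)
  set B := max 0 (max B₀ (max B₁ B₂))
  have hb0 : B₀ ≤ B := (le_max_left _ _).trans (le_max_right _ _)
  have hb1 : B₁ ≤ B := (le_max_left _ _).trans ((le_max_right _ _).trans (le_max_right _ _))
  have hb2 : B₂ ≤ B := (le_max_right _ _).trans ((le_max_right _ _).trans (le_max_right _ _))
  have hd : DifferentiableOn ℝ φ S := hφ.differentiableOn (by norm_num)
  have hd' : DifferentiableOn ℝ (fderivWithin ℝ φ S) S := hφ'.differentiableOn (by norm_num)
  refine ⟨B, le_max_left _ _, fun x hx => (hB₀ x hx).trans hb0, fun x hx => (hB₁ x hx).trans hb1,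
    ?_, ?_⟩
  · intro x hx y hy
    exact hS.norm_image_sub_le_of_norm_fderivWithin_le hd (fun z hz => (hB₁ z hz).trans hb1) hy hx
  · intro x hx y hy
    have hsub : S ∩ Metric.closedBall x ‖y - x‖ ⊆ S := inter_subset_left
    have key := (hS.inter (convex_closedBall x ‖y - x‖)).norm_image_sub_le_of_norm_hasFDerivWithin_le'
      (f := φ) (f' := fderivWithin ℝ φ S) (φ := fderivWithin ℝ φ S x) (C := B * ‖y - x‖)
      (x := x) (y := y)
      (fun z hz => ((hd z hz.1).hasFDerivWithinAt).mono hsub)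
      (fun z hz => by
        have h1 := hS.norm_image_sub_le_of_norm_fderivWithin_le hd'
          (fun z hz => (hB₂ z hz).trans hb2) hx hz.1
        refine h1.trans (mul_le_mul_of_nonneg_left ?_ (le_max_left _ _))
        have := hz.2
        rwa [Metric.mem_closedBall, dist_eq_norm] at this)
      ⟨hx, by simp⟩ ⟨hy, by simp [dist_eq_norm]⟩
    rw [Real.norm_eq_abs] at key
    refine key.trans (le_of_eq ?_)
    ring

/-- Projection of the real line onto `[0, T]`. -/
noncomputable def clamp (T t : ℝ) : ℝ := max 0 (min T t)

section clamp

variable {T : ℝ}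

theorem clamp_mem (hT : 0 ≤ T) (t : ℝ) : clamp T t ∈ Icc 0 T :=
  ⟨le_max_left _ _, max_le hT (min_le_left _ _)⟩

theorem clamp_of_mem {t : ℝ} (ht : t ∈ Icc 0 T) : clamp T t = t := by
  rw [clamp, min_eq_right ht.2, max_eq_right ht.1]

theorem continuous_clamp : Continuous (clamp T) :=
  continuous_const.max (continuous_const.min continuous_id)

theorem abs_clamp_sub_le (hT : 0 ≤ T) (x y : ℝ) : |clamp T x - clamp T y| ≤ |x - y| := by
  have h := (LipschitzWith.projIcc hT).dist_le_mul x y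
  rw [NNReal.coe_one, one_mul, Subtype.dist_eq, Real.dist_eq, Real.dist_eq] at h
  exact h

theorem clamp_lipschitz (hT : 0 ≤ T) {g : ℝ → ℝ} {B : ℝ} (hB : 0 ≤ B)
    (h : ∀ x ∈ Icc 0 T, ∀ y ∈ Icc 0 T, |g x - g y| ≤ B * |x - y|) (x y : ℝ) :
    |g (clamp T x) - g (clamp T y)| ≤ B * |x - y| :=
  (h _ (clamp_mem hT x) _ (clamp_mem hT y)).trans
    (mul_le_mul_of_nonneg_left (abs_clamp_sub_le hT x y) hB)

end clamp

theorem TaylorBound.mono {T B B' : ℝ} {g g' : ℝ → ℝ} (h : TaylorBound T B g g') (hB : B ≤ B') :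
    TaylorBound T B' g g' := fun x hx y hy =>
  (h x hx y hy).trans (mul_le_mul_of_nonneg_right hB (sq_nonneg _))

theorem TaylorBound.congr {T B : ℝ} {g g₁ g' : ℝ → ℝ} (h : TaylorBound T B g g')
    (hg : ∀ x ∈ Icc 0 T, g₁ x = g x) : TaylorBound T B g₁ g' := fun x hx y hy => by
  rw [hg x hx, hg y hy]
  exact h x hx y hy

theorem exists_taylorBound_of_contDiffOn {T : ℝ} (hT : 0 < T) {g : ℝ → ℝ}
    (hg : ContDiffOn ℝ 2 g (Icc 0 T)) :
    ∃ B : ℝ, 0 ≤ B ∧ (∀ x ∈ Icc 0 T, |g x| ≤ B) ∧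
      (∀ x ∈ Icc 0 T, ∀ y ∈ Icc 0 T, |g x - g y| ≤ B * |x - y|) ∧
      ∃ g', TaylorBound T B g g' := by
  obtain ⟨B, hB, h1, -, h3, h4⟩ := exists_taylor_bound isCompact_Icc (convex_Icc 0 T)
    (uniqueDiffOn_Icc hT) hg
  refine ⟨B, hB, h1, fun x hx y hy => h3 x hx y hy,
    fun x => fderivWithin ℝ g (Icc 0 T) x 1, fun x hx y hy => ?_⟩
  have := h4 x hx y hy
  rw [Real.norm_eq_abs, sq_abs] at this
  have h5 : fderivWithin ℝ g (Icc 0 T) x (y - x) =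
      fderivWithin ℝ g (Icc 0 T) x 1 * (y - x) := by
    have := (fderivWithin ℝ g (Icc 0 T) x).map_smul (y - x) 1
    rw [smul_eq_mul, mul_one, smul_eq_mul] at this
    rw [this, mul_comm]
  rwa [h5] at this

theorem integral_le_kernelBound {T : ℝ} (hT : 0 < T) {K : ℝ → ℝ → ℝ} {B : ℝ}
    (hK : ∀ x ∈ Icc 0 T, ∀ y ∈ Icc 0 T, |K x y| ≤ B) {ξ : ℝ} (hξ : ξ ∈ Icc 0 T) :
    ∫ η in (0 : ℝ)..T, |K ξ η| ≤ kernelBound T K := by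
  refine le_csSup ⟨B * |T - 0|, ?_⟩ ⟨ξ, hξ, rfl⟩
  rintro _ ⟨x, hx, rfl⟩
  refine (le_abs_self _).trans ?_
  rw [← Real.norm_eq_abs]
  refine intervalIntegral.norm_integral_le_of_norm_le_const fun t ht => ?_
  rw [uIoc_of_le hT.le] at ht
  rw [Real.norm_eq_abs, abs_abs]
  exact hK x hx t ⟨ht.1.le, ht.2⟩

/-- Clamped `C²` coefficients form a `SmoothData`. -/
theorem exists_smoothData {T abar : ℝ} (hT : 0 < T) (habar : 0 < abar) {a f : ℝ → ℝ}
    {K : ℝ → ℝ → ℝ} (ha : ContDiffOn ℝ 2 a (Icc 0 T)) (hf : ContDiffOn ℝ 2 f (Icc 0 T))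
    (hK : ContDiffOn ℝ 2 (fun p : ℝ × ℝ => K p.1 p.2) (Icc 0 T ×ˢ Icc 0 T))
    (ha_lower : ∀ ξ ∈ Icc 0 T, abar ≤ a ξ) :
    ∃ B K', SmoothData T abar B (kernelBound T K) (fun x => a (clamp T x))
      (fun x => f (clamp T x)) (fun x y => K (clamp T x) (clamp T y)) K' := by
  obtain ⟨Ba, hBa0, ha1, ha2, a', ha3⟩ := exists_taylorBound_of_contDiffOn hT ha
  obtain ⟨Bf, hBf0, hf1, hf2, f', hf3⟩ := exists_taylorBound_of_contDiffOn hT hf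
  obtain ⟨BK, hBK0, hK1, hK2, hK3, hK4⟩ := exists_taylor_bound
    (isCompact_Icc.prod isCompact_Icc) ((convex_Icc 0 T).prod (convex_Icc 0 T))
    ((uniqueDiffOn_Icc hT).prod (uniqueDiffOn_Icc hT)) hK
  set S := Icc (0 : ℝ) T ×ˢ Icc (0 : ℝ) T
  set Φ := fderivWithin ℝ (fun p : ℝ × ℝ => K p.1 p.2) S
  have hcm := clamp_mem hT.le
  have hba : Ba ≤ Ba + Bf + BK := by linarith
  have hbf : Bf ≤ Ba + Bf + BK := by linarith
  have hbK : BK ≤ Ba + Bf + BK := by linarith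
  have hclK : ∀ x ∈ Icc 0 T, ∀ y ∈ Icc 0 T, K (clamp T x) (clamp T y) = K x y :=
    fun x hx y hy => by rw [clamp_of_mem hx, clamp_of_mem hy]
  refine ⟨Ba + Bf + BK, fun x y => Φ (x, y) (1, 0), ?_⟩
  constructor
  · exact hT
  · exact habar
  · exact fun x => ha_lower _ (hcm x)
  · exact fun x => (le_abs_self _).trans ((ha1 _ (hcm x)).trans hba)
  · exact fun x y => (clamp_lipschitz hT.le hBa0 ha2 x y).trans
      (mul_le_mul_of_nonneg_right hba (abs_nonneg _))
  · exact ⟨a', (ha3.mono hba).congr fun x hx => by rw [clamp_of_mem hx]⟩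
  · exact fun x => (hf1 _ (hcm x)).trans hbf
  · exact fun x y => (clamp_lipschitz hT.le hBf0 hf2 x y).trans
      (mul_le_mul_of_nonneg_right hbf (abs_nonneg _))
  · exact ⟨f', (hf3.mono hbf).congr fun x hx => by rw [clamp_of_mem hx]⟩
  · exact hK.continuousOn.comp_continuous
      ((continuous_clamp.comp continuous_fst).prodMk (continuous_clamp.comp continuous_snd))
      fun p => ⟨hcm p.1, hcm p.2⟩
  · exact fun x y => (hK1 (clamp T x, clamp T y) ⟨hcm x, hcm y⟩).trans hbK
  · intro x y η
    refine (clamp_lipschitz (g := fun s => K s (clamp T η)) hT.le hBK0 (fun s hs t ht => ?_)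
      x y).trans (mul_le_mul_of_nonneg_right hbK (abs_nonneg _))
    simpa [Prod.norm_def] using hK3 (s, clamp T η) ⟨hs, hcm η⟩ (t, clamp T η) ⟨ht, hcm η⟩
  · intro ξ x y
    refine (clamp_lipschitz (g := fun s => K (clamp T ξ) s) hT.le hBK0 (fun s hs t ht => ?_)
      x y).trans (mul_le_mul_of_nonneg_right hbK (abs_nonneg _))
    simpa [Prod.norm_def] using hK3 (clamp T ξ, s) ⟨hcm ξ, hs⟩ (clamp T ξ, t) ⟨hcm ξ, ht⟩
  · intro x hx η hη
    have h1 := (Φ (x, η)).le_opNorm (1, 0)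
    have h2 : ‖((1 : ℝ), (0 : ℝ))‖ = 1 := by simp [Prod.norm_def]
    rw [h2, mul_one] at h1
    exact h1.trans ((hK2 _ ⟨hx, hη⟩).trans hbK)
  · intro η hη
    refine TaylorBound.mono (B := BK) (TaylorBound.congr (g := fun x => K x η) ?_
      fun x hx => hclK x hx η hη) hbK
    intro x hx y hy
    have h1 := hK4 (x, η) ⟨hx, hη⟩ (y, η) ⟨hy, hη⟩
    have h2 : ((y, η) - (x, η) : ℝ × ℝ) = (y - x) • (1, 0) := by simp
    rw [h2, map_smul, norm_smul, smul_eq_mul, Real.norm_eq_abs] at h1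
    have h3 : ‖((1 : ℝ), (0 : ℝ))‖ = 1 := by simp [Prod.norm_def]
    rw [h3, mul_one, sq_abs, mul_comm (y - x)] at h1
    exact h1
  · intro ξ hξ
    refine ⟨fun y => Φ (ξ, y) (0, 1), TaylorBound.mono (B := BK) (TaylorBound.congr
      (g := fun y => K ξ y) ?_ fun y hy => hclK ξ hξ y hy) hbK⟩
    intro x hx y hy
    have h1 := hK4 (ξ, x) ⟨hξ, hx⟩ (ξ, y) ⟨hξ, hy⟩
    have h2 : ((ξ, y) - (ξ, x) : ℝ × ℝ) = (y - x) • (0, 1) := by simp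
    rw [h2, map_smul, norm_smul, smul_eq_mul, Real.norm_eq_abs] at h1
    have h3 : ‖((0 : ℝ), (1 : ℝ))‖ = 1 := by simp [Prod.norm_def]
    rw [h3, mul_one, sq_abs, mul_comm (y - x)] at h1
    exact h1
  · intro ξ hξ
    have h1 : ∫ η in (0 : ℝ)..T, |K (clamp T ξ) (clamp T η)| = ∫ η in (0 : ℝ)..T, |K ξ η| := by
      apply intervalIntegral.integral_congr
      intro η hη
      rw [uIcc_of_le hT.le] at hη
      simp only [hclK ξ hξ η hη]
    rw [h1]
    exact integral_le_kernelBound hT (fun x hx y hy => hK1 (x, y) ⟨hx, hy⟩) hξ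

theorem IsSolution.comp_clamp {T ε lam α β : ℝ} (hT : 0 < T) {a f v : ℝ → ℝ} {K : ℝ → ℝ → ℝ}
    (h : IsSolution T ε lam α β a f K v) :
    IsSolution T ε lam α β (fun x => a (clamp T x)) (fun x => f (clamp T x))
      (fun x y => K (clamp T x) (clamp T y)) v := by
  refine ⟨h.continuousOn, h.contDiffOn, fun ξ hξ => ?_, h.left_bc, h.right_bc⟩
  have hξ' := Ioo_subset_Icc_self hξ
  rw [clamp_of_mem hξ', h.equation ξ hξ]
  congr 2
  apply intervalIntegral.integral_congr
  intro η hη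
  rw [uIcc_of_le hT.le] at hη
  simp only [clamp_of_mem hη]

theorem IsDiscreteSolution.comp_clamp {T ε lam α β : ℝ} {a f : ℝ → ℝ} {K : ℝ → ℝ → ℝ} {N : ℕ}
    {x y : ℕ → ℝ} (hmem : ∀ j ≤ N, x j ∈ Icc 0 T)
    (hint : ∀ j, 1 ≤ j → j ≤ N - 1 → x j ∈ Ioo 0 T)
    (h : IsDiscreteSolution ε lam α β a f K N x y) :
    IsDiscreteSolution ε lam α β (fun x => a (clamp T x)) (fun x => f (clamp T x))
      (fun x y => K (clamp T x) (clamp T y)) N x y := by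
  refine ⟨fun i hi1 hiN => ?_, h.left_bc, h.right_bc⟩
  have h0 : clamp T (x i) = x i := clamp_of_mem (hmem i (by omega))
  have h1 : clamp T (x (i + 1)) = x (i + 1) := clamp_of_mem (hmem (i + 1) (by omega))
  have heq := h.equation i hi1 hiN
  have hchi1 : chi1 ε (fun x => a (clamp T x)) N x i = chi1 ε a N x i := by
    simp only [chi1, h0]
  have hchi2 : chi2 ε (fun x => a (clamp T x)) N x i = chi2 ε a N x i := by
    simp only [chi2, h0]
  have hgam1 : gamma1 ε (fun x => a (clamp T x)) N x i = gamma1 ε a N x i := by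
    simp only [gamma1, h0]
  have hgam2 : gamma2 ε (fun x => a (clamp T x)) N x i = gamma2 ε a N x i := by
    simp only [gamma2, h0]
  have hdisc : ∀ j ∈ Finset.range (N + 1), discreteKernel ε (fun x => a (clamp T x))
      (fun x y => K (clamp T x) (clamp T y)) N x i j = discreteKernel ε a K N x i j := by
    intro j hj
    have hj' : clamp T (x j) = x j :=
      clamp_of_mem (hmem j (Nat.lt_succ_iff.1 (Finset.mem_range.1 hj)))
    have hd : deriv (fun ξ => K (clamp T ξ) (x j)) (x i) = deriv (fun ξ => K ξ (x j)) (x i) := by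
      apply Filter.EventuallyEq.deriv_eq
      filter_upwards [isOpen_Ioo.mem_nhds (hint i hi1 hiN)] with ξ hξ
      rw [clamp_of_mem (Ioo_subset_Icc_self hξ)]
    simp only [discreteKernel, hchi1, hchi2, hgam1, hgam2, h0, hj', hd]
  rw [Finset.sum_congr rfl fun j hj => by rw [hdisc j hj]]
  simp only [theta, coeffA, fHat, aHat1, aHat2, fwdDiff, hchi1, hchi2, hgam1, hgam2, h0, h1] at heq ⊢
  exact heq

end FredholmScheme

theorem mainTheorem1
    (T abar lam α β : ℝ) (hT : 0 < T) (habar : 0 < abar)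
    (a f : ℝ → ℝ) (K : ℝ → ℝ → ℝ)
    (ha : ContDiffOn ℝ 2 a (Set.Icc 0 T))
    (hf : ContDiffOn ℝ 2 f (Set.Icc 0 T))
    (hK : ContDiffOn ℝ 2 (fun p : ℝ × ℝ => K p.1 p.2) (Set.Icc 0 T ×ˢ Set.Icc 0 T))
    (ha_lower : ∀ ξ ∈ Set.Icc 0 T, abar ≤ a ξ)
    (hlam : |lam| * (FredholmScheme.kernelBound T K * T) < abar) :
    ∃ (C : ℝ) (N₀ : ℕ), ∀ (ε : ℝ) (N : ℕ), 0 < ε → ε ≤ 1 → N₀ ≤ N → Even N →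
      ∀ (v : ℝ → ℝ) (y : ℕ → ℝ),
        FredholmScheme.IsSolution T ε lam α β a f K v →
        FredholmScheme.IsDiscreteSolution ε lam α β a f K N
          (FredholmScheme.mesh T abar ε N) y →
        FredholmScheme.maxNorm N (fun i => v (FredholmScheme.mesh T abar ε N i) - y i)
          ≤ C * ((N : ℝ) ^ 2)⁻¹ * Real.log N := by
  obtain ⟨B, K', h⟩ := FredholmScheme.exists_smoothData hT habar ha hf hK ha_lower
  obtain ⟨C, N₀, hC⟩ := FredholmScheme.smooth_error_estimate (α := α) (β := β) h hlam
  refine ⟨C, max 2 N₀, fun ε N hε hε1 hN he v y hv hy => ?_⟩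
  have hN2 : 2 ≤ N := (le_max_left _ _).trans hN
  have hmono := FredholmScheme.mesh_strictMono hT habar hε hN2 he
  refine hC ε N hε hε1 ((le_max_right _ _).trans hN) he v y (hv.comp_clamp hT)
    (hy.comp_clamp (fun j hj => FredholmScheme.mesh_mem hT habar hε hN2 he hj) fun j hj1 hjN => ?_)
  have h1 := hmono (by omega : 0 < j)
  have h2 := hmono (by omega : j < N)
  rw [FredholmScheme.mesh_zero] at h1
  rw [FredholmScheme.mesh_last hN2] at h2
  exact ⟨h1, h2⟩
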